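/- **Setting.** Let $H_{\mathbb Z}$ be a free $\mathbb Z$-module of finite rank $2n$ with a non-degenerate alternating form $\langle\,,\rangle$, let $H_{\mathbb R},H_{\mathbb C}$ be its scalar extensions, $G=\mathrm{Sp}(H_{\mathbb R})$, $\mathfrak g=\mathrm{Lie}\,G$, $G_{\mathbb C}=\mathrm{Sp}(H_{\mathbb C})$. Fix Hodge numbers $h^{p,-p-1}$. Let $\check D$ be the set of decreasing filtrations $F$ of $H_{\mathbb C}$ with $\dim F^p=\sum_{r\ge p}h^{r,-r-1}$ and $F^p=(F^{-p})^{\perp}$, and let $D\subset\check D$ be the period domain of those $F$ with $H_{\mathbb C}=F^p\oplus\overline{F^{-p}}$ for all $p$ and $i^{2p+1}\langle v,\bar v\rangle>0$ for $0\ne v\in H^{p,-p-1}=F^p\cap\overline{F^{-p-1}}$. For $F\in D$ put $H^{\rm ev}=\bigoplus_{p\text{ even}}H^{p,-p-1}$, $H^{\rm od}=\bigoplus_{p\text{ odd}}H^{p,-p-1}$, let $K_F\subset G$ be the stabilizer of $H^{\rm ev}$ (the maximal compact subgroup containing the isotropy group of $F$), and let $C_F=K_FF$. Let $\mathcal M_{\check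 D}=\{gC_F: g\in G_{\mathbb C},\,F\in D\}$ with the quotient topology from $G_{\mathbb C}$, $\mathcal M_D=\{C\in\mathcal M_{\check D}: C\subset D\}$, and $\mathcal M_D^{\rm cl}$ the closure of $\mathcal M_D$ in $\mathcal M_{\check D}$. Let $\mathcal B$ (resp. $\overline{\mathcal B}$) be the set of Lagrangian subspaces of $H_{\mathbb C}$ on which the Hermitian form $i\langle x,\bar y\rangle$ is positive (resp. negative) definite, and $\mathcal B^{\rm cl},\overline{\mathcal B}^{\rm cl}$ the closures in the Lagrangian Grassmannian. The projections are $p^{\rm ev}(gC_F)=gH^{\rm ev}$ and $p^{\rm od}(gC_F)=gH^{\rm od}$ if $h^{p,-p-1}\neq0$ for some even and for some odd $p\ge0$. If $h^{p,-p-1}\ne 0$ for no odd $p\ge0$, then $p^{\rm ev}(gC_F)=gH^{\rm ev}$ and $p^{\rm od}=\overline{p^{\rm ev}}$; if for odd but for no even $p\ge0$, then $p^{\rm od}(gC_F)=gH^{\rm od}$ and $p^{\rm ev}=\overline{p^{\rm od}}$. **Nilpotent orbits.** $(\sigma,\exp(\sigma_{\mathbb C})F)$ is a nilpotent orbit if $\sigma\subset\mathfrak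 g$ is a cone of commuting nilpotent elements generated by finitely many rational ones, $F\in\check D$, $\exp(zN)F\in D$ for $\operatorname{Im}z\gg0$ and $N$ in the relative interior $\sigma^\circ$, and $NF^p\subset F^{p-1}$ for $N\in\sigma$. For $N^2=0$ let $W(N)_0=H$, $W(N)_{-1}=\ker N$, $W(N)_{-2}=\operatorname{Im}N$, $W(N)_{-3}=0$, and let $I^{p,q}$ be the Deligne components of $(W(N),F)$. The nilpotent orbit is of even type (resp. odd type) if for all $N\in\sigma^\circ$ one has $N^2=0$ and $I^{p,-p}=0$ for every odd (resp. even) $p$. **The boundary cycle.** Let $N\in\sigma^\circ$, $N^2=0$, $F'\in\exp(\sigma_{\mathbb C})F$. Let $\delta\in L^{-1,-1}_{\mathbb R}(W(N),F')=\{\delta\in\mathfrak g:\delta I^{p,q}\subset\bigoplus_{r<p,\,s<q}I^{r,s}\}$ be such that $\hat F=e^{-i\delta}F'$ makes $(W(N),\hat F)$ an $\mathbb R$-split limiting mixed Hodge structure. Let $n_-=\begin{pmatrix}0&1\\0&0\end{pmatrix}$, $h=\begin{pmatrix}-1&0\\0&1\end{pmatrix}$, $n_+=\begin{pmatrix}0&0\\1&0\end{pmatrix}$.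 Let $\rho:SL(2,\mathbb C)\to G_{\mathbb C}$ be a homomorphism of Lie groups defined over $\mathbb R$ and $\varphi:\mathbb P^1\to\check D$ a map with $\rho(g)\varphi(z)=\varphi(gz)$, $\varphi(0)=\hat F$, $\rho_*(n_-)=N$, $\rho_*(h)=Y$ acting by $p+q+1$ on the components $I^{p,q}$ of $(W(N),\hat F)$, and such that $\rho_*$ is a $(0,0)$-morphism of Hodge structures relative to $i$ and $F_0=\varphi(i)$. Put $N^+=\rho_*(n_+)$, $X=\tfrac12(iN-Y+iN^+)$ and $C_0=C_{F_0}$. **Theorem.** Let $(\sigma,\exp(\sigma_{\mathbb C})F)$ be a nilpotent orbit of even type (resp. odd type). Then for all $N\in\sigma^\circ$ and $F'\in\exp(\sigma_{\mathbb C})F$ data as above exist, and for all such data $\exp(X)C_0\in\mathcal M_D^{\rm cl}$. The point $p^{\rm ev}(\exp(X)C_0)\in\mathcal B^{\rm cl}$ (resp. $p^{\rm od}(\exp(X)C_0)\in\overline{\mathcal B}^{\rm cl}$) does not depend on $N\in\sigma^\circ$, on $F'\in\exp(\sigma_{\mathbb C})F$, or on the data. It equals $$\sum_{p\text{ even}}I^{p,-p-1}+\operatorname{Im}N_{\mathbb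 C}\qquad\Bigl(\text{resp. }\sum_{p\text{ odd}}I^{p,-p-1}+\operatorname{Im}N_{\mathbb C}\Bigr),$$ where $I^{p,-p-1}$ are the Deligne components of $(W(N),F')$, for every such $N$ and $F'$. -/

import Mathlib

open Complex Matrix Set

namespace CycleBoundary

noncomputable section

/-! The lattice is `H_ℤ = ι → ℤ` with a nondegenerate alternating form given by its Gram matrix
`Q`; `H_ℝ = ι → ℝ`, `H_ℂ = ι → ℂ`, and complex conjugation is taken coordinatewise. -/

variable {ι : Type*} [Fintype ι] [DecidableEq ι]

/-- The bilinear form `⟨x, y⟩` on `H_ℂ`. -/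
def form (Q : Matrix ι ι ℤ) (x y : ι → ℂ) : ℂ :=
  x ⬝ᵥ ((Q.map (Int.cast : ℤ → ℂ)) *ᵥ y)

/-- Complex conjugation on `H_ℂ`. -/
def conjVec (x : ι → ℂ) : ι → ℂ := fun i => (starRingEnd ℂ) (x i)

/-- The conjugate of a complex subspace of `H_ℂ`. -/
def conjSub (V : Submodule ℂ (ι → ℂ)) : Submodule ℂ (ι → ℂ) where
  carrier := {x | conjVec x ∈ V}
  add_mem' {a b} ha hb := by
    have h : conjVec (a + b) = conjVec a + conjVec b := by
      funext i; simp [conjVec]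
    simpa [h] using V.add_mem ha hb
  zero_mem' := by
    have h : conjVec (0 : ι → ℂ) = 0 := by
      funext i; simp [conjVec]
    simp [h]
  smul_mem' c x hx := by
    have h : conjVec (c • x) = (starRingEnd ℂ) c • conjVec x := by
      funext i; simp [conjVec]
    simpa [h] using V.smul_mem ((starRingEnd ℂ) c) hx

/-- The complexification of a real matrix. -/
def toC (A : Matrix ι ι ℝ) : Matrix ι ι ℂ := A.map (Complex.ofReal)

/-- The Lie algebra `𝔤 = 𝔰𝔭(H_ℝ, ⟨ , ⟩)`. -/
def LieG (Q : Matrix ι ι ℤ) : Set (Matrix ι ι ℝ) :=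
  {A | Aᵀ * Q.map (Int.cast : ℤ → ℝ) + Q.map (Int.cast : ℤ → ℝ) * A = 0}

/-- The real group `G = Sp(H_ℝ, ⟨ , ⟩)`. -/
def GR (Q : Matrix ι ι ℤ) : Set (Matrix ι ι ℝ) :=
  {g | gᵀ * Q.map (Int.cast : ℤ → ℝ) * g = Q.map (Int.cast : ℤ → ℝ)}

/-- The complex group `G_ℂ = Sp(H_ℂ, ⟨ , ⟩)`. -/
def GC (Q : Matrix ι ι ℤ) : Set (Matrix ι ι ℂ) :=
  {g | gᵀ * Q.map (Int.cast : ℤ → ℂ) * g = Q.map (Int.cast : ℤ → ℂ)}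

/-- The image of a subspace of `H_ℂ` under a complex matrix. -/
def mapSub (g : Matrix ι ι ℂ) (V : Submodule ℂ (ι → ℂ)) : Submodule ℂ (ι → ℂ) :=
  V.map (Matrix.toLin' g)

/-! ### Filtrations, the compact dual and the period domain -/

/-- Families of subspaces `(F^p)_{p ∈ ℤ}` of `H_ℂ`. -/
abbrev Filt (ι : Type*) := ℤ → Submodule ℂ (ι → ℂ)

/-- The action `(g F)^p = g F^p`. -/
def act (g : Matrix ι ι ℂ) (F : Filt ι) : Filt ι := fun p => mapSub g (F p)

/-- The compact dual `Ď` for the Hodge numbers `h p = h^{p,-p-1}`: decreasing filtrations with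
`dim F^p = ∑_{r ≥ p} h^{r,-r-1}` and `F^p = (F^{-p})^⊥`. -/
def CompactDual (Q : Matrix ι ι ℤ) (h : ℤ →₀ ℕ) : Set (Filt ι) :=
  {F | Antitone F ∧
    (∀ p, Module.finrank ℂ (F p) = ∑ r ∈ h.support.filter (fun r => p ≤ r), h r) ∧
    (∀ p x, x ∈ F p ↔ ∀ y ∈ F (-p), form Q x y = 0)}

/-- The component `H^{p,-p-1} = F^p ∩ conj F^{-p-1}`. -/
def hodge (F : Filt ι) (p : ℤ) : Submodule ℂ (ι → ℂ) := F p ⊓ conjSub (F (-p - 1))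

/-- The period domain `D` : the filtrations in `Ď` that are Hodge filtrations of weight `-1`
(`H_ℂ = F^p ⊕ conj F^{-p}` for all `p`) polarized by `⟨ , ⟩`
(`i^{p-q} ⟨v, conj v⟩ > 0` for `0 ≠ v ∈ H^{p,q}`, `q = -p-1`). -/
def PeriodDomain (Q : Matrix ι ι ℤ) (h : ℤ →₀ ℕ) : Set (Filt ι) :=
  {F | F ∈ CompactDual Q h ∧
    (∀ p, IsCompl (F p) (conjSub (F (-p)))) ∧
    (∀ p, ∀ v ∈ hodge F p, v ≠ 0 → 0 < (I ^ (2 * p + 1) * form Q v (conjVec v)).re)}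

/-- `H^ev`, the sum of the `H^{p,-p-1}` with `p` even. -/
def hodgeEv (F : Filt ι) : Submodule ℂ (ι → ℂ) := ⨆ (p : ℤ) (_ : Even p), hodge F p

/-- `H^od`, the sum of the `H^{p,-p-1}` with `p` odd. -/
def hodgeOd (F : Filt ι) : Submodule ℂ (ι → ℂ) := ⨆ (p : ℤ) (_ : Odd p), hodge F p

/-! ### Cycles -/

/-- For `F ∈ D`, the maximal compact subgroup `K_F` of `G` that contains the isotropy group of `F`.
It is the group of the `g ∈ G` that commute with the Weil operator of `F`, i.e. preserve `H^ev`
(hence also `H^od = conj H^ev`). -/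
def maxCompact (Q : Matrix ι ι ℤ) (F : Filt ι) : Set (Matrix ι ι ℝ) :=
  {k | k ∈ GR Q ∧ mapSub (toC k) (hodgeEv F) = hodgeEv F}

/-- The base cycle `C_F = K_F F`. -/
def baseCycle (Q : Matrix ι ι ℤ) (F : Filt ι) : Set (Filt ι) :=
  {F' | ∃ k ∈ maxCompact Q F, F' = act (toC k) F}

/-- The translate `g C` of a set of filtrations. -/
def translate (g : Matrix ι ι ℂ) (C : Set (Filt ι)) : Set (Filt ι) := (act g) '' C

/-- `M_Ď`, the set of all `g C_F` with `g ∈ G_ℂ` (and `F ∈ D`; as `G` acts transitively on `D`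
and `C_{gF} = g C_F`, one base point would suffice). -/
def CycDual (Q : Matrix ι ι ℤ) (h : ℤ →₀ ℕ) : Set (Set (Filt ι)) :=
  {C | ∃ F ∈ PeriodDomain Q h, ∃ g ∈ GC Q, C = translate g (baseCycle Q F)}

/-- The orbit map `G_ℂ → M_Ď`, `g ↦ g C_F`, of `F ∈ D`. -/
def orbitMap (Q : Matrix ι ι ℤ) (h : ℤ →₀ ℕ) (F : PeriodDomain Q h) (g : GC Q) : CycDual Q h :=
  ⟨translate g.1 (baseCycle Q F.1), F.1, F.2, g.1, g.2, rfl⟩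

/-- The topology of the homogeneous space `M_Ď` of `G_ℂ` : the finest one that makes the orbit maps
continuous. (All orbit maps induce the same quotient topology.) -/
instance cycDualTop (Q : Matrix ι ι ℤ) (h : ℤ →₀ ℕ) : TopologicalSpace (CycDual Q h) :=
  ⨆ F : PeriodDomain Q h, TopologicalSpace.coinduced (orbitMap Q h F) inferInstance

/-- The cycle space `M_D`, the set of the `g C_F` that are contained in `D`, as a subset
of `M_Ď`. -/
def CycSpace (Q : Matrix ι ι ℤ) (h : ℤ →₀ ℕ) : Set (CycDual Q h) :=
  {C | C.1 ⊆ PeriodDomain Q h}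

/-- `M_D^cl`, the topological closure of `M_D` in `M_Ď`. -/
def CycClosure (Q : Matrix ι ι ℤ) (h : ℤ →₀ ℕ) : Set (Set (Filt ι)) :=
  Subtype.val '' closure (CycSpace Q h)

/-! ### The two Siegel spaces -/

/-- The Lagrangian Grassmannian: isotropic subspaces of half the dimension. -/
def Lagr (Q : Matrix ι ι ℤ) : Set (Submodule ℂ (ι → ℂ)) :=
  {V | 2 * Module.finrank ℂ V = Fintype.card ι ∧ ∀ x ∈ V, ∀ y ∈ V, form Q x y = 0}

/-- Frames of Lagrangian subspaces. -/
def LagrFrame (Q : Matrix ι ι ℤ) : Set (Fin (Fintype.card ι / 2) → (ι → ℂ)) :=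
  {b | LinearIndependent ℂ b ∧ Submodule.span ℂ (Set.range b) ∈ Lagr Q}

/-- The Lagrangian subspace spanned by a frame. -/
def frameSpan (Q : Matrix ι ι ℤ) (b : LagrFrame Q) : Lagr Q :=
  ⟨Submodule.span ℂ (Set.range b.1), b.2.2⟩

/-- The topology of the Lagrangian Grassmannian, as the quotient of the space of frames. -/
instance lagrTop (Q : Matrix ι ι ℤ) : TopologicalSpace (Lagr Q) :=
  TopologicalSpace.coinduced (frameSpan Q) inferInstance

/-- `𝓑` : Lagrangian subspaces on which the Hermitian form `i⟨x, conj y⟩` is positive definite. -/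
def SiegelPos (Q : Matrix ι ι ℤ) : Set (Lagr Q) :=
  {V | ∀ v ∈ V.1, v ≠ 0 → 0 < (I * form Q v (conjVec v)).re}

/-- `conj 𝓑` : Lagrangian subspaces on which `i⟨x, conj y⟩` is negative definite. -/
def SiegelNeg (Q : Matrix ι ι ℤ) : Set (Lagr Q) :=
  {V | ∀ v ∈ V.1, v ≠ 0 → (I * form Q v (conjVec v)).re < 0}

/-- The closure `𝓑^cl` in the Lagrangian Grassmannian. -/
def SiegelPosCl (Q : Matrix ι ι ℤ) : Set (Submodule ℂ (ι → ℂ)) :=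
  Subtype.val '' closure (SiegelPos Q)

/-- The closure of `conj 𝓑` in the Lagrangian Grassmannian. -/
def SiegelNegCl (Q : Matrix ι ι ℤ) : Set (Submodule ℂ (ι → ℂ)) :=
  Subtype.val '' closure (SiegelNeg Q)

open Classical in
/-- `g H^ev` for a cycle `g C_F` (junk value `⊥` off `M_Ď`). -/
def evTranslate (Q : Matrix ι ι ℤ) (h : ℤ →₀ ℕ) (C : Set (Filt ι)) : Submodule ℂ (ι → ℂ) :=
  if hC : ∃ x : Filt ι × Matrix ι ι ℂ,
      x.1 ∈ PeriodDomain Q h ∧ x.2 ∈ GC Q ∧ C = translate x.2 (baseCycle Q x.1) then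
    mapSub hC.choose.2 (hodgeEv hC.choose.1)
  else ⊥

open Classical in
/-- `g H^od` for a cycle `g C_F` (junk value `⊥` off `M_Ď`). -/
def odTranslate (Q : Matrix ι ι ℤ) (h : ℤ →₀ ℕ) (C : Set (Filt ι)) : Submodule ℂ (ι → ℂ) :=
  if hC : ∃ x : Filt ι × Matrix ι ι ℂ,
      x.1 ∈ PeriodDomain Q h ∧ x.2 ∈ GC Q ∧ C = translate x.2 (baseCycle Q x.1) then
    mapSub hC.choose.2 (hodgeOd hC.choose.1)
  else ⊥

open Classical in
/-- The projection `p^ev`. If `h^{p,-p-1} ≠ 0` both for an even and for an odd `p ≥ 0`, a cycle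
`C_{V,W} = g C_F` (`V = g H^ev`, `W = g H^od`) determines the pair `(V, W)`, and `p^ev` is
`C_{V,W} ↦ V`. If only even `p ≥ 0` occur then `F^0 = H^ev`, the cycle determines `V` (but
not `W`), and `p^ev` is again `C_{V,W} ↦ V`, the isomorphism of `M_D` with `𝓑`. If only odd `p ≥ 0`
occur, the cycle determines `W`, and `p^ev` is `C_{V,W} ↦ conj W`. -/
def pEv (Q : Matrix ι ι ℤ) (h : ℤ →₀ ℕ) (C : Set (Filt ι)) : Submodule ℂ (ι → ℂ) :=
  if ∃ p : ℤ, 0 ≤ p ∧ Even p ∧ h p ≠ 0 then evTranslate Q h C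
  else conjSub (odTranslate Q h C)

open Classical in
/-- The projection `p^od` : it is `C_{V,W} ↦ W`, unless only even `p ≥ 0` with `h^{p,-p-1} ≠ 0`
occur, when it is the complex conjugate `C_{V,W} ↦ conj V` of `p^ev`. -/
def pOd (Q : Matrix ι ι ℤ) (h : ℤ →₀ ℕ) (C : Set (Filt ι)) : Submodule ℂ (ι → ℂ) :=
  if ∃ p : ℤ, 0 ≤ p ∧ Odd p ∧ h p ≠ 0 then odTranslate Q h C
  else conjSub (evTranslate Q h C)

/-! ### Limiting mixed Hodge structures with `N² = 0` -/

/-- The complexified monodromy weight filtration of `N` with `N² = 0` (shifted by `-1`):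
`W_0 = H`, `W_{-1} = Ker N`, `W_{-2} = Im N`, `W_{-3} = 0`. -/
def wt (N : Matrix ι ι ℝ) (k : ℤ) : Submodule ℂ (ι → ℂ) :=
  if 0 ≤ k then ⊤
  else if k = -1 then LinearMap.ker (Matrix.toLin' (toC N))
  else if k = -2 then LinearMap.range (Matrix.toLin' (toC N))
  else ⊥

/-- The Deligne components
`I^{p,q} = F^p ∩ W_{p+q} ∩ (conj F^q ∩ W_{p+q} + ∑_{j ≥ 2} conj F^{q-j+1} ∩ W_{p+q-j})`
of `(W(N), F)`. -/
def deligne (N : Matrix ι ι ℝ) (F : Filt ι) (p q : ℤ) : Submodule ℂ (ι → ℂ) :=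
  F p ⊓ wt N (p + q) ⊓ (conjSub (F q) ⊓ wt N (p + q) ⊔
    ⨆ (j : ℤ) (_ : 2 ≤ j), conjSub (F (q - j + 1)) ⊓ wt N (p + q - j))

/-- The preimage in `W_k` of the filtration that `F` induces on `Gr_k = W_k / W_{k-1}`. -/
def grFilt (N : Matrix ι ι ℝ) (F : Filt ι) (k p : ℤ) : Submodule ℂ (ι → ℂ) :=
  F p ⊓ wt N k ⊔ wt N (k - 1)

/-- The limiting mixed Hodge structures `(W(N), F)`. Everything about `Gr_k` is expressed through
preimages in `W_k`. -/
structure IsLMHS (Q : Matrix ι ι ℤ) (N : Matrix ι ι ℝ) (F : Filt ι) : Prop where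
  /-- `F` induces a Hodge structure of weight `k` on `Gr_k`: `Gr_k = F^p ⊕ conj F^{k+1-p}`. -/
  pure_sup : ∀ k p, grFilt N F k p ⊔ conjSub (grFilt N F k (k + 1 - p)) = wt N k
  pure_inf : ∀ k p, grFilt N F k p ⊓ conjSub (grFilt N F k (k + 1 - p)) = wt N (k - 1)
  /-- `N : Gr_0 ≅ Gr_{-2}` is a `(-1,-1)`-morphism (bijectivity is clear from `W(N)`). -/
  morphism : ∀ p, mapSub (toC N) (grFilt N F 0 p) ≤ grFilt N F (-2) (p - 1)
  /-- `⟨ , N ⟩` polarizes `Gr_0`. -/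
  orth_zero : ∀ p, ∀ x ∈ grFilt N F 0 p, ∀ y ∈ grFilt N F 0 (1 - p),
    form Q x (toC N *ᵥ y) = 0
  pos_zero : ∀ p, ∀ v ∈ grFilt N F 0 p ⊓ conjSub (grFilt N F 0 (-p)), v ∉ wt N (-1) →
    0 < (I ^ (2 * p) * form Q v (toC N *ᵥ conjVec v)).re
  /-- `⟨ , ⟩` polarizes `Gr_{-1}`. -/
  orth_one : ∀ p, ∀ x ∈ grFilt N F (-1) p, ∀ y ∈ grFilt N F (-1) (-p), form Q x y = 0
  pos_one : ∀ p, ∀ v ∈ grFilt N F (-1) p ⊓ conjSub (grFilt N F (-1) (-p - 1)), v ∉ wt N (-2) →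
    0 < (I ^ (2 * p + 1) * form Q v (conjVec v)).re

/-- The Deligne decomposition is defined over `ℝ`. -/
def IsRSplit (N : Matrix ι ι ℝ) (F : Filt ι) : Prop :=
  ∀ p q, conjSub (deligne N F p q) = deligne N F q p

/-- `L^{-1,-1}_ℝ(W(N), F)` : the `δ ∈ 𝔤` with `δ I^{p,q} ⊆ ⨁_{r < p, s < q} I^{r,s}`. -/
def LMinus (Q : Matrix ι ι ℤ) (N : Matrix ι ι ℝ) (F : Filt ι) : Set (Matrix ι ι ℝ) :=
  {δ | δ ∈ LieG Q ∧ ∀ p q, mapSub (toC δ) (deligne N F p q) ≤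
    ⨆ (r : ℤ) (_ : r < p) (s : ℤ) (_ : s < q), deligne N F r s}

/-! ### The SL(2)-orbit of `(N, F)` -/

/-- `ρ_* ξ = T` for a homomorphism `ρ : SL(2,ℂ) → G_ℂ` and `ξ ∈ 𝔰𝔩(2,ℂ)`, i.e.
`ρ (exp (t ξ)) = exp (t T)` for all `t ∈ ℂ`. -/
def HasDifferential (ρ : Matrix.SpecialLinearGroup (Fin 2) ℂ →* Matrix ι ι ℂ)
    (ξ : Matrix (Fin 2) (Fin 2) ℂ) (T : Matrix ι ι ℂ) : Prop :=
  ∀ (t : ℂ) (g : Matrix.SpecialLinearGroup (Fin 2) ℂ),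
    (g : Matrix (Fin 2) (Fin 2) ℂ) = NormedSpace.exp (t • ξ) → ρ g = NormedSpace.exp (t • T)

/-- The data that the `SL(2)`-orbit theorem attaches to a pair `(N, F)`: the element `δ` for which
`(W(N), e^{-iδ} F)` is an `ℝ`-split LMHS, and `ρ : SL(2,ℂ) → G_ℂ`, `φ : ℙ¹ → Ď`. The standard
generators of `𝔰𝔩(2)` are `n_- = (0 1; 0 0)`, `h = (-1 0; 0 1)`, `n_+ = (0 0; 1 0)`, so
that `exp (z n_-) 0 = z` in `ℙ¹`. The map `φ` is automatically holomorphic, being an orbit map. -/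
structure SL2Data (Q : Matrix ι ι ℤ) (h : ℤ →₀ ℕ) (N : Matrix ι ι ℝ) (F : Filt ι) where
  δ : Matrix ι ι ℝ
  δ_mem : δ ∈ LMinus Q N F
  lmhs : IsLMHS Q N (act (NormedSpace.exp (-(I • toC δ))) F)
  split : IsRSplit N (act (NormedSpace.exp (-(I • toC δ))) F)
  ρ : Matrix.SpecialLinearGroup (Fin 2) ℂ →* Matrix ι ι ℂ
  ρ_mem : ∀ g, ρ g ∈ GC Q
  ρ_cont : Continuous ρ
  /-- `ρ` is defined over `ℝ`. -/
  ρ_real : ∀ g, ρ (Matrix.SpecialLinearGroup.map (starRingEnd ℂ) g) = (ρ g).map (starRingEnd ℂ)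
  φ : OnePoint ℂ → Filt ι
  φ_mem : ∀ z, φ z ∈ CompactDual Q h
  equivariant : ∀ (g : Matrix.SpecialLinearGroup (Fin 2) ℂ) (z : OnePoint ℂ),
    act (ρ g) (φ z) = φ (Matrix.SpecialLinearGroup.toGL g • z)
  φ_zero : φ ((0 : ℂ) : OnePoint ℂ) = act (NormedSpace.exp (-(I • toC δ))) F
  /-- `N⁺ = ρ_* n_+`. -/
  Nplus : Matrix ι ι ℝ
  /-- `Y = ρ_* h`. -/
  Y : Matrix ι ι ℝ
  Nplus_mem : Nplus ∈ LieG Q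
  Y_mem : Y ∈ LieG Q
  diff_minus : HasDifferential ρ !![0, 1; 0, 0] (toC N)
  diff_h : HasDifferential ρ !![-1, 0; 0, 1] (toC Y)
  diff_plus : HasDifferential ρ !![0, 0; 1, 0] (toC Nplus)
  Y_eigen : ∀ p q, ∀ v ∈ deligne N (act (NormedSpace.exp (-(I • toC δ))) F) p q,
    toC Y *ᵥ v = ((p + q + 1 : ℤ) : ℂ) • v
  /-- `ρ_*` is a `(0,0)`-morphism of Hodge structures, for the Hodge structure of `𝔤` given by
  `φ(i)` and that of `𝔰𝔩(2,ℂ)` given by `i`, whose components of types `(-1,1)`, `(0,0)`, `(1,-1)`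
  are spanned by `i n_- - h + i n_+`, by `n_- - n_+`, and by `-i n_- - h - i n_+`. -/
  morph_minus : ∀ p, mapSub (I • toC N - toC Y + I • toC Nplus)
    (hodge (φ (I : ℂ)) p) ≤ hodge (φ (I : ℂ)) (p - 1)
  morph_zero : ∀ p, mapSub (toC N - toC Nplus)
    (hodge (φ (I : ℂ)) p) ≤ hodge (φ (I : ℂ)) p
  morph_plus : ∀ p, mapSub (-(I • toC N) - toC Y - I • toC Nplus)
    (hodge (φ (I : ℂ)) p) ≤ hodge (φ (I : ℂ)) (p + 1)

/-- The base point `F_0 = φ(i)`. -/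
def SL2Data.basePoint {Q : Matrix ι ι ℤ} {h : ℤ →₀ ℕ} {N : Matrix ι ι ℝ} {F : Filt ι}
    (d : SL2Data Q h N F) : Filt ι := d.φ (I : ℂ)

/-- `X = (i N - Y + i N⁺) / 2`. -/
def SL2Data.X {Q : Matrix ι ι ℤ} {h : ℤ →₀ ℕ} {N : Matrix ι ι ℝ} {F : Filt ι}
    (d : SL2Data Q h N F) : Matrix ι ι ℂ :=
  (1 / 2 : ℂ) • (I • toC N - toC d.Y + I • toC d.Nplus)

/-- The cycle `exp(X) C_0`, where `C_0 = K_0 F_0`. -/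
def SL2Data.boundaryCycle {Q : Matrix ι ι ℤ} {h : ℤ →₀ ℕ} {N : Matrix ι ι ℝ} {F : Filt ι}
    (d : SL2Data Q h N F) : Set (Filt ι) :=
  translate (NormedSpace.exp d.X) (baseCycle Q d.basePoint)

/-! ### Nilpotent orbits -/

/-- The relative interior `σ°`. -/
def relInt (σ : PointedCone ℝ (Matrix ι ι ℝ)) : Set (Matrix ι ι ℝ) :=
  intrinsicInterior ℝ (σ : Set (Matrix ι ι ℝ))

/-- `σ_ℂ`, the complex span of `σ`. -/
def coneC (σ : PointedCone ℝ (Matrix ι ι ℝ)) : Submodule ℂ (Matrix ι ι ℂ) :=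
  Submodule.span ℂ (toC '' (σ : Set (Matrix ι ι ℝ)))

/-- `exp(σ_ℂ) F`. -/
def expOrbit (σ : PointedCone ℝ (Matrix ι ι ℝ)) (F : Filt ι) : Set (Filt ι) :=
  {F' | ∃ T ∈ coneC σ, F' = act (NormedSpace.exp T) F}

/-- `(σ, exp(σ_ℂ) F)` is a nilpotent orbit. -/
structure IsNilpotentOrbit (Q : Matrix ι ι ℤ) (h : ℤ →₀ ℕ) (σ : PointedCone ℝ (Matrix ι ι ℝ))
    (F : Filt ι) : Prop where
  subset_lie : (σ : Set (Matrix ι ι ℝ)) ⊆ LieG Q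
  nilpotent : ∀ N ∈ σ, IsNilpotent N
  /-- `σ` is generated by finitely many rational elements. -/
  rational : ∃ S : Finset (Matrix ι ι ℚ),
    σ = PointedCone.hull ℝ ((fun A : Matrix ι ι ℚ => A.map (Rat.cast : ℚ → ℝ)) '' (S : Set _))
  commute : ∀ N ∈ σ, ∀ M ∈ σ, N * M = M * N
  mem_dual : F ∈ CompactDual Q h
  mem_domain : ∀ N ∈ relInt σ, ∃ y₀ : ℝ, ∀ z : ℂ, y₀ < z.im →
    act (NormedSpace.exp (z • toC N)) F ∈ PeriodDomain Q h
  horizontal : ∀ N ∈ σ, ∀ p, mapSub (toC N) (F p) ≤ F (p - 1)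

/-- Even type: `N² = 0` for `N ∈ σ°`, and `I^{p,-p} = 0` for odd `p`. -/
def IsEvenType (σ : PointedCone ℝ (Matrix ι ι ℝ)) (F : Filt ι) : Prop :=
  ∀ N ∈ relInt σ, N * N = 0 ∧ ∀ p : ℤ, Odd p → deligne N F p (-p) = ⊥

/-- Odd type: `N² = 0` for `N ∈ σ°`, and `I^{p,-p} = 0` for even `p`. -/
def IsOddType (σ : PointedCone ℝ (Matrix ι ι ℝ)) (F : Filt ι) : Prop :=
  ∀ N ∈ relInt σ, N * N = 0 ∧ ∀ p : ℤ, Even p → deligne N F p (-p) = ⊥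

end

end CycleBoundary

/-!
Both cases of the theorem are treated together, for a parity `e` (`0` for even type, `1` for odd
type). All subspaces are explicit, so that the theorem comes down to linear algebra with the
Hermitian forms `⟨x, conj y⟩` and `⟨x, N conj y⟩`.

*Mixed Hodge structures.* If `N² = 0`, a vector of `F^p ∩ Ker N` that is orthogonal to `conj
F^{p+1}` is a Hodge vector of every `exp(iyN)F`, and on the Hodge vectors `exp(iyN)x` the
polarization is affine in `y`. Positivity on the nilpotent orbit therefore gives a sign, on these
vectors, to the two Hermitian forms on `F^p ∩ Ker N` and on `H / Ker N`. This makes the forms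
nondegenerate where orthogonal projections need it, and the projections give the Hodge
decompositions of the graded pieces of `W(N)` and their polarizations (`OrbitPositivity.isLMHS`).
It follows that `H = A ⊕ B ⊕ NA`, where `A = ∑ I^{p,-p}` and `B = ∑ I^{p,-p-1}`.

*The `SL(2)`-orbit.* The imaginary part of the projection to `A` along `Ker N` is an element `δ`
that makes the structure `ℝ`-split (`MixedHodge.exists_splitting`). For a split structure let `N⁺`
be zero on `A ⊕ B` and inverse to `N` on `NA` (`SplitHodge.exists_isNplus`). Then `N, N⁺` behave
like off-diagonal matrix units, which yields `ρ` and `φ` (`MixedHodge.nonempty_SL2Data`). For the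
given `δ`, any other choice of `ρ_* n_+` differs from `N⁺` by an operator that is both of type
`(-1,1)` and of type `(0,0)` at the base point, and hence by `0` (`SL2Data.exists_isNplus`).

*The boundary cycle.* Let `B_e ⊆ B` be the sum of the `I^{p,-p-1}` with `p ≡ e`. Since `I^{p,-p} =
0` unless `p ≡ e`, the Lagrangian subspaces of the base point `F_0 = exp(iN)F̂` are `V = B_e ⊕ (1 +
iN)A` and `W = B_{e+1} ⊕ (1 - iN)A` (`SplitHodge.hodgePar_base`). The operator `exp(tX)` fixes `W`,
and it maps `(1 + iN)a` to `(1 - t)a + i(1 + t)Na`. For `0 ≤ t < 1` its image `V_t` of `V` is still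
definite of the right sign, which implies that the translated cycle lies in `D`
(`translate_baseCycle_subset`). For `t = 1` the image is `B_e ⊕ Im N`, a limit of the `V_t`
(`SL2Data.boundary`).

*The projections.* A cycle `g C_F` determines `g V` when the parity of `V` occurs in `F^0`
(`mapSub_hodgePar_eq`). For the parity of the top index this holds because the maximal compact
subgroup acts irreducibly on `V`. For the other one the obstruction is a quadratic form on `V` that
vanishes on an orbit of that group, hence vanishes. If the parity `e` does not occur in `F^0`, then
`A = 0`, so that `exp(X) = 1`, and `V` is the conjugate of the other Lagrangian subspace.

*Independence of `N` and `F'`.* The form `⟨x, N conj x⟩` is semidefinite with radical `Ker N`, it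
is linear in `N`, and segments in the cone can be prolonged beyond a point of the relative
interior. Hence `Ker N` and `Im N = (Ker N)^⊥` are the same for all inner `N`, and every element of
the cone vanishes on `Ker N` (`IsNilpotentOrbit.mulVec_eq_zero`). For the same reason `exp(σ_ℂ)`
acts trivially on `Ker N`, and thus changes neither the graded pieces nor the `I^{p,-p-1}`.
-/

namespace CycleBoundary

set_option linter.unusedSectionVars false

noncomputable section

variable {ι : Type*} [Fintype ι] [DecidableEq ι]

/-! ### The symplectic form and complex conjugation -/

theorem form_add_left (Q : Matrix ι ι ℤ) (x y z : ι → ℂ) :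
    form Q (x + y) z = form Q x z + form Q y z := add_dotProduct _ _ _

theorem form_add_right (Q : Matrix ι ι ℤ) (x y z : ι → ℂ) :
    form Q x (y + z) = form Q x y + form Q x z := by
  simp [form, mulVec_add]

theorem form_smul_left (Q : Matrix ι ι ℤ) (c : ℂ) (x y : ι → ℂ) :
    form Q (c • x) y = c * form Q x y := by
  simp [form]

theorem form_smul_right (Q : Matrix ι ι ℤ) (c : ℂ) (x y : ι → ℂ) :
    form Q x (c • y) = c * form Q x y := by
  simp [form, mulVec_smul]

theorem form_neg_right (Q : Matrix ι ι ℤ) (x y : ι → ℂ) : form Q x (-y) = -form Q x y := by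
  simp [form, mulVec_neg]

theorem form_sub_left (Q : Matrix ι ι ℤ) (x y z : ι → ℂ) :
    form Q (x - y) z = form Q x z - form Q y z := by
  simp [form]

theorem form_sub_right (Q : Matrix ι ι ℤ) (x y z : ι → ℂ) :
    form Q x (y - z) = form Q x y - form Q x z := by
  simp [form, mulVec_sub]

theorem form_zero_left (Q : Matrix ι ι ℤ) (x : ι → ℂ) : form Q 0 x = 0 := by
  simp [form]

theorem form_zero_right (Q : Matrix ι ι ℤ) (x : ι → ℂ) : form Q x 0 = 0 := by
  simp [form]

/-- The form as a bundled bilinear map. -/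
def formL (Q : Matrix ι ι ℤ) : (ι → ℂ) →ₗ[ℂ] (ι → ℂ) →ₗ[ℂ] ℂ :=
  LinearMap.mk₂ ℂ (form Q) (form_add_left Q) (form_smul_left Q) (form_add_right Q)
    (form_smul_right Q)

@[simp] theorem formL_apply (Q : Matrix ι ι ℤ) (x y : ι → ℂ) : formL Q x y = form Q x y := rfl

theorem form_swap {Q : Matrix ι ι ℤ} (hQ : Qᵀ = -Q) (x y : ι → ℂ) :
    form Q x y = -form Q y x := by
  have h1 : (Q.map (Int.cast : ℤ → ℂ))ᵀ = -Q.map (Int.cast : ℤ → ℂ) := by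
    ext i j
    have := congrFun (congrFun hQ i) j
    simp only [transpose_apply, neg_apply] at this
    simp [this]
  rw [form, form, dotProduct_mulVec, ← mulVec_transpose, h1, neg_mulVec, neg_dotProduct,
    dotProduct_comm]

theorem form_self {Q : Matrix ι ι ℤ} (hQ : Qᵀ = -Q) (x : ι → ℂ) : form Q x x = 0 := by
  have := form_swap hQ x x
  linear_combination (1 / 2 : ℂ) * this

theorem form_nondeg {Q : Matrix ι ι ℤ} (hQ : Q.det ≠ 0) {x : ι → ℂ}
    (h : ∀ y, form Q x y = 0) : x = 0 := by
  have hd : (Q.map (Int.cast : ℤ → ℂ)).det ≠ 0 := by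
    have : (Q.map (Int.cast : ℤ → ℂ)).det = ((Q.det : ℤ) : ℂ) :=
      ((Int.castRingHom ℂ).map_det Q).symm
    rw [this]; exact_mod_cast hQ
  have : vecMul x (Q.map (Int.cast : ℤ → ℂ)) = 0 := by
    apply dotProduct_eq_zero
    intro y
    rw [← dotProduct_mulVec]; exact h y
  exact Matrix.eq_zero_of_vecMul_eq_zero hd this

@[simp] theorem conjVec_conjVec (x : ι → ℂ) : conjVec (conjVec x) = x := by
  funext i; simp [conjVec]

@[simp] theorem conjVec_add (x y : ι → ℂ) : conjVec (x + y) = conjVec x + conjVec y := by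
  funext i; simp [conjVec]

@[simp] theorem conjVec_sub (x y : ι → ℂ) : conjVec (x - y) = conjVec x - conjVec y := by
  funext i; simp [conjVec]

@[simp] theorem conjVec_zero : conjVec (0 : ι → ℂ) = 0 := by
  funext i; simp [conjVec]

@[simp] theorem conjVec_smul (c : ℂ) (x : ι → ℂ) :
    conjVec (c • x) = (starRingEnd ℂ) c • conjVec x := by
  funext i; simp [conjVec]

theorem conjVec_mulVec (A : Matrix ι ι ℂ) (x : ι → ℂ) :
    conjVec (A *ᵥ x) = A.map (starRingEnd ℂ) *ᵥ conjVec x := by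
  funext i; simp [conjVec, mulVec, dotProduct, map_sum]

@[simp] theorem toC_map_conj (A : Matrix ι ι ℝ) : (toC A).map (starRingEnd ℂ) = toC A := by
  ext i j; simp [toC]

@[simp] theorem conjVec_toC_mulVec (A : Matrix ι ι ℝ) (x : ι → ℂ) :
    conjVec (toC A *ᵥ x) = toC A *ᵥ conjVec x := by
  rw [conjVec_mulVec, toC_map_conj]

theorem conjVec_eq_zero {x : ι → ℂ} : conjVec x = 0 ↔ x = 0 :=
  ⟨fun h => by rw [← conjVec_conjVec x, h, conjVec_zero], fun h => by rw [h, conjVec_zero]⟩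

theorem form_conjVec (Q : Matrix ι ι ℤ) (x y : ι → ℂ) :
    form Q (conjVec x) (conjVec y) = (starRingEnd ℂ) (form Q x y) := by
  simp [form, conjVec, mulVec, dotProduct, map_sum]

theorem form_conjVec_left (Q : Matrix ι ι ℤ) (x y : ι → ℂ) :
    form Q (conjVec x) y = (starRingEnd ℂ) (form Q x (conjVec y)) := by
  rw [← form_conjVec, conjVec_conjVec]

theorem form_conjVec_eq_zero {Q : Matrix ι ι ℤ} {x y : ι → ℂ} :
    form Q (conjVec x) (conjVec y) = 0 ↔ form Q x y = 0 := by
  rw [form_conjVec]; exact map_eq_zero _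

/-- The Hermitian form attached to the alternating form satisfies
`⟨y, conj x⟩ = -conj ⟨x, conj y⟩`. -/
theorem form_conj_swap {Q : Matrix ι ι ℤ} (hQ : Qᵀ = -Q) (x y : ι → ℂ) :
    form Q y (conjVec x) = -(starRingEnd ℂ) (form Q x (conjVec y)) := by
  rw [← form_conjVec, conjVec_conjVec, form_swap hQ, neg_inj]

@[simp] theorem mem_conjSub {V : Submodule ℂ (ι → ℂ)} {x : ι → ℂ} :
    x ∈ conjSub V ↔ conjVec x ∈ V := Iff.rfl

@[simp] theorem conjSub_conjSub (V : Submodule ℂ (ι → ℂ)) : conjSub (conjSub V) = V := by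
  ext x; simp

theorem conjSub_mono {V W : Submodule ℂ (ι → ℂ)} (h : V ≤ W) : conjSub V ≤ conjSub W :=
  fun _ hx => h hx

/-- Conjugation as an automorphism of the lattice of subspaces. -/
def conjIso : Submodule ℂ (ι → ℂ) ≃o Submodule ℂ (ι → ℂ) where
  toFun := conjSub
  invFun := conjSub
  left_inv := conjSub_conjSub
  right_inv := conjSub_conjSub
  map_rel_iff' := ⟨fun h => by simpa using conjSub_mono h, fun h => conjSub_mono h⟩

theorem conjSub_inf (V W : Submodule ℂ (ι → ℂ)) : conjSub (V ⊓ W) = conjSub V ⊓ conjSub W :=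
  conjIso.map_inf V W

theorem conjSub_iSup {κ : Sort*} (f : κ → Submodule ℂ (ι → ℂ)) :
    conjSub (⨆ k, f k) = ⨆ k, conjSub (f k) :=
  conjIso.map_iSup f

theorem conjSub_top : conjSub (⊤ : Submodule ℂ (ι → ℂ)) = ⊤ := conjIso.map_top

theorem conjSub_bot : conjSub (⊥ : Submodule ℂ (ι → ℂ)) = ⊥ := conjIso.map_bot

@[simp] theorem mem_mapSub {g : Matrix ι ι ℂ} {V : Submodule ℂ (ι → ℂ)} {x : ι → ℂ} :
    x ∈ mapSub g V ↔ ∃ v ∈ V, g *ᵥ v = x := by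
  simp [mapSub, Submodule.mem_map, toLin'_apply]

theorem mapSub_le {g : Matrix ι ι ℂ} {V W : Submodule ℂ (ι → ℂ)} :
    mapSub g V ≤ W ↔ ∀ v ∈ V, g *ᵥ v ∈ W := by
  simp [mapSub, SetLike.le_def, toLin'_apply]

theorem mulVec_mem_mapSub (g : Matrix ι ι ℂ) {V : Submodule ℂ (ι → ℂ)} {x : ι → ℂ} (hx : x ∈ V) :
    g *ᵥ x ∈ mapSub g V := mem_mapSub.2 ⟨x, hx, rfl⟩

theorem mapSub_mul (g g' : Matrix ι ι ℂ) (V : Submodule ℂ (ι → ℂ)) :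
    mapSub (g * g') V = mapSub g (mapSub g' V) := by
  rw [mapSub, toLin'_mul, Submodule.map_comp]; rfl

@[simp] theorem mapSub_one (V : Submodule ℂ (ι → ℂ)) : mapSub (1 : Matrix ι ι ℂ) V = V := by
  rw [mapSub, toLin'_one, Submodule.map_id]

theorem mapSub_mono (g : Matrix ι ι ℂ) {V W : Submodule ℂ (ι → ℂ)} (h : V ≤ W) :
    mapSub g V ≤ mapSub g W := Submodule.map_mono h

theorem act_mul (g g' : Matrix ι ι ℂ) (F : Filt ι) : act (g * g') F = act g (act g' F) := by
  funext p; exact mapSub_mul g g' (F p)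

@[simp] theorem act_one (F : Filt ι) : act (1 : Matrix ι ι ℂ) F = F := by
  funext p; exact mapSub_one (F p)

theorem conjSub_mapSub_toC (A : Matrix ι ι ℝ) (V : Submodule ℂ (ι → ℂ)) :
    conjSub (mapSub (toC A) V) = mapSub (toC A) (conjSub V) := by
  ext x
  simp only [mem_conjSub, mem_mapSub]
  constructor
  · rintro ⟨v, hv, h⟩
    exact ⟨conjVec v, by simpa using hv, by rw [← conjVec_toC_mulVec, h, conjVec_conjVec]⟩
  · rintro ⟨v, hv, rfl⟩
    exact ⟨conjVec v, hv, by simp⟩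

@[simp] theorem toC_mul (A B : Matrix ι ι ℝ) : toC (A * B) = toC A * toC B := by
  exact Matrix.map_mul (f := Complex.ofRealHom)

@[simp] theorem toC_add (A B : Matrix ι ι ℝ) : toC (A + B) = toC A + toC B := by
  ext; simp [toC]

@[simp] theorem toC_sub (A B : Matrix ι ι ℝ) : toC (A - B) = toC A - toC B := by
  ext; simp [toC]

@[simp] theorem toC_smul (c : ℝ) (A : Matrix ι ι ℝ) : toC (c • A) = (c : ℂ) • toC A := by
  ext; simp [toC]

@[simp] theorem toC_zero : toC (0 : Matrix ι ι ℝ) = 0 := by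
  ext; simp [toC]

@[simp] theorem toC_one : toC (1 : Matrix ι ι ℝ) = 1 := by
  simp [toC]

theorem toC_injective : Function.Injective (toC : Matrix ι ι ℝ → Matrix ι ι ℂ) :=
  Matrix.map_injective Complex.ofReal_injective

/-- A complex matrix that commutes with complex conjugation is real. -/
theorem exists_toC_eq {A : Matrix ι ι ℂ}
    (h : ∀ x, conjVec (A *ᵥ conjVec x) = A *ᵥ x) : ∃ B, toC B = A := by
  have h1 : A.map (starRingEnd ℂ) = A := by
    apply Matrix.ext_of_mulVec_single
    intro i
    rw [← h, conjVec_mulVec, conjVec_conjVec]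
  refine ⟨A.map Complex.re, ?_⟩
  ext i j
  have := congrFun (congrFun h1 i) j
  simp only [map_apply] at this
  simp only [toC, map_apply]
  exact Complex.conj_eq_iff_re.1 this

/-! ### Infinitesimal isometries and isometries -/

theorem form_mulVec_left (Q : Matrix ι ι ℤ) (A : Matrix ι ι ℂ) (x y : ι → ℂ) :
    form Q (A *ᵥ x) y = x ⬝ᵥ ((Aᵀ * Q.map (Int.cast : ℤ → ℂ)) *ᵥ y) := by
  rw [form, ← mulVec_mulVec, dotProduct_mulVec x, vecMul_transpose]

theorem form_mulVec_right (Q : Matrix ι ι ℤ) (A : Matrix ι ι ℂ) (x y : ι → ℂ) :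
    form Q x (A *ᵥ y) = x ⬝ᵥ ((Q.map (Int.cast : ℤ → ℂ) * A) *ᵥ y) := by
  rw [form, ← mulVec_mulVec]

theorem matrix_eq_of_dotProduct {A B : Matrix ι ι ℂ}
    (h : ∀ x y : ι → ℂ, x ⬝ᵥ (A *ᵥ y) = x ⬝ᵥ (B *ᵥ y)) : A = B := by
  apply Matrix.ext_of_mulVec_single
  intro i
  exact dotProduct_eq _ _ fun x => by rw [dotProduct_comm, h, dotProduct_comm]

theorem toC_intCast (Q : Matrix ι ι ℤ) :
    toC (Q.map (Int.cast : ℤ → ℝ)) = Q.map (Int.cast : ℤ → ℂ) := by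
  ext; simp [toC]

theorem toC_transpose (A : Matrix ι ι ℝ) : toC Aᵀ = (toC A)ᵀ := rfl

/-- The real matrices of `𝔤` are those whose complexification is skew for the form. -/
theorem mem_LieG_iff {Q : Matrix ι ι ℤ} {A : Matrix ι ι ℝ} :
    A ∈ LieG Q ↔ ∀ x y, form Q (toC A *ᵥ x) y = -form Q x (toC A *ᵥ y) := by
  have h1 : A ∈ LieG Q ↔
      (toC A)ᵀ * Q.map (Int.cast : ℤ → ℂ) + Q.map (Int.cast : ℤ → ℂ) * toC A = 0 := by
    rw [← toC_intCast, ← toC_transpose, ← toC_mul, ← toC_mul, ← toC_add, ← toC_zero,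
      toC_injective.eq_iff]
    rfl
  rw [h1]
  constructor
  · intro h x y
    rw [form_mulVec_left, form_mulVec_right, eq_neg_of_add_eq_zero_left h, neg_mulVec,
      dotProduct_neg]
  · intro h
    rw [← eq_neg_iff_add_eq_zero]
    apply matrix_eq_of_dotProduct
    intro x y
    rw [← form_mulVec_left, h, form_mulVec_right, neg_mulVec, dotProduct_neg]

theorem mem_GC_iff {Q : Matrix ι ι ℤ} {g : Matrix ι ι ℂ} :
    g ∈ GC Q ↔ ∀ x y, form Q (g *ᵥ x) (g *ᵥ y) = form Q x y := by
  constructor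
  · intro h x y
    have h : gᵀ * Q.map (Int.cast : ℤ → ℂ) * g = Q.map (Int.cast : ℤ → ℂ) := h
    rw [form_mulVec_left, mulVec_mulVec, h, form]
  · intro h
    change gᵀ * Q.map (Int.cast : ℤ → ℂ) * g = Q.map (Int.cast : ℤ → ℂ)
    apply matrix_eq_of_dotProduct
    intro x y
    rw [← mulVec_mulVec, ← form_mulVec_left, h, form]

theorem toC_mem_GC_iff {Q : Matrix ι ι ℤ} {g : Matrix ι ι ℝ} : toC g ∈ GC Q ↔ g ∈ GR Q := by
  change (toC g)ᵀ * Q.map (Int.cast : ℤ → ℂ) * toC g = Q.map (Int.cast : ℤ → ℂ) ↔ _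
  rw [← toC_intCast, ← toC_transpose, ← toC_mul, ← toC_mul, toC_injective.eq_iff]
  rfl

theorem GC_mul {Q : Matrix ι ι ℤ} {g g' : Matrix ι ι ℂ} (h : g ∈ GC Q) (h' : g' ∈ GC Q) :
    g * g' ∈ GC Q := by
  rw [mem_GC_iff] at *
  intro x y
  rw [← mulVec_mulVec, ← mulVec_mulVec, h, h']

theorem isUnit_of_mem_GC {Q : Matrix ι ι ℤ} (hQ : Q.det ≠ 0) {g : Matrix ι ι ℂ} (h : g ∈ GC Q) :
    IsUnit g := by
  have h' := mem_GC_iff.1 h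
  apply Matrix.mulVec_injective_iff_isUnit.1
  intro x y hxy
  rw [← sub_eq_zero]
  apply form_nondeg hQ
  intro z
  have hxy : g *ᵥ (x - y) = 0 := by rw [mulVec_sub]; exact sub_eq_zero.2 hxy
  rw [← h', hxy, form_zero_left]

theorem inv_mem_GC {Q : Matrix ι ι ℤ} (hQ : Q.det ≠ 0) {g : Matrix ι ι ℂ} (h : g ∈ GC Q) :
    g⁻¹ ∈ GC Q := by
  have hu := isUnit_of_mem_GC hQ h
  have h1 : g * g⁻¹ = 1 := Matrix.mul_nonsing_inv _ ((Matrix.isUnit_iff_isUnit_det g).1 hu)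
  have h' := mem_GC_iff.1 h
  rw [mem_GC_iff]
  intro x y
  rw [← h', mulVec_mulVec, mulVec_mulVec, h1, one_mulVec, one_mulVec]

/-- `1 + T` is an isometry if `T` is an infinitesimal isometry with `T² = 0`. -/
theorem one_add_mem_GC {Q : Matrix ι ι ℤ} {T : Matrix ι ι ℂ} (hT : T * T = 0)
    (h : ∀ x y, form Q (T *ᵥ x) y = -form Q x (T *ᵥ y)) : 1 + T ∈ GC Q := by
  rw [mem_GC_iff]
  intro x y
  simp only [add_mulVec, one_mulVec, form_add_left, form_add_right]
  rw [h x y, h x (T *ᵥ y), mulVec_mulVec, hT, zero_mulVec, form_zero_right]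
  ring

theorem exp_eq_one_add {T : Matrix ι ι ℂ} (hT : T * T = 0) : NormedSpace.exp T = 1 + T := by
  rw [NormedSpace.exp_eq_tsum (𝕂 := ℂ)]
  beta_reduce
  rw [tsum_eq_sum (s := Finset.range 2)]
  · simp [Finset.sum_range_succ]
  · intro n hn
    obtain ⟨k, rfl⟩ : ∃ k, n = 2 + k := ⟨n - 2, by simp at hn; omega⟩
    rw [pow_add, pow_two, hT, zero_mul, smul_zero]

/-! ### Solving linear equations given by bilinear forms -/

/-- A functional `ℓ` that vanishes on the right radical of the restriction of `β` to `A × B` is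
represented on `B` by an element of `A`. -/
theorem exists_mem_forall_eq {H : Type*} [AddCommGroup H] [Module ℂ H] [FiniteDimensional ℂ H]
    (A B : Submodule ℂ H) (β : H →ₗ[ℂ] H →ₗ[ℂ] ℂ) (l : H →ₗ[ℂ] ℂ)
    (h : ∀ b ∈ B, (∀ a ∈ A, β a b = 0) → l b = 0) : ∃ a ∈ A, ∀ b ∈ B, β a b = l b := by
  let f : B →ₗ[ℂ] Module.Dual ℂ A := (LinearMap.lcomp ℂ ℂ A.subtype).comp (β.flip.domRestrict B)
  have hl : l.comp B.subtype ∈ (LinearMap.ker f).dualAnnihilator := by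
    rw [Submodule.mem_dualAnnihilator]
    intro b hb
    apply h b b.2
    intro a ha
    exact DFunLike.congr_fun (LinearMap.mem_ker.1 hb) (⟨a, ha⟩ : A)
  rw [← LinearMap.range_dualMap_eq_dualAnnihilator_ker] at hl
  obtain ⟨φ, hφ⟩ := hl
  obtain ⟨a, rfl⟩ := (Module.evalEquiv ℂ A).surjective φ
  exact ⟨a, a.2, fun b hb => DFunLike.congr_fun hφ (⟨b, hb⟩ : B)⟩

/-! ### The monodromy weight filtration -/

theorem wt_nonneg (N : Matrix ι ι ℝ) {k : ℤ} (hk : 0 ≤ k) : wt N k = ⊤ := by simp [wt, hk]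

theorem wt_le_neg_three (N : Matrix ι ι ℝ) {k : ℤ} (hk : k ≤ -3) : wt N k = ⊥ := by
  rw [wt, if_neg (by omega), if_neg (by omega), if_neg (by omega)]

theorem mem_wt_neg_one {N : Matrix ι ι ℝ} {x : ι → ℂ} : x ∈ wt N (-1) ↔ toC N *ᵥ x = 0 := by
  simp [wt, toLin'_apply]

theorem mem_wt_neg_two {N : Matrix ι ι ℝ} {x : ι → ℂ} :
    x ∈ wt N (-2) ↔ ∃ w, toC N *ᵥ w = x := by
  simp [wt, toLin'_apply]

theorem mem_grFilt_zero {N : Matrix ι ι ℝ} {F : Filt ι} {p : ℤ} {x : ι → ℂ} :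
    x ∈ grFilt N F 0 p ↔ ∃ a ∈ F p, toC N *ᵥ (x - a) = 0 := by
  rw [grFilt, wt_nonneg N le_rfl, inf_top_eq, zero_sub, Submodule.mem_sup]
  constructor
  · rintro ⟨a, ha, k, hk, rfl⟩
    exact ⟨a, ha, by rw [add_sub_cancel_left]; exact mem_wt_neg_one.1 hk⟩
  · rintro ⟨a, ha, hk⟩
    exact ⟨a, ha, x - a, mem_wt_neg_one.2 hk, by abel⟩

theorem mem_grFilt_neg_one {N : Matrix ι ι ℝ} {F : Filt ι} {p : ℤ} {x : ι → ℂ} :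
    x ∈ grFilt N F (-1) p ↔ ∃ a ∈ F p, toC N *ᵥ a = 0 ∧ ∃ w, x = a + toC N *ᵥ w := by
  rw [grFilt, Submodule.mem_sup]
  constructor
  · rintro ⟨a, ⟨ha, ha'⟩, k, hk, rfl⟩
    obtain ⟨w, rfl⟩ := mem_wt_neg_two.1 hk
    exact ⟨a, ha, mem_wt_neg_one.1 ha', w, rfl⟩
  · rintro ⟨a, ha, ha', w, rfl⟩
    exact ⟨a, ⟨ha, mem_wt_neg_one.2 ha'⟩, _, mem_wt_neg_two.2 ⟨w, rfl⟩, rfl⟩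

theorem mem_grFilt_neg_two {N : Matrix ι ι ℝ} {F : Filt ι} {p : ℤ} {x : ι → ℂ} :
    x ∈ grFilt N F (-2) p ↔ x ∈ F p ∧ ∃ w, toC N *ᵥ w = x := by
  rw [grFilt, wt_le_neg_three N (k := -2 - 1) (by norm_num), sup_bot_eq, Submodule.mem_inf,
    mem_wt_neg_two]

theorem grFilt_pos (N : Matrix ι ι ℝ) (F : Filt ι) {k : ℤ} (hk : 1 ≤ k) (p : ℤ) :
    grFilt N F k p = ⊤ := by
  rw [grFilt, wt_nonneg N (k := k - 1) (by omega), sup_top_eq]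

theorem grFilt_le_neg_three (N : Matrix ι ι ℝ) (F : Filt ι) {k : ℤ} (hk : k ≤ -3) (p : ℤ) :
    grFilt N F k p = ⊥ := by
  rw [grFilt, wt_le_neg_three N hk, wt_le_neg_three N (k := k - 1) (by omega)]; simp

theorem conjSub_wt (N : Matrix ι ι ℝ) (k : ℤ) : conjSub (wt N k) = wt N k := by
  rcases lt_or_ge k (-2) with hk | hk
  · rw [wt_le_neg_three N (by omega), conjSub_bot]
  rcases lt_or_ge k 0 with hk' | hk'
  · obtain rfl | rfl : k = -2 ∨ k = -1 := by omega
    · ext x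
      simp only [mem_conjSub, mem_wt_neg_two]
      constructor
      · rintro ⟨w, hw⟩; exact ⟨conjVec w, by rw [← conjVec_toC_mulVec, hw, conjVec_conjVec]⟩
      · rintro ⟨w, rfl⟩; exact ⟨conjVec w, by simp⟩
    · ext x
      simp only [mem_conjSub, mem_wt_neg_one]
      rw [← conjVec_toC_mulVec, conjVec_eq_zero]
  · rw [wt_nonneg N hk', conjSub_top]

theorem wt_sub_one_le {N : Matrix ι ι ℝ} (hN : N * N = 0) (k : ℤ) : wt N (k - 1) ≤ wt N k := by
  rcases le_or_gt k (-2) with hk | hk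
  · rw [wt_le_neg_three N (k := k - 1) (by omega)]; exact bot_le
  rcases lt_or_ge k 0 with hk' | hk'
  · obtain rfl : k = -1 := by omega
    intro x hx
    obtain ⟨w, rfl⟩ := mem_wt_neg_two.1 hx
    rw [mem_wt_neg_one, mulVec_mulVec, ← toC_mul, hN, toC_zero, zero_mulVec]
  · rw [wt_nonneg N hk']; exact le_top

theorem grFilt_le_wt {N : Matrix ι ι ℝ} (hN : N * N = 0) (F : Filt ι) (k p : ℤ) :
    grFilt N F k p ≤ wt N k :=
  sup_le inf_le_right (wt_sub_one_le hN k)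

theorem zpow_I_two_mul_add_one (p : ℤ) : I ^ (2 * p + 1) = I ^ (2 * p) * I := by
  rw [zpow_add₀ I_ne_zero, zpow_one]

theorem zpow_I_even {p : ℤ} (hp : Even p) : I ^ (2 * p) = 1 := by
  rw [_root_.zpow_mul, zpow_ofNat, I_sq, hp.neg_one_zpow]

theorem zpow_I_odd {p : ℤ} (hp : Odd p) : I ^ (2 * p) = -1 := by
  rw [_root_.zpow_mul, zpow_ofNat, I_sq, hp.neg_one_zpow]

/-! ### The limiting mixed Hodge structure of a nilpotent orbit with `N² = 0` -/

/-- A point `F` of the compact dual, without reference to the Hodge numbers. -/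
structure DualFilt (Q : Matrix ι ι ℤ) (F : Filt ι) : Prop where
  alt : Qᵀ = -Q
  nondeg : Q.det ≠ 0
  anti : Antitone F
  orth : ∀ p x, x ∈ F p ↔ ∀ y ∈ F (-p), form Q x y = 0
  bot : ∃ m, F m = ⊥

/-- A point `F` of the compact dual together with some `N ∈ 𝔤` with `N² = 0`. -/
structure MonodromyFilt (Q : Matrix ι ι ℤ) (N : Matrix ι ι ℝ) (F : Filt ι) : Prop
    extends DualFilt Q F where
  lie : N ∈ LieG Q
  sq : N * N = 0

/-- The properties of `(N, F)` from which the limiting mixed Hodge structure is derived: `F` is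
isotropic and horizontal for `N`, and two consequences of `exp(iyN)F ∈ D` for large `y`. The
vectors of `exp(iyN)F^p` that are orthogonal to `conj (exp(iyN)F^{p+1})` form its Hodge component
of index `p`. It contains the `v ∈ F^p ∩ Ker N` of `pos_ker`, which do not move with `y`, and the
`exp(iyN)x` with `x` as in `nonneg`, on which the polarization is affine in `y` with leading
coefficient given by `⟨x, N conj x⟩`. -/
structure OrbitPositivity (Q : Matrix ι ι ℤ) (N : Matrix ι ι ℝ) (F : Filt ι) : Prop
    extends MonodromyFilt Q N F where
  hor : ∀ p, ∀ x ∈ F p, toC N *ᵥ x ∈ F (p - 1)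
  pos_ker : ∀ p, ∀ v ∈ F p, toC N *ᵥ v = 0 → (∀ y ∈ F (p + 1), form Q v (conjVec y) = 0) →
    v ≠ 0 → 0 < (I ^ (2 * p + 1) * form Q v (conjVec v)).re
  nonneg : ∀ p, ∀ x ∈ F p, (∀ y ∈ F (p + 1), form Q x (conjVec y) = 0) →
    (∀ y ∈ F (p + 1), form Q x (toC N *ᵥ conjVec y) = 0) →
    0 ≤ (I ^ (2 * p) * form Q x (toC N *ᵥ conjVec x)).re

theorem toC_mulVec_mulVec_eq_zero {N : Matrix ι ι ℝ} (h : N * N = 0) (x : ι → ℂ) :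
    toC N *ᵥ (toC N *ᵥ x) = 0 := by
  rw [mulVec_mulVec, ← toC_mul, h, toC_zero, zero_mulVec]

/-- `⟨x, N conj y⟩` is a Hermitian form. -/
theorem form_N_conj_swap {Q : Matrix ι ι ℤ} (hQ : Qᵀ = -Q) {N : Matrix ι ι ℝ} (hN : N ∈ LieG Q)
    (x y : ι → ℂ) :
    form Q y (toC N *ᵥ conjVec x) = (starRingEnd ℂ) (form Q x (toC N *ᵥ conjVec y)) := by
  have h1 := mem_LieG_iff.1 hN y (conjVec x)
  rw [form_conj_swap hQ, conjVec_toC_mulVec] at h1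
  exact (neg_inj.1 h1).symm

theorem form_nondeg_right {Q : Matrix ι ι ℤ} (hQ : Qᵀ = -Q) (hQ' : Q.det ≠ 0) {x : ι → ℂ}
    (h : ∀ y, form Q y x = 0) : x = 0 :=
  form_nondeg hQ' fun y => by rw [form_swap hQ, h, neg_zero]

/-- A functional `⟨x, ·⟩` that vanishes on `B ∩ Ker N` agrees on `B` with one given by a vector of
`Im N`, because `Im N` is the orthogonal complement of `Ker N`. -/
theorem exists_form_mulVec_eq {Q : Matrix ι ι ℤ} (hQ : Qᵀ = -Q) (hQ' : Q.det ≠ 0)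
    {N : Matrix ι ι ℝ} (hN : N ∈ LieG Q) (B : Submodule ℂ (ι → ℂ)) {x : ι → ℂ}
    (hx : ∀ k ∈ B, toC N *ᵥ k = 0 → form Q x k = 0) :
    ∃ w, ∀ b ∈ B, form Q (toC N *ᵥ w) b = form Q x b := by
  obtain ⟨w, -, hw⟩ := exists_mem_forall_eq ⊤ B ((formL Q).comp (toLin' (toC N))) (formL Q x) (by
    intro b hb hb'
    apply hx b hb
    apply form_nondeg_right hQ hQ'
    intro z
    have := hb' z trivial
    simp only [LinearMap.comp_apply, toLin'_apply, formL_apply] at this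
    rwa [mem_LieG_iff.1 hN, neg_eq_zero] at this)
  exact ⟨w, fun b hb => by simpa [toLin'_apply] using hw b hb⟩

/-- A vector that is orthogonal to `Ker N` lies in `Im N`. -/
theorem exists_mulVec_eq_of_orth_ker {Q : Matrix ι ι ℤ} (hQ : Qᵀ = -Q) (hQ' : Q.det ≠ 0)
    {N : Matrix ι ι ℝ} (hN : N ∈ LieG Q) {x : ι → ℂ}
    (hx : ∀ k, toC N *ᵥ k = 0 → form Q x k = 0) : ∃ w, toC N *ᵥ w = x := by
  obtain ⟨w, hw⟩ := exists_form_mulVec_eq hQ hQ' hN ⊤ (x := x) fun k _ hk => hx k hk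
  refine ⟨w, sub_eq_zero.1 (form_nondeg hQ' fun y => ?_)⟩
  rw [form_sub_left, hw y trivial, sub_self]

namespace DualFilt

variable {Q : Matrix ι ι ℤ} {F : Filt ι}

/-- The subspace `conj F^{-p}` is the orthogonal complement of `F^p` for the Hermitian form. This
turns orthogonal projections to `F^p` into decompositions with respect to `F^p` and `conj F^{-p}`.
-/
theorem mem_of_conj (h : DualFilt Q F) {p : ℤ} {x : ι → ℂ}
    (hx : ∀ y ∈ F p, form Q x (conjVec y) = 0) : conjVec x ∈ F (-p) := by
  rw [h.orth]
  intro y hy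
  rw [neg_neg] at hy
  rw [← conjVec_conjVec y, form_conjVec_eq_zero]
  exact hx y hy

theorem form_eq_zero (h : DualFilt Q F) {p q : ℤ} (hpq : 0 ≤ p + q) {x y : ι → ℂ}
    (hx : x ∈ F p) (hy : y ∈ F q) : form Q x y = 0 :=
  (h.orth p x).1 hx y (h.anti (by omega) hy)

theorem form_conj_eq_zero (h : DualFilt Q F) {p q : ℤ} (hpq : 0 ≤ p + q) {x y : ι → ℂ}
    (hx : conjVec x ∈ F p) (hy : conjVec y ∈ F q) : form Q x y = 0 :=
  form_conjVec_eq_zero.1 (h.form_eq_zero hpq hx hy)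

end DualFilt

theorem ker_conj {N : Matrix ι ι ℝ} {k : ι → ℂ} (hk : toC N *ᵥ k = 0) : toC N *ᵥ conjVec k = 0 := by
  rw [← conjVec_toC_mulVec, hk, conjVec_zero]

namespace MonodromyFilt

variable {Q : Matrix ι ι ℤ} {N : Matrix ι ι ℝ} {F : Filt ι}

theorem form_N_ker (h : MonodromyFilt Q N F) (w : ι → ℂ) {k : ι → ℂ} (hk : toC N *ᵥ k = 0) :
    form Q (toC N *ᵥ w) k = 0 := by
  rw [mem_LieG_iff.1 h.lie, hk, form_zero_right, neg_zero]

theorem form_ker_N (h : MonodromyFilt Q N F) (w : ι → ℂ) {k : ι → ℂ} (hk : toC N *ᵥ k = 0) :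
    form Q k (toC N *ᵥ w) = 0 := by
  rw [form_swap h.alt, h.form_N_ker w hk, neg_zero]

end MonodromyFilt

namespace OrbitPositivity

variable {Q : Matrix ι ι ℤ} {N : Matrix ι ι ℝ} {F : Filt ι}

/-- The definiteness that all nondegeneracy statements about `F` and `N` are reduced to. -/
theorem eq_zero_of_null (h : OrbitPositivity Q N F) {p : ℤ} {v : ι → ℂ} (hv : v ∈ F p)
    (hv' : toC N *ᵥ v = 0) (ho : ∀ y ∈ F (p + 1), form Q v (conjVec y) = 0)
    (hn : form Q v (conjVec v) = 0) : v = 0 := by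
  by_contra hne
  have := h.pos_ker p v hv hv' ho hne
  rw [hn] at this
  simp at this

/-- The Hermitian form `⟨x, N conj y⟩` is nondegenerate on the image of `F^p` in `H / Ker N`: a
vector `x` in the radical gives the null vector `Nx` of the Hodge component of index `p - 1`. -/
theorem N_radical (h : OrbitPositivity Q N F) {p : ℤ} {x : ι → ℂ} (hx : x ∈ F p)
    (ho : ∀ y ∈ F p, form Q x (toC N *ᵥ conjVec y) = 0) : toC N *ᵥ x = 0 := by
  apply h.eq_zero_of_null (h.hor p x hx) (toC_mulVec_mulVec_eq_zero h.sq x)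
  · intro y hy
    rw [sub_add_cancel] at hy
    rw [mem_LieG_iff.1 h.lie, ho y hy, neg_zero]
  · rw [conjVec_toC_mulVec]
    exact h.form_N_ker _ (toC_mulVec_mulVec_eq_zero h.sq _)

theorem N_radical_conj (h : OrbitPositivity Q N F) {p : ℤ} {x : ι → ℂ} (hx : x ∈ F p)
    (ho : ∀ y ∈ F p, form Q (toC N *ᵥ y) (conjVec x) = 0) : toC N *ᵥ x = 0 := by
  apply h.N_radical hx
  intro y hy
  rw [form_N_conj_swap h.alt h.lie, map_eq_zero, ← neg_eq_zero, ← mem_LieG_iff.1 h.lie]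
  exact ho y hy

/-- Orthogonal projection to `F^p` with respect to `⟨x, N conj y⟩`. -/
theorem exists_N_proj (h : OrbitPositivity Q N F) (p : ℤ) (w : ι → ℂ) :
    ∃ a ∈ F p, ∀ z ∈ F p, form Q (w - a) (toC N *ᵥ conjVec z) = 0 := by
  obtain ⟨a, ha, ha'⟩ := exists_mem_forall_eq (F p) (conjSub (F p))
    ((formL Q).comp (toLin' (toC N))) ((formL Q) (toC N *ᵥ w)) (by
      intro b hb hb'
      have : toC N *ᵥ conjVec b = 0 := by
        apply h.N_radical_conj (p := p) hb
        intro y hy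
        rw [conjVec_conjVec]
        exact hb' y hy
      exact h.form_N_ker w (by simpa using ker_conj this))
  refine ⟨a, ha, fun z hz => ?_⟩
  have := ha' (conjVec z) (by simpa using hz)
  simp only [LinearMap.comp_apply, toLin'_apply, formL_apply] at this
  rw [← neg_eq_zero, ← mem_LieG_iff.1 h.lie, mulVec_sub, form_sub_left, this, sub_self]

/-- `N : (H, F) → (H, F[-1])` is strict. -/
theorem strict (h : OrbitPositivity Q N F) {p : ℤ} {w : ι → ℂ} (hw : toC N *ᵥ w ∈ F (p - 1)) :
    ∃ a ∈ F p, toC N *ᵥ a = toC N *ᵥ w := by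
  obtain ⟨a, ha, ha'⟩ := h.exists_N_proj p w
  refine ⟨a, ha, ?_⟩
  rw [eq_comm, ← sub_eq_zero, ← mulVec_sub]
  apply h.eq_zero_of_null (p := p - 1) _ (toC_mulVec_mulVec_eq_zero h.sq _)
  · intro y hy
    rw [sub_add_cancel] at hy
    rw [mem_LieG_iff.1 h.lie, ha' y hy, neg_zero]
  · rw [conjVec_toC_mulVec]
    exact h.form_N_ker _ (toC_mulVec_mulVec_eq_zero h.sq _)
  · rw [mulVec_sub]
    exact Submodule.sub_mem _ hw (h.hor p a ha)

/-- `Gr_0 = F^p + conj F^{1-p}`, in terms of the isomorphism `N : Gr_0 ≅ Gr_{-2}`: the error of the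
orthogonal projection to `F^p` lies in `conj F^{1-p}`, as `N` is strict. -/
theorem gr_zero_sup (h : OrbitPositivity Q N F) (p : ℤ) (w : ι → ℂ) :
    ∃ a ∈ F p, ∃ c ∈ F (1 - p), toC N *ᵥ w = toC N *ᵥ a + toC N *ᵥ conjVec c := by
  obtain ⟨a, ha, ha'⟩ := h.exists_N_proj p w
  have h1 : toC N *ᵥ conjVec (w - a) ∈ F (1 - p - 1) := by
    rw [← conjVec_toC_mulVec, show 1 - p - 1 = -p by ring]
    apply h.mem_of_conj
    intro y hy
    rw [mem_LieG_iff.1 h.lie, ha' y hy, neg_zero]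
  obtain ⟨c, hc, hc'⟩ := h.strict h1
  refine ⟨a, ha, c, hc, ?_⟩
  rw [← conjVec_toC_mulVec, hc', conjVec_toC_mulVec, conjVec_conjVec, ← mulVec_add]
  congr 1; abel

/-- `F^p ∩ conj F^{1-p} = 0` on `Gr_0`. -/
theorem gr_zero_inf (h : OrbitPositivity Q N F) {p : ℤ} {a c : ι → ℂ} (ha : a ∈ F p)
    (hc : c ∈ F (1 - p)) (hac : toC N *ᵥ a = toC N *ᵥ conjVec c) : toC N *ᵥ a = 0 := by
  apply h.N_radical ha
  intro y hy
  rw [← neg_eq_zero, ← mem_LieG_iff.1 h.lie, hac, ← conjVec_toC_mulVec, form_conjVec_eq_zero]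
  exact h.form_eq_zero (by omega) (h.hor _ c hc) hy

/-- The Hermitian form is nondegenerate on the image of `F^p ∩ Ker N` in `Ker N / Im N`. -/
theorem ker_radical (h : OrbitPositivity Q N F) {p : ℤ} {x : ι → ℂ} (hx : x ∈ F p)
    (hx' : toC N *ᵥ x = 0)
    (ho : ∀ z ∈ F p, toC N *ᵥ z = 0 → form Q x (conjVec z) = 0) :
    ∃ a ∈ F (p + 1), toC N *ᵥ a = x := by
  obtain ⟨w, hw⟩ := exists_form_mulVec_eq h.alt h.nondeg h.lie (conjSub (F p)) (x := x)
    (fun k hk hk' => by simpa using ho (conjVec k) hk (ker_conj hk'))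
  -- `x` and `Nw` have the same products with `conj F^p`, and `Na` is the part of `Nw` in `F^p`
  obtain ⟨a, ha, c, hc, hac⟩ := h.gr_zero_sup (p + 1) w
  refine ⟨a, ha, ?_⟩
  have hNa : toC N *ᵥ a ∈ F p := by simpa using h.hor _ a ha
  have hk : toC N *ᵥ (x - toC N *ᵥ a) = 0 := by
    rw [mulVec_sub, hx', toC_mulVec_mulVec_eq_zero h.sq, sub_zero]
  have hv : x - toC N *ᵥ a ∈ F p := Submodule.sub_mem _ hx hNa
  symm
  rw [← sub_eq_zero]
  apply h.eq_zero_of_null hv hk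
  · intro y hy
    have h1 := hw (conjVec y) (by simpa using h.anti (by omega : p ≤ p + 1) hy)
    rw [hac, form_add_left] at h1
    have h2 : form Q (toC N *ᵥ conjVec c) (conjVec y) = 0 := by
      rw [← conjVec_toC_mulVec, form_conjVec_eq_zero]
      exact h.form_eq_zero (by omega) (h.hor _ c hc) hy
    rw [form_sub_left, ← h1, h2, add_zero, sub_self]
  · rw [form_sub_left, ho _ hv hk, h.form_N_ker _ (ker_conj hk), sub_zero]

/-- Orthogonal projection to `F^p ∩ Ker N`. -/
theorem exists_ker_proj (h : OrbitPositivity Q N F) {p : ℤ} {x : ι → ℂ}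
    (hx : ∀ a ∈ F (p + 1), form Q x (toC N *ᵥ conjVec a) = 0) :
    ∃ u ∈ F p, toC N *ᵥ u = 0 ∧
      ∀ z ∈ F p, toC N *ᵥ z = 0 → form Q (x - u) (conjVec z) = 0 := by
  obtain ⟨u, ⟨hu, hu'⟩, huo⟩ := exists_mem_forall_eq (F p ⊓ wt N (-1))
    (conjSub (F p ⊓ wt N (-1))) (formL Q) (formL Q x) (by
      rintro b ⟨hb, hb'⟩ hbo
      have hb' := mem_wt_neg_one.1 hb'
      obtain ⟨a, ha, hab⟩ := h.ker_radical hb hb' (by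
        intro z hz hz'
        rw [form_conjVec_eq_zero, form_swap h.alt, neg_eq_zero]
        exact hbo z ⟨hz, mem_wt_neg_one.2 hz'⟩)
      have := hx a ha
      rwa [← conjVec_toC_mulVec, hab, conjVec_conjVec] at this)
  refine ⟨u, hu, mem_wt_neg_one.1 hu', fun z hz hz' => ?_⟩
  have := huo (conjVec z) (by simpa using And.intro hz (mem_wt_neg_one.2 hz'))
  simp only [formL_apply] at this
  rw [form_sub_left, this, sub_self]

/-- `Gr_{-1} = F^p + conj F^{-p}`. -/
theorem gr_one_sup (h : OrbitPositivity Q N F) (p : ℤ) {x : ι → ℂ} (hx : toC N *ᵥ x = 0) :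
    ∃ u ∈ F p, toC N *ᵥ u = 0 ∧ ∃ t ∈ F (-p), toC N *ᵥ t = 0 ∧
      ∃ w, x = u + conjVec t + toC N *ᵥ w := by
  obtain ⟨u, hu, hu', huo⟩ := h.exists_ker_proj (p := p) (x := x)
    (fun a _ => h.form_ker_N _ hx)
  obtain ⟨w, hw⟩ := exists_form_mulVec_eq h.alt h.nondeg h.lie (conjSub (F p)) (x := x - u)
    (fun k hk hk' => by simpa using huo (conjVec k) hk (ker_conj hk'))
  refine ⟨u, hu, hu', conjVec (x - u - toC N *ᵥ w), ?_, ?_, w, ?_⟩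
  · apply h.mem_of_conj
    intro y hy
    rw [form_sub_left, hw _ (by simpa using hy), sub_self]
  · apply ker_conj
    rw [mulVec_sub, mulVec_sub, hx, hu', toC_mulVec_mulVec_eq_zero h.sq]; simp
  · rw [conjVec_conjVec]; abel

/-- `F^p ∩ conj F^{-p} = 0` on `Gr_{-1}`. -/
theorem gr_one_inf (h : OrbitPositivity Q N F) {p : ℤ} {u t w : ι → ℂ} (hu : u ∈ F p)
    (hu' : toC N *ᵥ u = 0) (ht : t ∈ F (-p)) (hut : u = conjVec t + toC N *ᵥ w) :
    ∃ a ∈ F (p + 1), toC N *ᵥ a = u := by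
  apply h.ker_radical hu hu'
  intro z hz hz'
  rw [hut, form_add_left, h.form_N_ker _ (ker_conj hz'), add_zero, form_conjVec_eq_zero]
  exact h.form_eq_zero (by omega) ht hz

/-- The polarization of `Gr_{-1}`. A class of type `(p, -p-1)` has a representative in
`F^p ∩ conj F^{-p-1} ∩ Ker N`, which is a Hodge vector of every `exp(zN)F`. -/
theorem pos_gr_one (h : OrbitPositivity Q N F) {p : ℤ} {u t w w' v : ι → ℂ} (hu : u ∈ F p)
    (hu' : toC N *ᵥ u = 0) (ht : t ∈ F (-p - 1)) (hut : v = u + toC N *ᵥ w)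
    (hut' : v = conjVec t + toC N *ᵥ w') (hv : ∀ w, toC N *ᵥ w ≠ v) :
    0 < (I ^ (2 * p + 1) * form Q v (conjVec v)).re := by
  -- `u - Na = conj (t + Nc)` is the representative of `v` modulo `Im N`
  obtain ⟨a, ha, c, hc, hac⟩ := h.gr_zero_sup (p + 1) (w' - w)
  have hvk : toC N *ᵥ v = 0 := by
    rw [hut, mulVec_add, hu', toC_mulVec_mulVec_eq_zero h.sq, add_zero]
  have hNa : toC N *ᵥ a ∈ F p := by simpa using h.hor _ a ha
  have hNc : toC N *ᵥ c ∈ F (-p - 1) := by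
    have := h.hor _ c hc
    rwa [show 1 - (p + 1) - 1 = -p - 1 by ring] at this
  have h1 : u - toC N *ᵥ a = conjVec (t + toC N *ᵥ c) := by
    rw [mulVec_sub] at hac
    rw [conjVec_add, conjVec_toC_mulVec]
    have h2 : u + toC N *ᵥ w = conjVec t + toC N *ᵥ w' := by rw [← hut, hut']
    linear_combination (exp := 1) h2 + hac
  have hk : toC N *ᵥ (u - toC N *ᵥ a) = 0 := by
    rw [mulVec_sub, hu', toC_mulVec_mulVec_eq_zero h.sq, sub_zero]
  have h3 := h.pos_ker p (u - toC N *ᵥ a) (Submodule.sub_mem _ hu hNa) hk (by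
    intro y hy
    rw [h1, form_conjVec_eq_zero]
    exact h.form_eq_zero (by omega) (Submodule.add_mem _ ht hNc) hy) (by
    intro h0
    refine hv (a + w) ?_
    rw [hut, mulVec_add, sub_eq_zero.1 h0])
  have h4 : v = u - toC N *ᵥ a + toC N *ᵥ (w + a) := by rw [hut, mulVec_add]; abel
  have h5 : form Q v (conjVec v) = form Q (u - toC N *ᵥ a) (conjVec (u - toC N *ᵥ a)) := by
    nth_rw 2 [h4]
    rw [conjVec_add, form_add_right, conjVec_toC_mulVec _ (w + a), h.form_ker_N _ hvk, add_zero,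
      h4, form_add_left, h.form_N_ker _ (ker_conj hk), add_zero]
  rwa [h5]

/-- If `x ∈ F^p` is orthogonal to `F^{p+1}` with respect to `⟨x, N conj y⟩`, a vector of `F^p` with
the same image in `H / Ker N` is also orthogonal to it with respect to `⟨x, conj y⟩`. -/
theorem exists_orth_lift (h : OrbitPositivity Q N F) {p : ℤ} {x : ι → ℂ} (hx : x ∈ F p)
    (ho : ∀ y ∈ F (p + 1), form Q x (toC N *ᵥ conjVec y) = 0) :
    ∃ x' ∈ F p, toC N *ᵥ x' = toC N *ᵥ x ∧ ∀ y ∈ F (p + 1), form Q x' (conjVec y) = 0 := by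
  obtain ⟨u, hu, hu', huo⟩ := h.exists_ker_proj (p := p + 1) (x := x)
    (fun a ha => ho a (h.anti (by omega) ha))
  obtain ⟨c, hc, hc'⟩ := exists_mem_forall_eq (F (p + 1)) (conjSub (F (p + 1)))
    ((formL Q).comp (toLin' (toC N))) (formL Q (x - u)) (by
      intro b hb hb'
      have : toC N *ᵥ conjVec b = 0 := by
        apply h.N_radical_conj (p := p + 1) hb
        intro y hy
        rw [conjVec_conjVec]
        exact hb' y hy
      simpa [form_sub_left] using huo (conjVec b) hb this)
  refine ⟨x - u - toC N *ᵥ c, ?_, ?_, ?_⟩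
  · refine Submodule.sub_mem _ (Submodule.sub_mem _ hx (h.anti (by omega) hu)) ?_
    simpa using h.hor _ c hc
  · rw [mulVec_sub, mulVec_sub, hu', toC_mulVec_mulVec_eq_zero h.sq, sub_zero, sub_zero]
  · intro y hy
    have := hc' (conjVec y) (by simpa using hy)
    simp only [LinearMap.comp_apply, toLin'_apply, formL_apply] at this
    rw [form_sub_left, this, sub_self]

/-- The polarization of `Gr_0` is semidefinite. The classes of type `(p, -p)` are those of the
vectors of `F^p` that are orthogonal to `F^{p+1}` with respect to `⟨x, N conj y⟩`. -/
theorem nonneg_of_orth (h : OrbitPositivity Q N F) {p : ℤ} {x : ι → ℂ} (hx : x ∈ F p)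
    (ho : ∀ y ∈ F (p + 1), form Q x (toC N *ᵥ conjVec y) = 0) :
    0 ≤ (I ^ (2 * p) * form Q x (toC N *ᵥ conjVec x)).re := by
  obtain ⟨x', hx', hN, ho'⟩ := h.exists_orth_lift hx ho
  have h1 : ∀ y, form Q x' (toC N *ᵥ y) = form Q x (toC N *ᵥ y) := by
    intro y
    rw [← neg_inj, ← mem_LieG_iff.1 h.lie, ← mem_LieG_iff.1 h.lie, hN]
  have h2 := h.nonneg p x' hx' ho' (fun y hy => by rw [h1]; exact ho y hy)
  rwa [h1, ← conjVec_toC_mulVec, hN, conjVec_toC_mulVec] at h2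

/-- The polarization of `Gr_0`: semidefinite and nondegenerate forms are definite. -/
theorem pos_of_orth (h : OrbitPositivity Q N F) {p : ℤ} {x : ι → ℂ} (hx : x ∈ F p)
    (ho : ∀ y ∈ F (p + 1), form Q x (toC N *ᵥ conjVec y) = 0) (hx' : toC N *ᵥ x ≠ 0) :
    0 < (I ^ (2 * p) * form Q x (toC N *ᵥ conjVec x)).re := by
  refine lt_of_le_of_ne (h.nonneg_of_orth hx ho) fun h0 => hx' ?_
  -- by the Cauchy-Schwarz inequality a null vector is in the radical
  have hc : ∃ c : ℝ, c ≠ 0 ∧ I ^ (2 * p) = (c : ℂ) := by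
    rcases Int.even_or_odd p with hp | hp
    · exact ⟨1, by norm_num, by simp [zpow_I_even hp]⟩
    · exact ⟨-1, by norm_num, by simp [zpow_I_odd hp]⟩
  obtain ⟨c, hc0, hc⟩ := hc
  have key : ∀ z ∈ F p, (∀ y ∈ F (p + 1), form Q z (toC N *ᵥ conjVec y) = 0) →
      form Q x (toC N *ᵥ conjVec z) = 0 := by
    intro z hz hzo
    set s := form Q x (toC N *ᵥ conjVec z) with hs
    set a := (c * form Q z (toC N *ᵥ conjVec z)).re with ha
    -- the value of the form at `z - rc (conj s) x`, which is affine in `r`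
    have h1 : ∀ r : ℝ, 0 ≤ a - r * (2 * c ^ 2 * normSq s) := by
      intro r
      have h2 := h.nonneg_of_orth (x := z - ((r * c : ℝ) * (starRingEnd ℂ) s) • x)
        (Submodule.sub_mem _ hz (Submodule.smul_mem _ _ hx)) (fun y hy => by
          rw [form_sub_left, form_smul_left, hzo y hy, ho y hy, mul_zero, sub_zero])
      have h3 : form Q z (toC N *ᵥ conjVec x) = (starRingEnd ℂ) s :=
        form_N_conj_swap h.alt h.lie x z
      have h4 : (form Q x (toC N *ᵥ conjVec x)).re = 0 := by
        rw [hc, re_ofReal_mul] at h0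
        exact (mul_eq_zero.1 h0.symm).resolve_left hc0
      rw [hc, re_ofReal_mul] at h2
      simp only [conjVec_sub, conjVec_smul, mulVec_sub, mulVec_smul, form_sub_left,
        form_sub_right, form_smul_left, form_smul_right, h3, ← hs] at h2
      simp only [sub_re, sub_im, mul_re, mul_im, ofReal_re, ofReal_im, conj_re, conj_im, map_mul,
        conj_ofReal, Complex.conj_conj, h4] at h2
      rw [ha, re_ofReal_mul, normSq_apply]
      convert h2 using 1
      ring
    have h5 : 2 * c ^ 2 * normSq s = 0 := by
      by_contra hne
      have := h1 ((a + 1) / (2 * c ^ 2 * normSq s))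
      rw [div_mul_cancel₀ _ hne] at this
      linarith
    rcases mul_eq_zero.1 h5 with h6 | h6
    · exact absurd h6 (by positivity)
    · exact normSq_eq_zero.1 h6
  apply h.N_radical hx
  intro w hw
  obtain ⟨a, ha, ha'⟩ := h.exists_N_proj (p + 1) w
  have h1 := ho a ha
  have h2 := key (w - a) (Submodule.sub_mem _ hw (h.anti (by omega) ha)) ha'
  rwa [conjVec_sub, mulVec_sub, form_sub_right, h1, sub_zero] at h2

/-- The limiting mixed Hodge structure of a nilpotent orbit with `N² = 0`. -/
theorem isLMHS (h : OrbitPositivity Q N F) : IsLMHS Q N F := by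
  have hcases : ∀ k : ℤ, 1 ≤ k ∨ k = 0 ∨ k = -1 ∨ k = -2 ∨ k ≤ -3 := by omega
  refine ⟨?_, ?_, ?_, ?_, ?_, ?_, ?_⟩
  · intro k p
    apply le_antisymm
    · exact sup_le (grFilt_le_wt h.sq F k p)
        (conjSub_wt N k ▸ conjSub_mono (grFilt_le_wt h.sq F k _))
    rcases hcases k with hk | rfl | rfl | rfl | hk
    · rw [grFilt_pos N F hk, top_sup_eq]; exact le_top
    · intro x _
      obtain ⟨a, ha, c, hc, hac⟩ := h.gr_zero_sup p x
      rw [Submodule.mem_sup]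
      refine ⟨a, mem_grFilt_zero.2 ⟨a, ha, by simp⟩, x - a, mem_grFilt_zero.2 ⟨c, ?_, ?_⟩,
        by abel⟩
      · rwa [show (0 : ℤ) + 1 - p = 1 - p by ring]
      · rw [← conjVec_conjVec c, ← conjVec_sub, ← conjVec_toC_mulVec, conjVec_eq_zero, mulVec_sub,
          mulVec_sub, hac]
        abel
    · intro x hx
      obtain ⟨u, hu, hu', t, ht, ht', w, hw⟩ := h.gr_one_sup p (mem_wt_neg_one.1 hx)
      rw [Submodule.mem_sup]
      refine ⟨u, mem_grFilt_neg_one.2 ⟨u, hu, hu', 0, by simp⟩, x - u,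
        mem_grFilt_neg_one.2 ⟨t, ?_, ht', conjVec w, ?_⟩, by abel⟩
      · rwa [show (-1 : ℤ) + 1 - p = -p by ring]
      · rw [hw, ← conjVec_toC_mulVec, ← conjVec_conjVec t, ← conjVec_add, conjVec_conjVec]
        congr 1; abel
    · intro x hx
      obtain ⟨w, rfl⟩ := mem_wt_neg_two.1 hx
      obtain ⟨a, ha, c, hc, hac⟩ := h.gr_zero_sup (p + 1) w
      rw [Submodule.mem_sup]
      refine ⟨toC N *ᵥ a, mem_grFilt_neg_two.2 ⟨?_, a, rfl⟩, toC N *ᵥ conjVec c,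
        mem_grFilt_neg_two.2 ⟨?_, c, ?_⟩, hac.symm⟩
      · simpa using h.hor _ a ha
      · rw [conjVec_toC_mulVec, conjVec_conjVec]
        have := h.hor _ c hc
        rwa [show 1 - (p + 1) - 1 = -2 + 1 - p by ring] at this
      · rw [conjVec_toC_mulVec, conjVec_conjVec]
    · rw [wt_le_neg_three N hk]; exact bot_le
  · intro k p
    apply le_antisymm
    swap
    · exact le_inf le_sup_right (conjSub_wt N (k - 1) ▸ conjSub_mono le_sup_right)
    rcases hcases k with hk | rfl | rfl | rfl | hk
    · rw [wt_nonneg N (k := k - 1) (by omega)]; exact le_top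
    · rintro x ⟨hx, hx'⟩
      obtain ⟨a, ha, hxa⟩ := mem_grFilt_zero.1 hx
      obtain ⟨c, hc, hxc⟩ := mem_grFilt_zero.1 (mem_conjSub.1 hx')
      rw [show (0 : ℤ) + 1 - p = 1 - p by ring] at hc
      rw [mulVec_sub, sub_eq_zero] at hxa hxc
      refine mem_wt_neg_one.2 ?_
      rw [hxa]
      refine h.gr_zero_inf ha hc ?_
      rw [← hxa, ← conjVec_toC_mulVec, ← hxc, ← conjVec_toC_mulVec, conjVec_conjVec]
    · rintro x ⟨hx, hx'⟩
      obtain ⟨a, ha, ha', w, hw⟩ := mem_grFilt_neg_one.1 hx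
      obtain ⟨c, hc, hc', w', hw'⟩ := mem_grFilt_neg_one.1 (mem_conjSub.1 hx')
      rw [show (-1 : ℤ) + 1 - p = -p by ring] at hc
      obtain ⟨b, hb, hb'⟩ := h.gr_one_inf ha ha' hc (w := conjVec w' - w) (by
        rw [mulVec_sub, ← conjVec_toC_mulVec, ← add_sub_assoc, ← conjVec_add, ← hw',
          conjVec_conjVec, hw]
        abel)
      exact mem_wt_neg_two.2 ⟨b + w, by rw [hw, mulVec_add, hb']⟩
    · rintro x ⟨hx, hx'⟩
      obtain ⟨hx1, w, rfl⟩ := mem_grFilt_neg_two.1 hx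
      obtain ⟨hx2, -⟩ := mem_grFilt_neg_two.1 (mem_conjSub.1 hx')
      rw [show (-2 : ℤ) - 1 = -3 by norm_num, wt_le_neg_three N le_rfl, Submodule.mem_bot]
      obtain ⟨a, ha, ha'⟩ := h.strict (p := p + 1) (w := w) (by simpa using hx1)
      obtain ⟨c, hc, hc'⟩ := h.strict (p := -p) (w := conjVec w) (by
        rw [conjVec_toC_mulVec] at hx2
        rwa [show (-2 : ℤ) + 1 - p = -p - 1 by ring] at hx2)
      rw [← ha']
      apply h.gr_zero_inf ha (c := c)
      · rwa [show 1 - (p + 1) = -p by ring]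
      · rw [ha', ← conjVec_toC_mulVec, hc', conjVec_toC_mulVec, conjVec_conjVec]
    · rw [grFilt_le_neg_three N F hk]; exact inf_le_left.trans bot_le
  · intro p
    rw [mapSub_le]
    intro x hx
    obtain ⟨a, ha, hxa⟩ := mem_grFilt_zero.1 hx
    rw [mulVec_sub, sub_eq_zero] at hxa
    exact mem_grFilt_neg_two.2 ⟨hxa ▸ h.hor p a ha, x, rfl⟩
  · intro p x hx y hy
    obtain ⟨a, ha, hxa⟩ := mem_grFilt_zero.1 hx
    obtain ⟨b, hb, hyb⟩ := mem_grFilt_zero.1 hy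
    rw [mulVec_sub, sub_eq_zero] at hxa hyb
    rw [hyb, ← neg_eq_zero, ← mem_LieG_iff.1 h.lie, hxa, mem_LieG_iff.1 h.lie, neg_eq_zero]
    exact h.form_eq_zero (by omega) ha (h.hor _ b hb)
  · rintro p v ⟨hv, hv'⟩ hvN
    obtain ⟨a, ha, hxa⟩ := mem_grFilt_zero.1 hv
    obtain ⟨c, hc, hvc⟩ := mem_grFilt_zero.1 (mem_conjSub.1 hv')
    rw [mem_wt_neg_one] at hvN
    rw [mulVec_sub, sub_eq_zero] at hxa hvc
    have h1 : form Q v (toC N *ᵥ conjVec v) = form Q a (toC N *ᵥ conjVec a) := by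
      rw [← conjVec_toC_mulVec, hxa, conjVec_toC_mulVec, ← neg_inj, ← mem_LieG_iff.1 h.lie,
        ← mem_LieG_iff.1 h.lie, hxa]
    rw [h1]
    apply h.pos_of_orth ha _ (hxa ▸ hvN)
    intro y hy
    rw [← neg_eq_zero, ← mem_LieG_iff.1 h.lie, ← hxa, ← conjVec_conjVec v, ← conjVec_toC_mulVec,
      hvc, form_conjVec_eq_zero]
    exact h.form_eq_zero (by omega) (h.hor _ c hc) hy
  · intro p x hx y hy
    obtain ⟨a, ha, ha', w, rfl⟩ := mem_grFilt_neg_one.1 hx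
    obtain ⟨b, hb, hb', w', rfl⟩ := mem_grFilt_neg_one.1 hy
    rw [form_add_left, form_add_right, form_add_right, h.form_N_ker _ hb', h.form_ker_N _ ha',
      h.form_N_ker _ (toC_mulVec_mulVec_eq_zero h.sq _), h.form_eq_zero (by omega) ha hb]
    simp
  · rintro p v ⟨hv, hv'⟩ hvN
    obtain ⟨a, ha, ha', w, hw⟩ := mem_grFilt_neg_one.1 hv
    obtain ⟨c, hc, hc', w', hw'⟩ := mem_grFilt_neg_one.1 (mem_conjSub.1 hv')
    rw [mem_wt_neg_two] at hvN
    push Not at hvN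
    refine h.pos_gr_one ha ha' hc hw (w' := conjVec w') ?_ hvN
    rw [← conjVec_toC_mulVec, ← conjVec_add, ← hw', conjVec_conjVec]

end OrbitPositivity

theorem CompactDual.dualFilt {Q : Matrix ι ι ℤ} (hQ : Qᵀ = -Q) (hQ' : Q.det ≠ 0) {h : ℤ →₀ ℕ}
    {F : Filt ι} (hF : F ∈ CompactDual Q h) : DualFilt Q F := by
  refine ⟨hQ, hQ', hF.1, hF.2.2, ?_⟩
  obtain ⟨m, hm⟩ := h.support.bddAbove
  refine ⟨m + 1, ?_⟩
  rw [← Submodule.finrank_eq_zero (R := ℂ), hF.2.1, Finset.sum_eq_zero]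
  intro r hr
  rw [Finset.mem_filter] at hr
  have := hm hr.1
  omega

theorem exp_smul_toC {N : Matrix ι ι ℝ} (hN : N * N = 0) (z : ℂ) :
    NormedSpace.exp (z • toC N) = 1 + z • toC N := by
  apply exp_eq_one_add
  rw [smul_mul_smul_comm, ← toC_mul, hN, toC_zero, smul_zero]

theorem one_add_smul_mulVec (N : Matrix ι ι ℂ) (z : ℂ) (x : ι → ℂ) :
    (1 + z • N) *ᵥ x = x + z • (N *ᵥ x) := by
  rw [add_mulVec, one_mulVec, smul_mulVec]

/-- The positivity of the Hodge structures `exp(iyN)F` for large `y` passes to `F` and `N`. -/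
theorem OrbitPositivity.of_orbit {Q : Matrix ι ι ℤ} (hQ : Qᵀ = -Q) (hQ' : Q.det ≠ 0)
    {h : ℤ →₀ ℕ} {N : Matrix ι ι ℝ} {F : Filt ι} (hF : F ∈ CompactDual Q h) (hN : N ∈ LieG Q)
    (hN2 : N * N = 0) (hor : ∀ p, mapSub (toC N) (F p) ≤ F (p - 1))
    (hD : ∃ y₀ : ℝ, ∀ z : ℂ, y₀ < z.im →
      act (NormedSpace.exp (z • toC N)) F ∈ PeriodDomain Q h) : OrbitPositivity Q N F := by
  obtain ⟨y₀, hy₀⟩ := hD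
  have hd : DualFilt Q F := CompactDual.dualFilt hQ hQ' hF
  refine ⟨⟨hd, hN, hN2⟩, fun p => mapSub_le.1 (hor p), ?_, ?_⟩
  · intro p v hv hNv ho hne
    have h1 := hy₀ ((y₀ + 1 : ℝ) * I) (by simp)
    rw [exp_smul_toC hN2] at h1
    have h2 := hd.mem_of_conj ho
    refine h1.2.2 p v ⟨mem_mapSub.2 ⟨v, hv, ?_⟩, mem_mapSub.2 ⟨conjVec v, ?_, ?_⟩⟩ hne
    · rw [one_add_smul_mulVec, hNv, smul_zero, add_zero]
    · rwa [show -p - 1 = -(p + 1) by ring]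
    · rw [one_add_smul_mulVec, ker_conj hNv, smul_zero, add_zero]
  · intro p x hx ho ho'
    -- `exp(iyN)x` is a Hodge vector of index `p` of `exp(iyN)F` for all large `y`, and its
    -- polarization is `A + 2yB`, so that `B` cannot be negative
    have h2 := hd.mem_of_conj ho
    have h3 : toC N *ᵥ conjVec x ∈ F (-(p + 1)) := by
      rw [← conjVec_toC_mulVec]
      apply hd.mem_of_conj
      intro y hy
      rw [mem_LieG_iff.1 hN, ho' y hy, neg_zero]
    have hNN : form Q (toC N *ᵥ x) (toC N *ᵥ conjVec x) = 0 := by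
      rw [mem_LieG_iff.1 hN, toC_mulVec_mulVec_eq_zero hN2, form_zero_right, neg_zero]
    set A := (I ^ (2 * p + 1) * form Q x (conjVec x)).re with hA
    set B := (I ^ (2 * p) * form Q x (toC N *ᵥ conjVec x)).re with hB
    have key : ∀ y : ℝ, y₀ < y → 0 ≤ A + 2 * y * B := by
      intro y hy
      have h1 := hy₀ (y * I) (by simpa using hy)
      rw [exp_smul_toC hN2] at h1
      set v := x + (y * I : ℂ) • (toC N *ᵥ x) with hv
      have hvc : conjVec v = conjVec x - (y * I : ℂ) • (toC N *ᵥ conjVec x) := by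
        rw [hv, conjVec_add, conjVec_smul, conjVec_toC_mulVec, map_mul, conj_ofReal, conj_I,
          mul_neg, neg_smul, sub_eq_add_neg]
      have hform : I ^ (2 * p + 1) * form Q v (conjVec v) =
          I ^ (2 * p + 1) * form Q x (conjVec x) +
            (2 * y : ℝ) * (I ^ (2 * p) * form Q x (toC N *ᵥ conjVec x)) := by
        rw [hvc, hv]
        simp only [form_add_left, form_sub_right, form_smul_left, form_smul_right, hNN,
          mem_LieG_iff.1 hN x (conjVec x), zpow_I_two_mul_add_one]
        push_cast
        linear_combination (-2 * y * I ^ (2 * p) * form Q x (toC N *ᵥ conjVec x)) * I_sq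
      have hre : (I ^ (2 * p + 1) * form Q v (conjVec v)).re = A + 2 * y * B := by
        rw [hform, add_re, re_ofReal_mul]
      rw [← hre]
      by_cases hv0 : v = 0
      · rw [hv0, form_zero_left, mul_zero, zero_re]
      refine (h1.2.2 p v ⟨mem_mapSub.2 ⟨x, hx, one_add_smul_mulVec _ _ _⟩,
        mem_mapSub.2 ⟨conjVec x - (2 * y * I : ℂ) • (toC N *ᵥ conjVec x), ?_, ?_⟩⟩ hv0).le
      · rw [show -p - 1 = -(p + 1) by ring]
        exact Submodule.sub_mem _ h2 (Submodule.smul_mem _ _ h3)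
      · rw [one_add_smul_mulVec, mulVec_sub, mulVec_smul, toC_mulVec_mulVec_eq_zero hN2, hvc]
        module
    by_contra hneg
    push Not at hneg
    have h4 := key (max (y₀ + 1) ((A + 1) / (-2 * B))) (lt_of_lt_of_le (by linarith)
      (le_max_left _ _))
    have h5 : A + 1 ≤ max (y₀ + 1) ((A + 1) / (-2 * B)) * (-2 * B) := by
      rw [← div_le_iff₀ (by linarith)]
      exact le_max_right _ _
    linarith

/-! ### Orthogonality and positivity of sums of subspaces -/

/-- Sums of mutually orthogonal subspaces are orthogonal. -/
theorem form_eq_zero_of_mem_iSup {Q : Matrix ι ι ℤ} {κ κ' : Sort*}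
    {f : κ → Submodule ℂ (ι → ℂ)} {g : κ' → Submodule ℂ (ι → ℂ)}
    (h : ∀ i j, ∀ x ∈ f i, ∀ y ∈ g j, form Q x y = 0) {x y : ι → ℂ} (hx : x ∈ ⨆ i, f i)
    (hy : y ∈ ⨆ j, g j) : form Q x y = 0 := by
  refine Submodule.iSup_induction f (motive := fun x => form Q x y = 0) hx ?_
    (form_zero_left _ _) (fun a b ha hb => by rw [form_add_left, ha, hb, add_zero])
  intro i x hx
  refine Submodule.iSup_induction g (motive := fun y => form Q x y = 0) hy
    (fun j y hy => h i j x hx y hy)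
    (form_zero_right _ _) (fun a b ha hb => by rw [form_add_right, ha, hb, add_zero])

/-- A Hermitian form `c⟨x, M conj y⟩` that is positive definite on each of a family of mutually
orthogonal subspaces is positive definite on their sum. -/
theorem pos_of_mem_iSup {Q : Matrix ι ι ℤ} (M : Matrix ι ι ℝ) (c : ℂ) {κ : Type*}
    {G : κ → Submodule ℂ (ι → ℂ)}
    (ho : ∀ p q, p ≠ q → ∀ x ∈ G p, ∀ y ∈ G q, form Q x (toC M *ᵥ conjVec y) = 0)
    (hpos : ∀ p, ∀ x ∈ G p, x ≠ 0 → 0 < (c * form Q x (toC M *ᵥ conjVec x)).re)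
    {x : ι → ℂ} (hx : x ∈ ⨆ p, G p) (hx0 : x ≠ 0) :
    0 < (c * form Q x (toC M *ᵥ conjVec x)).re := by
  classical
  obtain ⟨f, hf, rfl⟩ := (Submodule.mem_iSup_iff_exists_finsupp G x).1 hx
  have hform : ∀ s : Finset κ, form Q (∑ p ∈ s, f p) (toC M *ᵥ conjVec (∑ p ∈ s, f p)) =
      ∑ p ∈ s, form Q (f p) (toC M *ᵥ conjVec (f p)) := by
    intro s
    induction s using Finset.induction_on with
    | empty => simp [form_zero_left]
    | insert a s ha ih =>
      have h1 : ∀ y ∈ (⨆ p : {p // p ≠ a}, G p), form Q (f a) (toC M *ᵥ conjVec y) = 0 ∧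
          form Q y (toC M *ᵥ conjVec (f a)) = 0 := by
        intro y hy
        refine Submodule.iSup_induction (fun p : {p // p ≠ a} => G p)
          (motive := fun y => form Q (f a) (toC M *ᵥ conjVec y) = 0 ∧
            form Q y (toC M *ᵥ conjVec (f a)) = 0) hy ?_ ?_ ?_
        · intro p y hy
          exact ⟨ho _ _ p.2.symm _ (hf a) _ hy, ho _ _ p.2 _ hy _ (hf a)⟩
        · simp [form_zero_left, form_zero_right]
        · intro y z hy hz
          simp [mulVec_add, form_add_left, form_add_right, hy, hz]
      have h2 : ∑ p ∈ s, f p ∈ (⨆ p : {p // p ≠ a}, G p) := by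
        refine Submodule.sum_mem _ fun p hp => ?_
        exact Submodule.mem_iSup_of_mem (⟨p, fun h => ha (h ▸ hp)⟩ : {p // p ≠ a}) (hf p)
      rw [Finset.sum_insert ha, Finset.sum_insert ha, conjVec_add, mulVec_add, form_add_left,
        form_add_right, form_add_right, (h1 _ h2).1, (h1 _ h2).2, ih]
      ring
  rw [Finsupp.sum, hform, Finset.mul_sum, re_sum]
  apply Finset.sum_pos
  · intro p hp
    exact hpos p _ (hf p) (Finsupp.mem_support_iff.1 hp)
  · rw [Finset.nonempty_iff_ne_empty]
    intro h0
    exact hx0 (by rw [Finsupp.sum, h0, Finset.sum_empty])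

/-! ### Deligne components of a mixed Hodge structure with weights `0, -1, -2` -/

theorem mem_deligne_neg_one {N : Matrix ι ι ℝ} {F : Filt ι} {p q : ℤ} (hpq : p + q = -1)
    {x : ι → ℂ} : x ∈ deligne N F p q ↔ x ∈ F p ∧ conjVec x ∈ F q ∧ toC N *ᵥ x = 0 := by
  have h1 : (⨆ (j : ℤ) (_ : 2 ≤ j), conjSub (F (q - j + 1)) ⊓ wt N (p + q - j)) = ⊥ := by
    rw [eq_bot_iff]
    refine iSup₂_le fun j hj => ?_
    rw [wt_le_neg_three N (by omega), inf_bot_eq]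
  rw [deligne, h1, sup_bot_eq, hpq]
  simp only [Submodule.mem_inf, mem_conjSub, mem_wt_neg_one]
  tauto

theorem mem_deligne_neg_two {N : Matrix ι ι ℝ} {F : Filt ι} {p q : ℤ} (hpq : p + q = -2)
    {x : ι → ℂ} : x ∈ deligne N F p q ↔ x ∈ F p ∧ conjVec x ∈ F q ∧ ∃ w, toC N *ᵥ w = x := by
  have h1 : (⨆ (j : ℤ) (_ : 2 ≤ j), conjSub (F (q - j + 1)) ⊓ wt N (p + q - j)) = ⊥ := by
    rw [eq_bot_iff]
    refine iSup₂_le fun j hj => ?_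
    rw [wt_le_neg_three N (by omega), inf_bot_eq]
  rw [deligne, h1, sup_bot_eq, hpq]
  simp only [Submodule.mem_inf, mem_conjSub, mem_wt_neg_two]
  tauto

/-- For weight `0` only the summand `j = 2` of the correction term in the definition of `I^{p,q}`
remains, because `W_{-3} = 0`. -/
theorem mem_deligne_zero {N : Matrix ι ι ℝ} {F : Filt ι} {p q : ℤ} (hpq : p + q = 0)
    {x : ι → ℂ} : x ∈ deligne N F p q ↔ x ∈ F p ∧ ∃ c ∈ F q, ∃ w, toC N *ᵥ w ∈ F (q - 1) ∧
      x = conjVec (c + toC N *ᵥ w) := by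
  have h1 : (⨆ (j : ℤ) (_ : 2 ≤ j), conjSub (F (q - j + 1)) ⊓ wt N (p + q - j)) =
      conjSub (F (q - 1)) ⊓ wt N (-2) := by
    apply le_antisymm
    · refine iSup₂_le fun j hj => ?_
      rcases hj.eq_or_lt with rfl | hj
      · rw [hpq, show q - 2 + 1 = q - 1 by ring, zero_sub]
      · rw [wt_le_neg_three N (by omega), inf_bot_eq]; exact bot_le
    · refine le_trans (le_of_eq ?_) (le_iSup₂_of_le 2 le_rfl le_rfl)
      rw [hpq, show q - 2 + 1 = q - 1 by ring, zero_sub]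
  rw [deligne, h1, hpq, wt_nonneg N le_rfl, inf_top_eq, inf_top_eq, Submodule.mem_inf,
    Submodule.mem_sup]
  refine and_congr_right fun _ => ?_
  constructor
  · rintro ⟨c, hc, r, ⟨hr, hr'⟩, rfl⟩
    obtain ⟨w, rfl⟩ := mem_wt_neg_two.1 hr'
    refine ⟨conjVec c, hc, conjVec w, ?_, by simp⟩
    rw [← conjVec_toC_mulVec]; exact hr
  · rintro ⟨c, hc, w, hw, rfl⟩
    refine ⟨conjVec c, by simpa using hc, conjVec (toC N *ᵥ w), ⟨by simpa using hw, ?_⟩, by simp⟩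
    exact mem_wt_neg_two.2 ⟨conjVec w, by simp⟩

theorem deligne_le_wt (N : Matrix ι ι ℝ) (F : Filt ι) (p q : ℤ) :
    deligne N F p q ≤ wt N (p + q) := inf_le_left.trans inf_le_right

theorem deligne_le (N : Matrix ι ι ℝ) (F : Filt ι) (p q : ℤ) :
    deligne N F p q ≤ F p := inf_le_left.trans inf_le_left

theorem deligne_eq_bot_of_le {N : Matrix ι ι ℝ} {F : Filt ι} {p q : ℤ} (hpq : p + q ≤ -3) :
    deligne N F p q = ⊥ :=
  eq_bot_iff.2 ((deligne_le_wt N F p q).trans (wt_le_neg_three N hpq).le)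

/-- The sum of the Deligne components of weight `0`. -/
def deligneZero (N : Matrix ι ι ℝ) (F : Filt ι) : Submodule ℂ (ι → ℂ) :=
  ⨆ p : ℤ, deligne N F p (-p)

/-- The sum of the Deligne components of weight `-1`. -/
def deligneOne (N : Matrix ι ι ℝ) (F : Filt ι) : Submodule ℂ (ι → ℂ) :=
  ⨆ p : ℤ, deligne N F p (-p - 1)

/-- A limiting mixed Hodge structure `(W(N), F)` with `F` in the compact dual and `N² = 0`. -/
structure MixedHodge (Q : Matrix ι ι ℤ) (N : Matrix ι ι ℝ) (F : Filt ι) : Prop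
    extends MonodromyFilt Q N F where
  lmhs : IsLMHS Q N F

/-- Descending induction along `F`, which ends because `F^r = 0` for large `r`. -/
theorem DualFilt.le_of_step {Q : Matrix ι ι ℤ} {F : Filt ι} (h : DualFilt Q F) {p : ℤ}
    {S : Submodule ℂ (ι → ℂ)} (hS : ∀ r, p ≤ r → F r ≤ S ⊔ F (r + 1)) : F p ≤ S := by
  obtain ⟨m, hm⟩ := h.bot
  have key : ∀ n : ℕ, F p ≤ S ⊔ F (p + n) := by
    intro n
    induction n with
    | zero => simp
    | succ n ih =>
      refine ih.trans (sup_le le_sup_left ((hS _ (by omega)).trans ?_))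
      rw [Nat.cast_succ, add_assoc]
  have h1 : F (p + (m - p).toNat) ≤ F m := h.anti (by omega)
  have h2 := key (m - p).toNat
  rw [hm] at h1
  rwa [le_bot_iff.1 h1, sup_bot_eq] at h2

theorem DualFilt.exists_eq_top {Q : Matrix ι ι ℤ} {F : Filt ι} (h : DualFilt Q F) :
    ∃ m, F m = ⊤ := by
  obtain ⟨m, hm⟩ := h.bot
  refine ⟨-m, eq_top_iff.2 fun x _ => ?_⟩
  rw [h.orth, neg_neg, hm]
  intro y hy
  rw [(Submodule.mem_bot ℂ).1 hy, form_zero_right]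

namespace MixedHodge

variable {Q : Matrix ι ι ℤ} {N : Matrix ι ι ℝ} {F : Filt ι}

theorem hor (h : MixedHodge Q N F) {p : ℤ} {x : ι → ℂ} (hx : x ∈ F p) :
    toC N *ᵥ x ∈ F (p - 1) :=
  (mem_grFilt_neg_two.1 (mapSub_le.1 (h.lmhs.morphism p) x
    (mem_grFilt_zero.2 ⟨x, hx, by simp⟩))).1

theorem gr_zero_sup (h : MixedHodge Q N F) (p : ℤ) (w : ι → ℂ) :
    ∃ a ∈ F p, ∃ c ∈ F (1 - p), toC N *ᵥ w = toC N *ᵥ a + toC N *ᵥ conjVec c := by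
  have h1 : w ∈ grFilt N F 0 p ⊔ conjSub (grFilt N F 0 (0 + 1 - p)) := by
    rw [h.lmhs.pure_sup, wt_nonneg N le_rfl]; trivial
  obtain ⟨x, hx, y, hy, rfl⟩ := Submodule.mem_sup.1 h1
  obtain ⟨a, ha, hxa⟩ := mem_grFilt_zero.1 hx
  obtain ⟨c, hc, hyc⟩ := mem_grFilt_zero.1 (mem_conjSub.1 hy)
  refine ⟨a, ha, c, by rwa [zero_add] at hc, ?_⟩
  rw [mulVec_sub, sub_eq_zero] at hxa hyc
  rw [mulVec_add, hxa, ← conjVec_toC_mulVec, ← hyc, conjVec_toC_mulVec, conjVec_conjVec]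

theorem gr_zero_inf (h : MixedHodge Q N F) {p : ℤ} {a c : ι → ℂ} (ha : a ∈ F p)
    (hc : c ∈ F (1 - p)) (hac : toC N *ᵥ a = toC N *ᵥ conjVec c) : toC N *ᵥ a = 0 := by
  have h1 : a ∈ grFilt N F 0 p ⊓ conjSub (grFilt N F 0 (0 + 1 - p)) := by
    refine ⟨mem_grFilt_zero.2 ⟨a, ha, by simp⟩, mem_grFilt_zero.2 ⟨c, by rwa [zero_add], ?_⟩⟩
    rw [mulVec_sub, ← conjVec_toC_mulVec, hac, conjVec_toC_mulVec, conjVec_conjVec, sub_self]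
  rw [h.lmhs.pure_inf] at h1
  exact mem_wt_neg_one.1 h1

theorem gr_one_sup (h : MixedHodge Q N F) (p : ℤ) {x : ι → ℂ} (hx : toC N *ᵥ x = 0) :
    ∃ u ∈ F p, toC N *ᵥ u = 0 ∧ ∃ t ∈ F (-p), toC N *ᵥ t = 0 ∧
      ∃ w, x = u + conjVec t + toC N *ᵥ w := by
  have h1 : x ∈ grFilt N F (-1) p ⊔ conjSub (grFilt N F (-1) (-1 + 1 - p)) := by
    rw [h.lmhs.pure_sup]; exact mem_wt_neg_one.2 hx
  obtain ⟨y, hy, z, hz, rfl⟩ := Submodule.mem_sup.1 h1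
  obtain ⟨u, hu, hu', w, rfl⟩ := mem_grFilt_neg_one.1 hy
  obtain ⟨t, ht, ht', w', hw'⟩ := mem_grFilt_neg_one.1 (mem_conjSub.1 hz)
  refine ⟨u, hu, hu', t, by rwa [show (-1 : ℤ) + 1 - p = -p by ring] at ht, ht',
    w + conjVec w', ?_⟩
  rw [mulVec_add, ← conjVec_toC_mulVec N w', ← conjVec_conjVec z, hw', conjVec_add]
  abel

theorem gr_one_inf (h : MixedHodge Q N F) {p : ℤ} {u t w : ι → ℂ} (hu : u ∈ F p)
    (hu' : toC N *ᵥ u = 0) (ht : t ∈ F (-p)) (hut : u = conjVec t + toC N *ᵥ w) :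
    ∃ w', toC N *ᵥ w' = u := by
  have h1 : u ∈ grFilt N F (-1) p ⊓ conjSub (grFilt N F (-1) (-1 + 1 - p)) := by
    refine ⟨mem_grFilt_neg_one.2 ⟨u, hu, hu', 0, by simp⟩, mem_grFilt_neg_one.2 ⟨t, ?_, ?_,
      conjVec w, ?_⟩⟩
    · rwa [show (-1 : ℤ) + 1 - p = -p by ring]
    · rw [hut, mulVec_add, toC_mulVec_mulVec_eq_zero h.sq, add_zero] at hu'
      simpa using ker_conj hu'
    · rw [hut]; simp
  rw [h.lmhs.pure_inf] at h1
  exact mem_wt_neg_two.1 h1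

theorem gr_two_sup (h : MixedHodge Q N F) (p : ℤ) (w : ι → ℂ) :
    ∃ a b, toC N *ᵥ a ∈ F p ∧ toC N *ᵥ b ∈ F (-p - 1) ∧
      toC N *ᵥ w = toC N *ᵥ a + conjVec (toC N *ᵥ b) := by
  obtain ⟨a, ha, c, hc, hac⟩ := h.gr_zero_sup (p + 1) w
  refine ⟨a, c, by simpa using h.hor ha, ?_, by rw [hac, conjVec_toC_mulVec]⟩
  have := h.hor hc
  rwa [show 1 - (p + 1) - 1 = -p - 1 by ring] at this

theorem gr_two_inf (h : MixedHodge Q N F) {p q : ℤ} (hpq : -1 ≤ p + q) {x w : ι → ℂ}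
    (hx : x ∈ F p) (hx' : conjVec x ∈ F q) (hw : toC N *ᵥ w = x) : x = 0 := by
  have h1 : x ∈ grFilt N F (-2) p ⊓ conjSub (grFilt N F (-2) (-2 + 1 - p)) :=
    ⟨mem_grFilt_neg_two.2 ⟨hx, w, hw⟩, mem_grFilt_neg_two.2
      ⟨h.anti (by omega) hx', conjVec w, by rw [← conjVec_toC_mulVec, hw]⟩⟩
  rw [h.lmhs.pure_inf, wt_le_neg_three N (by norm_num)] at h1
  exact (Submodule.mem_bot ℂ).1 h1

/-- The class of a vector of `I^{p,-p}` in `Gr_0` determines it. -/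
theorem deligne_zero_ker (h : MixedHodge Q N F) {p q : ℤ} (hpq : p + q = 0) {x : ι → ℂ}
    (hx : x ∈ deligne N F p q) (hk : toC N *ᵥ x = 0) : x = 0 := by
  obtain ⟨hxp, c, hc, w, hw, hxc⟩ := (mem_deligne_zero hpq).1 hx
  obtain rfl : q = -p := by omega
  have h1 : toC N *ᵥ c = 0 := by
    have := ker_conj hk
    rwa [hxc, conjVec_conjVec, mulVec_add, toC_mulVec_mulVec_eq_zero h.sq, add_zero] at this
  obtain ⟨w', hw'⟩ := h.gr_one_inf hxp hk hc (w := conjVec w) (by rw [hxc]; simp)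
  refine h.gr_two_inf (q := -p - 1) (by omega) hxp ?_ hw'
  rw [hxc, conjVec_conjVec]
  exact Submodule.add_mem _ (h.anti (by omega) hc) hw

/-- The components `I^{p,q}` with `p + q > 0` vanish, although `W_{p+q}` is the whole space. -/
theorem deligne_eq_bot_of_pos (h : MixedHodge Q N F) {p q : ℤ} (hpq : 1 ≤ p + q) :
    deligne N F p q = ⊥ := by
  rw [eq_bot_iff]
  rintro x ⟨⟨hxp, -⟩, hx⟩
  have hle : conjSub (F q) ⊓ wt N (p + q) ⊔
      (⨆ (j : ℤ) (_ : 2 ≤ j), conjSub (F (q - j + 1)) ⊓ wt N (p + q - j)) ≤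
      conjSub (F (1 - p)) ⊔ (conjSub (F (-p)) ⊓ wt N (-1) ⊔ conjSub (F (-p - 1)) ⊓ wt N (-2)) := by
    refine sup_le (inf_le_left.trans ((conjSub_mono (h.anti (by omega))).trans le_sup_left))
      (iSup₂_le fun j hj => ?_)
    rcases lt_or_ge (p + q - j) (-2) with h1 | h1
    · rw [wt_le_neg_three N (by omega), inf_bot_eq]; exact bot_le
    obtain h2 | h2 | h2 : p + q - j = -2 ∨ p + q - j = -1 ∨ 0 ≤ p + q - j := by omega
    · rw [h2, show q - j + 1 = -p - 1 by omega]
      exact le_sup_right.trans le_sup_right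
    · rw [h2, show q - j + 1 = -p by omega]
      exact le_sup_left.trans le_sup_right
    · exact inf_le_left.trans ((conjSub_mono (h.anti (by omega))).trans le_sup_left)
  obtain ⟨f, hf, y, hy, hxy⟩ := Submodule.mem_sup.1 (hle hx)
  obtain ⟨k, ⟨hk, hk'⟩, r, ⟨hr, hr'⟩, rfl⟩ := Submodule.mem_sup.1 hy
  have hk' := mem_wt_neg_one.1 hk'
  obtain ⟨w, rfl⟩ := mem_wt_neg_two.1 hr'
  have hf := mem_conjSub.1 hf
  have hk := mem_conjSub.1 hk
  have hr := mem_conjSub.1 hr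
  have hxk : toC N *ᵥ x = 0 := by
    apply h.gr_zero_inf hxp hf
    rw [conjVec_conjVec, ← hxy, mulVec_add, mulVec_add, hk', toC_mulVec_mulVec_eq_zero h.sq]
    simp
  obtain ⟨w', hw'⟩ := h.gr_one_inf hxp hxk (t := conjVec (f + k)) (w := w) (by
    rw [conjVec_add]
    exact Submodule.add_mem _ (h.anti (by omega) hf) hk) (by
    rw [conjVec_conjVec, ← hxy]; abel)
  refine (Submodule.mem_bot ℂ).2 (h.gr_two_inf (q := -p - 1) (by omega) hxp ?_ hw')
  rw [← hxy, conjVec_add, conjVec_add]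
  exact Submodule.add_mem _ (h.anti (by omega) hf)
    (Submodule.add_mem _ (h.anti (by omega) hk) hr)

/-- A vector whose class in `H / Ker N` has type `(p, -p)` lifts to `I^{p,-p}`. -/
theorem exists_mem_deligne_zero (h : MixedHodge Q N F) {p : ℤ} {a c k : ι → ℂ} (ha : a ∈ F p)
    (hc : c ∈ F (-p)) (hk : toC N *ᵥ k = 0) (hack : a = conjVec c + k) :
    ∃ x ∈ deligne N F p (-p), ∃ u ∈ F p, toC N *ᵥ u = 0 ∧ a = x + u := by
  obtain ⟨u, hu, hu', t, ht, ht', w, hw⟩ := h.gr_one_sup p hk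
  obtain ⟨b, d, hb, hd, hbd⟩ := h.gr_two_sup p w
  have hub : u + toC N *ᵥ b ∈ F p := Submodule.add_mem _ hu hb
  refine ⟨a - (u + toC N *ᵥ b), (mem_deligne_zero (by omega)).2 ⟨Submodule.sub_mem _ ha hub, c + t,
    Submodule.add_mem _ hc ht, d, hd, ?_⟩, u + toC N *ᵥ b, hub, ?_, by abel⟩
  · rw [hack, hw, hbd, conjVec_add, conjVec_add]; abel
  · rw [mulVec_add, hu', toC_mulVec_mulVec_eq_zero h.sq, add_zero]

theorem exists_mem_deligne_zero_of_grFilt (h : MixedHodge Q N F) {p : ℤ} {v : ι → ℂ}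
    (hv : v ∈ grFilt N F 0 p ⊓ conjSub (grFilt N F 0 (-p))) :
    ∃ x ∈ deligne N F p (-p), toC N *ᵥ v = toC N *ᵥ x := by
  obtain ⟨a, ha, hva⟩ := mem_grFilt_zero.1 hv.1
  obtain ⟨c, hc, hvc⟩ := mem_grFilt_zero.1 (mem_conjSub.1 hv.2)
  rw [mulVec_sub, sub_eq_zero] at hva hvc
  obtain ⟨x, hx, u, -, hu', rfl⟩ := h.exists_mem_deligne_zero ha hc (k := a - conjVec c) (by
    rw [mulVec_sub, ← hva, ← conjVec_toC_mulVec, ← hvc, ← conjVec_toC_mulVec, conjVec_conjVec,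
      sub_self]) (by abel)
  exact ⟨x, hx, by rw [hva, mulVec_add, hu', add_zero]⟩

theorem deligne_zero_le_grFilt (h : MixedHodge Q N F) (p : ℤ) :
    deligne N F p (-p) ≤ grFilt N F 0 p ⊓ conjSub (grFilt N F 0 (-p)) := by
  intro x hx
  obtain ⟨hxp, c, hc, w, hw, hxc⟩ := (mem_deligne_zero (by omega)).1 hx
  refine ⟨mem_grFilt_zero.2 ⟨x, hxp, by simp⟩, mem_grFilt_zero.2 ⟨c, hc, ?_⟩⟩
  rw [hxc, conjVec_conjVec, add_sub_cancel_left, toC_mulVec_mulVec_eq_zero h.sq]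

/-- The Deligne components split the Hodge filtration: `F^p` is the sum of the `I^{p,q}` and of
`F^{p+1}`. -/
theorem le_deligne_sup (h : MixedHodge Q N F) (p : ℤ) :
    F p ≤ deligne N F p (-p) ⊔ deligne N F p (-p - 1) ⊔ deligne N F p (-p - 2) ⊔ F (p + 1) := by
  intro v hv
  -- `v` is split off in three steps, on `Gr_0`, `Gr_{-1}` and `Gr_{-2}`, into its part of index `p`
  -- and a vector of `F^{p+1}`
  obtain ⟨a, ha, c, hc, hac⟩ := h.gr_zero_sup (p + 1) v
  obtain ⟨x, hx, k, hk, hk', hxk⟩ := h.exists_mem_deligne_zero (a := v - a) (c := c)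
    (k := v - a - conjVec c) (Submodule.sub_mem _ hv (h.anti (by omega) ha))
    (by rwa [show 1 - (p + 1) = -p by ring] at hc) (by
      rw [mulVec_sub, mulVec_sub, hac]; abel) (by abel)
  obtain ⟨u, hu, hu', t, ht, ht', w, hw⟩ := h.gr_one_sup (p + 1) hk'
  obtain ⟨b, d, hb, hd, hbd⟩ := h.gr_two_sup p w
  have hB : k - u - toC N *ᵥ b ∈ deligne N F p (-p - 1) := by
    rw [mem_deligne_neg_one (by omega)]
    refine ⟨Submodule.sub_mem _ (Submodule.sub_mem _ hk (h.anti (by omega) hu)) hb, ?_, ?_⟩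
    · have : k - u - toC N *ᵥ b = conjVec (t + toC N *ᵥ d) := by
        rw [hw, hbd, conjVec_add]; abel
      rw [this, conjVec_conjVec]
      refine Submodule.add_mem _ ?_ hd
      rwa [show -(p + 1) = -p - 1 by ring] at ht
    · rw [mulVec_sub, mulVec_sub, hk', hu', toC_mulVec_mulVec_eq_zero h.sq]; simp
  obtain ⟨e, f, he, hf, hef⟩ := h.gr_two_sup (p + 1) b
  have hC : toC N *ᵥ b - toC N *ᵥ e ∈ deligne N F p (-p - 2) := by
    rw [mem_deligne_neg_two (by omega)]
    refine ⟨Submodule.sub_mem _ hb (h.anti (by omega) he), ?_, b - e, mulVec_sub _ _ _⟩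
    rw [hef, add_sub_cancel_left, conjVec_conjVec]
    rwa [show -(p + 1) - 1 = -p - 2 by ring] at hf
  have : v = x + (k - u - toC N *ᵥ b) + (toC N *ᵥ b - toC N *ᵥ e) + (a + u + toC N *ᵥ e) := by
    have : v = (v - a) + a := by abel
    rw [this, hxk]; abel
  rw [this]
  exact Submodule.add_mem_sup (Submodule.add_mem_sup (Submodule.add_mem_sup hx hB) hC)
    (Submodule.add_mem _ (Submodule.add_mem _ ha hu) he)

theorem deligne_sup_eq_top (h : MixedHodge Q N F) :
    deligneZero N F ⊔ deligneOne N F ⊔ wt N (-2) = ⊤ := by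
  obtain ⟨m, hm⟩ := h.exists_eq_top
  rw [eq_top_iff, ← hm]
  apply h.le_of_step
  intro r _
  refine (h.le_deligne_sup r).trans (sup_le_sup_right (sup_le_sup (sup_le_sup ?_ ?_) ?_) _)
  · exact le_iSup (fun p => deligne N F p (-p)) r
  · exact le_iSup (fun p => deligne N F p (-p - 1)) r
  · intro x hx
    exact mem_wt_neg_two.2 ((mem_deligne_neg_two (by omega)).1 hx).2.2

theorem deligneOne_ker (N : Matrix ι ι ℝ) (F : Filt ι) {b : ι → ℂ} (hb : b ∈ deligneOne N F) :
    toC N *ᵥ b = 0 := by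
  have hle : deligneOne N F ≤ wt N (-1) :=
    iSup_le fun p x hx => mem_wt_neg_one.2 ((mem_deligne_neg_one (by omega)).1 hx).2.2
  exact mem_wt_neg_one.1 (hle hb)

/-- Every vector is `a + b + Na'` with `a, a'` of weight `0` and `b` of weight `-1`. -/
theorem exists_decomp (h : MixedHodge Q N F) (x : ι → ℂ) :
    ∃ a ∈ deligneZero N F, ∃ b ∈ deligneOne N F, ∃ a' ∈ deligneZero N F,
      x = a + b + toC N *ᵥ a' := by
  have key : ∀ x : ι → ℂ, ∃ a ∈ deligneZero N F, ∃ b ∈ deligneOne N F, ∃ w,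
      x = a + b + toC N *ᵥ w := by
    intro x
    have hx : x ∈ deligneZero N F ⊔ deligneOne N F ⊔ wt N (-2) := by
      rw [h.deligne_sup_eq_top]; trivial
    obtain ⟨y, hy, r, hr, rfl⟩ := Submodule.mem_sup.1 hx
    obtain ⟨a, ha, b, hb, rfl⟩ := Submodule.mem_sup.1 hy
    obtain ⟨w, rfl⟩ := mem_wt_neg_two.1 hr
    exact ⟨a, ha, b, hb, w, rfl⟩
  obtain ⟨a, ha, b, hb, w, rfl⟩ := key x
  obtain ⟨a', ha', b', hb', w', rfl⟩ := key w
  refine ⟨a, ha, b, hb, a', ha', ?_⟩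
  rw [mulVec_add, mulVec_add, deligneOne_ker N F hb', toC_mulVec_mulVec_eq_zero h.sq, add_zero,
    add_zero]

/-- The `I^{p,-p}` are isotropic: two of them are orthogonal as parts of `F` or as parts of `conj
F`, according to the sign of the sum of their indices. -/
theorem deligneZero_isotropic (h : MixedHodge Q N F) {x y : ι → ℂ} (hx : x ∈ deligneZero N F)
    (hy : y ∈ deligneZero N F) : form Q x y = 0 := by
  refine form_eq_zero_of_mem_iSup ?_ hx hy
  intro p q x hx y hy
  rcases le_or_gt 0 (p + q) with hpq | hpq
  · exact h.form_eq_zero hpq (deligne_le _ _ _ _ hx) (deligne_le _ _ _ _ hy)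
  obtain ⟨-, c, hc, w, hw, rfl⟩ := (mem_deligne_zero (by omega)).1 hx
  obtain ⟨-, d, hd, u, hu, rfl⟩ := (mem_deligne_zero (by omega)).1 hy
  rw [form_conjVec_eq_zero, form_add_left, form_add_right, form_add_right,
    h.form_eq_zero (by omega) hc hd, h.form_eq_zero (by omega) hc hu,
    h.form_eq_zero (by omega) hw hd, h.form_N_ker _ (toC_mulVec_mulVec_eq_zero h.sq u)]
  simp

theorem deligneZero_orth_deligneOne (h : MixedHodge Q N F) {x y : ι → ℂ}
    (hx : x ∈ deligneZero N F) (hy : y ∈ deligneOne N F) : form Q x y = 0 := by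
  refine form_eq_zero_of_mem_iSup ?_ hx hy
  intro p q x hx y hy
  obtain ⟨hyq, hyq', hyk⟩ := (mem_deligne_neg_one (by omega)).1 hy
  rcases le_or_gt 0 (p + q) with hpq | hpq
  · exact h.form_eq_zero hpq (deligne_le _ _ _ _ hx) hyq
  obtain ⟨-, c, hc, w, hw, rfl⟩ := (mem_deligne_zero (by omega)).1 hx
  rw [← conjVec_conjVec y, form_conjVec_eq_zero, form_add_left,
    h.form_eq_zero (by omega) hc hyq', h.form_N_ker _ (ker_conj hyk), add_zero]

theorem deligneZero_ker (h : MixedHodge Q N F) {x : ι → ℂ} (hx : x ∈ deligneZero N F)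
    (hk : toC N *ᵥ x = 0) : x = 0 := by
  apply form_nondeg h.nondeg
  intro y
  obtain ⟨a, ha, b, hb, a', ha', rfl⟩ := h.exists_decomp y
  rw [form_add_right, form_add_right, h.deligneZero_isotropic hx ha,
    h.deligneZero_orth_deligneOne hx hb, h.form_ker_N _ hk]
  simp

theorem deligneOne_range (h : MixedHodge Q N F) {w : ι → ℂ}
    (hx : toC N *ᵥ w ∈ deligneOne N F) : toC N *ᵥ w = 0 := by
  apply form_nondeg h.nondeg
  intro y
  obtain ⟨a, ha, b, hb, a', ha', rfl⟩ := h.exists_decomp y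
  rw [form_add_right, form_add_right, form_swap h.alt _ a, h.deligneZero_orth_deligneOne ha hx,
    h.form_N_ker _ (deligneOne_ker N F hb), h.form_N_ker _ (toC_mulVec_mulVec_eq_zero h.sq a')]
  simp

theorem decomp_eq_zero (h : MixedHodge Q N F) {a b w : ι → ℂ} (ha : a ∈ deligneZero N F)
    (hb : b ∈ deligneOne N F) (h0 : a + b + toC N *ᵥ w = 0) :
    a = 0 ∧ b = 0 ∧ toC N *ᵥ w = 0 := by
  have h1 : a = 0 := by
    apply h.deligneZero_ker ha
    have := congrArg (toC N *ᵥ ·) h0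
    simpa [mulVec_add, deligneOne_ker N F hb, toC_mulVec_mulVec_eq_zero h.sq] using this
  rw [h1, zero_add] at h0
  have h2 : toC N *ᵥ w = 0 := by
    apply h.deligneOne_range
    rw [eq_neg_of_add_eq_zero_right h0]
    exact Submodule.neg_mem _ hb
  exact ⟨h1, by simpa [h2] using h0, h2⟩

theorem pos_deligne_zero (h : MixedHodge Q N F) {p : ℤ} {x : ι → ℂ}
    (hx : x ∈ deligne N F p (-p)) (hx0 : x ≠ 0) :
    0 < (I ^ (2 * p) * form Q x (toC N *ᵥ conjVec x)).re := by
  apply h.lmhs.pos_zero p x (h.deligne_zero_le_grFilt p hx)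
  rw [mem_wt_neg_one]
  exact fun hk => hx0 (h.deligne_zero_ker (by omega) hx hk)

theorem pos_deligne_one (h : MixedHodge Q N F) {p : ℤ} {x : ι → ℂ}
    (hx : x ∈ deligne N F p (-p - 1)) (hx0 : x ≠ 0) :
    0 < (I ^ (2 * p + 1) * form Q x (conjVec x)).re := by
  obtain ⟨hxp, hxp', hk⟩ := (mem_deligne_neg_one (by omega)).1 hx
  apply h.lmhs.pos_one p x
  · exact ⟨mem_grFilt_neg_one.2 ⟨x, hxp, hk, 0, by simp⟩,
      mem_grFilt_neg_one.2 ⟨conjVec x, hxp', ker_conj hk, 0, by simp⟩⟩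
  · rw [mem_wt_neg_two]
    rintro ⟨w, rfl⟩
    exact hx0 (h.deligneOne_range (Submodule.mem_iSup_of_mem p hx))

theorem deligne_zero_N_orth (h : MixedHodge Q N F) {p q : ℤ} (hpq : p ≠ q) {x y : ι → ℂ}
    (hx : x ∈ deligne N F p (-p)) (hy : y ∈ deligne N F q (-q)) :
    form Q x (toC N *ᵥ conjVec y) = 0 := by
  have key : ∀ {p q : ℤ}, q < p → ∀ {x y : ι → ℂ}, x ∈ deligne N F p (-p) →
      y ∈ deligne N F q (-q) → form Q x (toC N *ᵥ conjVec y) = 0 := by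
    intro p q hpq x y hx hy
    obtain ⟨-, c, hc, w, hw, rfl⟩ := (mem_deligne_zero (by omega)).1 hy
    rw [conjVec_conjVec, mulVec_add, toC_mulVec_mulVec_eq_zero h.sq, add_zero]
    exact h.form_eq_zero (by omega) (deligne_le _ _ _ _ hx) (h.hor hc)
  rcases lt_or_gt_of_ne hpq with h1 | h1
  · rw [form_N_conj_swap h.alt h.lie, key h1 hy hx, map_zero]
  · exact key h1 hx hy

theorem deligne_one_conj_orth (h : MixedHodge Q N F) {p q : ℤ} (hpq : p ≠ q) {x y : ι → ℂ}
    (hx : x ∈ deligne N F p (-p - 1)) (hy : y ∈ deligne N F q (-q - 1)) :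
    form Q x (conjVec y) = 0 := by
  obtain ⟨hxp, hxp', -⟩ := (mem_deligne_neg_one (by omega)).1 hx
  obtain ⟨hyq, hyq', -⟩ := (mem_deligne_neg_one (by omega)).1 hy
  rcases lt_or_gt_of_ne hpq with h1 | h1
  · exact h.form_conj_eq_zero (p := -p - 1) (q := q) (by omega) hxp' (by simpa using hyq)
  · exact h.form_eq_zero (p := p) (q := -q - 1) (by omega) hxp hyq'

end MixedHodge

/-! ### Unipotent translates that do not change the graded pieces -/

/-- The `T ∈ 𝔤_ℂ` that kill `Ker N`, and hence map `H` to `Im N`. -/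
structure IsLowering (Q : Matrix ι ι ℤ) (N : Matrix ι ι ℝ) (T : Matrix ι ι ℂ) : Prop where
  skew : ∀ x y, form Q (T *ᵥ x) y = -form Q x (T *ᵥ y)
  ker : ∀ x, toC N *ᵥ x = 0 → T *ᵥ x = 0

theorem DualFilt.act {Q : Matrix ι ι ℤ} {F : Filt ι} (hF : DualFilt Q F) {g : Matrix ι ι ℂ}
    (hg : g ∈ GC Q) : DualFilt Q (act g F) := by
  have hd := (Matrix.isUnit_iff_isUnit_det g).1 (isUnit_of_mem_GC hF.nondeg hg)
  refine ⟨hF.alt, hF.nondeg, fun p q hpq => mapSub_mono g (hF.anti hpq), fun p x => ?_, ?_⟩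
  · have hxy : ∀ y, form Q x (g *ᵥ y) = form Q (g⁻¹ *ᵥ x) y := by
      intro y
      rw [← mem_GC_iff.1 hg (g⁻¹ *ᵥ x), mulVec_mulVec, Matrix.mul_nonsing_inv _ hd, one_mulVec]
    have h1 : x ∈ CycleBoundary.act g F p ↔ g⁻¹ *ᵥ x ∈ F p := by
      constructor
      · intro hx
        obtain ⟨v, hv, rfl⟩ := mem_mapSub.1 hx
        rwa [mulVec_mulVec, Matrix.nonsing_inv_mul _ hd, one_mulVec]
      · intro hx
        exact mem_mapSub.2 ⟨_, hx, by rw [mulVec_mulVec, Matrix.mul_nonsing_inv _ hd, one_mulVec]⟩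
    rw [h1, hF.orth]
    constructor
    · intro hy z hz
      obtain ⟨y, hy', rfl⟩ := mem_mapSub.1 hz
      rw [hxy]; exact hy y hy'
    · intro hy y hy'
      rw [← hxy]; exact hy _ (mulVec_mem_mapSub g hy')
  · obtain ⟨m, hm⟩ := hF.bot
    exact ⟨m, by rw [CycleBoundary.act, hm, mapSub, Submodule.map_bot]⟩

theorem act_mem_CompactDual {Q : Matrix ι ι ℤ} (hQ : Qᵀ = -Q) (hQ' : Q.det ≠ 0) {h : ℤ →₀ ℕ}
    {F : Filt ι} (hF : F ∈ CompactDual Q h) {g : Matrix ι ι ℂ} (hg : g ∈ GC Q) :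
    act g F ∈ CompactDual Q h := by
  have hd := (CompactDual.dualFilt hQ hQ' hF).act hg
  have hinj : Function.Injective (toLin' g) :=
    Matrix.mulVec_injective_iff_isUnit.2 (isUnit_of_mem_GC hQ' hg)
  refine ⟨hd.anti, fun p => ?_, hd.orth⟩
  rw [← hF.2.1 p]
  exact (Submodule.equivMapOfInjective _ hinj _).finrank_eq.symm

namespace IsLowering

variable {Q : Matrix ι ι ℤ} {N : Matrix ι ι ℝ} {T : Matrix ι ι ℂ} {F : Filt ι}

theorem range (hT : IsLowering Q N T) (h : MonodromyFilt Q N F) (x : ι → ℂ) :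
    ∃ w, toC N *ᵥ w = T *ᵥ x :=
  exists_mulVec_eq_of_orth_ker h.alt h.nondeg h.lie fun k hk => by
    rw [hT.skew, hT.ker k hk, form_zero_right, neg_zero]

theorem N_mul (hT : IsLowering Q N T) (h : MonodromyFilt Q N F) (x : ι → ℂ) :
    toC N *ᵥ (T *ᵥ x) = 0 := by
  obtain ⟨w, hw⟩ := hT.range h x
  rw [← hw, toC_mulVec_mulVec_eq_zero h.sq]

theorem sq (hT : IsLowering Q N T) (h : MonodromyFilt Q N F) : T * T = 0 := by
  apply Matrix.ext_of_mulVec_single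
  intro i
  rw [← mulVec_mulVec, hT.ker _ (hT.N_mul h _), zero_mulVec]

theorem one_add_mem_GC (hT : IsLowering Q N T) (h : MonodromyFilt Q N F) : 1 + T ∈ GC Q :=
  CycleBoundary.one_add_mem_GC (hT.sq h) hT.skew

theorem smul (hT : IsLowering Q N T) (c : ℂ) : IsLowering Q N (c • T) := by
  refine ⟨fun x y => ?_, fun x hx => ?_⟩
  · rw [smul_mulVec, smul_mulVec, form_smul_left, form_smul_right, hT.skew, mul_neg]
  · rw [smul_mulVec, hT.ker x hx, smul_zero]

theorem one_add_mulVec (T : Matrix ι ι ℂ) (x : ι → ℂ) : (1 + T) *ᵥ x = x + T *ᵥ x := by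
  rw [add_mulVec, one_mulVec]

/-- On `Ker N` the filtration does not change. -/
theorem mem_act_iff_of_ker (hT : IsLowering Q N T) (h : MonodromyFilt Q N F) {p : ℤ} {x : ι → ℂ}
    (hx : toC N *ᵥ x = 0) : x ∈ act (1 + T) F p ↔ x ∈ F p := by
  constructor
  · intro hx'
    obtain ⟨v, hv, rfl⟩ := mem_mapSub.1 hx'
    rw [one_add_mulVec, mulVec_add, hT.N_mul h, add_zero] at hx
    rwa [one_add_mulVec, hT.ker v hx, add_zero]
  · intro hx'
    exact mem_mapSub.2 ⟨x, hx', by rw [one_add_mulVec, hT.ker x hx, add_zero]⟩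

/-- The Hodge filtrations on the graded pieces do not change. -/
theorem grFilt_act (hT : IsLowering Q N T) (h : MonodromyFilt Q N F) :
    grFilt N (act (1 + T) F) = grFilt N F := by
  funext k p
  obtain hk | rfl | hk : 1 ≤ k ∨ k = 0 ∨ k ≤ -1 := by omega
  · rw [grFilt_pos N _ hk, grFilt_pos N _ hk]
  · ext x
    rw [mem_grFilt_zero, mem_grFilt_zero]
    constructor
    · rintro ⟨a, ha, hxa⟩
      obtain ⟨v, hv, rfl⟩ := mem_mapSub.1 ha
      refine ⟨v, hv, ?_⟩
      rwa [one_add_mulVec, mulVec_sub, mulVec_add, hT.N_mul h, add_zero, ← mulVec_sub] at hxa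
    · rintro ⟨a, ha, hxa⟩
      refine ⟨_, mulVec_mem_mapSub _ ha, ?_⟩
      rwa [one_add_mulVec, mulVec_sub, mulVec_add, hT.N_mul h, add_zero, ← mulVec_sub]
  · have hwt : wt N k ≤ wt N (-1) := by
      obtain rfl | rfl | hk : k = -1 ∨ k = -2 ∨ k ≤ -3 := by omega
      · exact le_rfl
      · exact wt_sub_one_le h.sq (-1)
      · rw [wt_le_neg_three N hk]; exact bot_le
    have : act (1 + T) F p ⊓ wt N k = F p ⊓ wt N k := by
      ext x
      simp only [Submodule.mem_inf]
      refine and_congr_left fun hx => ?_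
      exact hT.mem_act_iff_of_ker h (mem_wt_neg_one.1 (hwt hx))
    rw [grFilt, grFilt, this]

theorem mixedHodge_act (hT : IsLowering Q N T) (h : MixedHodge Q N F) :
    MixedHodge Q N (act (1 + T) F) := by
  refine ⟨⟨h.toDualFilt.act (hT.one_add_mem_GC h.toMonodromyFilt), h.lie, h.sq⟩, ?_⟩
  have hg := hT.grFilt_act h.toMonodromyFilt
  have := h.lmhs
  constructor <;> rw [hg]
  · exact this.pure_sup
  · exact this.pure_inf
  · exact this.morphism
  · exact this.orth_zero
  · exact this.pos_zero
  · exact this.orth_one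
  · exact this.pos_one

theorem deligne_act_neg_one (hT : IsLowering Q N T) (h : MonodromyFilt Q N F) {p q : ℤ}
    (hpq : p + q = -1) : deligne N (act (1 + T) F) p q = deligne N F p q := by
  ext x
  rw [mem_deligne_neg_one hpq, mem_deligne_neg_one hpq]
  constructor
  · rintro ⟨h1, h2, h3⟩
    exact ⟨(hT.mem_act_iff_of_ker h h3).1 h1, (hT.mem_act_iff_of_ker h (ker_conj h3)).1 h2, h3⟩
  · rintro ⟨h1, h2, h3⟩
    exact ⟨(hT.mem_act_iff_of_ker h h3).2 h1, (hT.mem_act_iff_of_ker h (ker_conj h3)).2 h2, h3⟩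

theorem deligne_zero_act_eq_bot (hT : IsLowering Q N T) (h : MixedHodge Q N F) {p : ℤ}
    (hp : deligne N F p (-p) = ⊥) : deligne N (act (1 + T) F) p (-p) = ⊥ := by
  have h' := hT.mixedHodge_act h
  rw [eq_bot_iff]
  intro x hx
  have h1 := h'.deligne_zero_le_grFilt p hx
  rw [hT.grFilt_act h.toMonodromyFilt] at h1
  obtain ⟨y, hy, hxy⟩ := h.exists_mem_deligne_zero_of_grFilt h1
  rw [hp, Submodule.mem_bot] at hy
  rw [hy, mulVec_zero] at hxy
  exact h'.deligne_zero_ker (by omega) hx hxy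

end IsLowering

namespace MixedHodge

variable {Q : Matrix ι ι ℤ} {N : Matrix ι ι ℝ} {F : Filt ι}

theorem N_mulVec_mem_deligne (h : MixedHodge Q N F) {p : ℤ} {x : ι → ℂ}
    (hx : x ∈ deligne N F p (-p)) : toC N *ᵥ x ∈ deligne N F (p - 1) (-p - 1) := by
  obtain ⟨hxp, c, hc, w, hw, hxc⟩ := (mem_deligne_zero (by omega)).1 hx
  refine (mem_deligne_neg_two (by omega)).2 ⟨h.hor hxp, ?_, x, rfl⟩
  rw [conjVec_toC_mulVec, hxc, conjVec_conjVec, mulVec_add, toC_mulVec_mulVec_eq_zero h.sq,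
    add_zero]
  exact h.hor hc

/-- The projection to the sum of the `I^{p,-p}` along `Ker N`. -/
theorem exists_proj (h : MixedHodge Q N F) : ∃ M : Matrix ι ι ℂ,
    (∀ x, M *ᵥ x ∈ deligneZero N F) ∧ ∀ x, toC N *ᵥ (M *ᵥ x) = toC N *ᵥ x := by
  have hc : IsCompl (deligneZero N F) (wt N (-1)) := by
    constructor
    · rw [Submodule.disjoint_def]
      exact fun x hx hx' => h.deligneZero_ker hx (mem_wt_neg_one.1 hx')
    · rw [codisjoint_iff, eq_top_iff]
      intro x _
      obtain ⟨a, ha, b, hb, a', ha', rfl⟩ := h.exists_decomp x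
      rw [add_assoc]
      refine Submodule.add_mem_sup ha (mem_wt_neg_one.2 ?_)
      rw [mulVec_add, deligneOne_ker N F hb, toC_mulVec_mulVec_eq_zero h.sq, add_zero]
  refine ⟨LinearMap.toMatrix' ((deligneZero N F).projection _ hc), fun x => ?_, fun x => ?_⟩
  · rw [← toLin'_apply, toLin'_toMatrix']
    exact Submodule.projection_apply_mem hc x
  · rw [← toLin'_apply (LinearMap.toMatrix' _), toLin'_toMatrix']
    obtain ⟨a, ha, k, hk, hx⟩ := Submodule.mem_sup.1
      (show x ∈ deligneZero N F ⊔ wt N (-1) by rw [codisjoint_iff.1 hc.codisjoint]; trivial)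
    rw [← hx, map_add, Submodule.projection_apply_of_mem_left hc ha,
      Submodule.projection_apply_of_mem_right hc hk, add_zero, mulVec_add, mem_wt_neg_one.1 hk,
      add_zero]

/-- The imaginary part of a complex matrix, in terms of its action on vectors. -/
theorem toC_im_mulVec (M : Matrix ι ι ℂ) (x : ι → ℂ) :
    toC (M.map Complex.im) *ᵥ x = (I / 2) • (conjVec (M *ᵥ conjVec x) - M *ᵥ x) := by
  have h1 : toC (M.map Complex.im) = (I / 2) • (M.map (starRingEnd ℂ) - M) := by
    ext i j
    simp only [toC, map_apply, Matrix.smul_apply, Matrix.sub_apply, smul_eq_mul]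
    apply Complex.ext
    · simp; ring
    · simp
  rw [h1, smul_mulVec, sub_mulVec, conjVec_mulVec, conjVec_conjVec]

/-- Every limiting mixed Hodge structure `(W(N), F)` with `N² = 0` has an `ℝ`-split translate
`(W(N), exp(-iδ)F)`. Here `δ` is the imaginary part of the projection `Π` to the sum of the
`I^{p,-p}` along `Ker N`, so that `exp(-iδ)` acts on the `I^{p,-p}` as the real part of `Π`. -/
theorem exists_splitting (h : MixedHodge Q N F) :
    ∃ δ ∈ LMinus Q N F, IsLowering Q N (-(I • toC δ)) ∧
      IsRSplit N (act (1 + -(I • toC δ)) F) := by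
  obtain ⟨M, hMA, hMN⟩ := h.exists_proj
  have hMeq : ∀ {x a : ι → ℂ}, a ∈ deligneZero N F → toC N *ᵥ x = toC N *ᵥ a → M *ᵥ x = a := by
    intro x a ha hxa
    rw [← sub_eq_zero]
    apply h.deligneZero_ker (Submodule.sub_mem _ (hMA x) ha)
    rw [mulVec_sub, hMN, hxa, sub_self]
  have hA : ∀ {p : ℤ} {a : ι → ℂ}, a ∈ deligne N F p (-p) → a ∈ deligneZero N F :=
    fun ha => Submodule.mem_iSup_of_mem _ ha
  have hMker : ∀ {x : ι → ℂ}, toC N *ᵥ x = 0 → M *ᵥ x = 0 := fun hx =>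
    hMeq (Submodule.zero_mem _) (by rw [hx, mulVec_zero])
  -- `Π` maps the conjugate of a vector of `I^{p,-p}` to `I^{-p,p}`
  have hconj : ∀ {p : ℤ} {a : ι → ℂ}, a ∈ deligne N F p (-p) →
      M *ᵥ conjVec a ∈ deligne N F (-p) p := by
    intro p a ha
    have h1 := h.deligne_zero_le_grFilt p ha
    obtain ⟨x, hx, hxa⟩ := h.exists_mem_deligne_zero_of_grFilt (p := -p) (v := conjVec a)
      ⟨h1.2, by simpa using h1.1⟩
    rw [neg_neg] at hx
    rwa [hMeq (Submodule.mem_iSup_of_mem (-p) (by rwa [neg_neg])) hxa]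
  -- the defect of reality of `Π` on `I^{p,-p}` has type `(p-1,-p-1)`
  have hdiff : ∀ {p : ℤ} {a : ι → ℂ}, a ∈ deligne N F p (-p) →
      conjVec (M *ᵥ conjVec a) - a ∈ deligne N F (p - 1) (-p - 1) := by
    intro p a ha
    have h1 := hconj ha
    set a' := M *ᵥ conjVec a with ha'
    have hNa' : toC N *ᵥ a' = toC N *ᵥ conjVec a := hMN _
    obtain ⟨hap, c, hc, w, hw, hac⟩ := (mem_deligne_zero (by omega)).1 ha
    obtain ⟨hap', d, hd, u, hu, had⟩ := (mem_deligne_zero (by omega)).1 h1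
    have e1 : conjVec a' - a = d - a + toC N *ᵥ u := by rw [had, conjVec_conjVec]; abel
    have e2 : conjVec a' - a = conjVec (a' - c) - conjVec (toC N *ᵥ w) := by
      rw [conjVec_add] at hac
      rw [conjVec_sub]
      linear_combination (exp := 1) -hac
    have hk : toC N *ᵥ (d - a) = 0 := by
      have : toC N *ᵥ (conjVec a' - a) = 0 := by
        rw [mulVec_sub, ← conjVec_toC_mulVec, hNa', ← conjVec_toC_mulVec, conjVec_conjVec, sub_self]
      rwa [e1, mulVec_add, toC_mulVec_mulVec_eq_zero h.sq, add_zero] at this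
    obtain ⟨w', hw'⟩ := h.gr_one_inf (p := p) (Submodule.sub_mem _ hd hap) hk
      (Submodule.sub_mem _ hap' hc) (w := -conjVec w - u) (by
        rw [mulVec_sub, mulVec_neg, ← conjVec_toC_mulVec]
        have := e1.symm.trans e2
        linear_combination (exp := 1) this)
    refine (mem_deligne_neg_two (by omega)).2 ⟨?_, ?_, w' + u, ?_⟩
    · rw [e1]
      exact Submodule.add_mem _ (h.anti (by omega) (Submodule.sub_mem _ hd hap)) hu
    · rw [e2, conjVec_sub, conjVec_conjVec, conjVec_conjVec]
      exact Submodule.sub_mem _ (h.anti (by omega) (Submodule.sub_mem _ hap' hc)) hw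
    · rw [mulVec_add, hw', e1]
  have hrange : ∀ x, ∃ w, toC N *ᵥ w = conjVec (M *ᵥ conjVec x) - M *ᵥ x := by
    intro x
    obtain ⟨a, ha, hxa⟩ : ∃ a ∈ deligneZero N F, toC N *ᵥ x = toC N *ᵥ a := ⟨_, hMA x, (hMN x).symm⟩
    have h1 : M *ᵥ conjVec x = M *ᵥ conjVec a := by
      apply hMeq (hMA _)
      rw [hMN, ← conjVec_toC_mulVec, hxa, conjVec_toC_mulVec]
    rw [h1, hMeq ha hxa, ← mem_wt_neg_two]
    refine Submodule.iSup_induction (fun p => deligne N F p (-p))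
      (motive := fun a => conjVec (M *ᵥ conjVec a) - a ∈ wt N (-2)) ha ?_ ?_ ?_
    · intro p a ha
      exact mem_wt_neg_two.2 ((mem_deligne_neg_two (by omega)).1 (hdiff ha)).2.2
    · simp
    · intro a b ha hb
      have : conjVec (M *ᵥ conjVec (a + b)) - (a + b) =
          (conjVec (M *ᵥ conjVec a) - a) + (conjVec (M *ᵥ conjVec b) - b) := by
        rw [conjVec_add, mulVec_add, conjVec_add]; abel
      rw [this]
      exact Submodule.add_mem _ ha hb
  have hMbar : ∀ x, toC N *ᵥ conjVec (M *ᵥ conjVec x) = toC N *ᵥ x := by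
    intro x
    rw [← conjVec_toC_mulVec, hMN, ← conjVec_toC_mulVec, conjVec_conjVec]
  set δ := M.map Complex.im with hδ
  have hδ_apply : ∀ x, toC δ *ᵥ x = (I / 2) • (conjVec (M *ᵥ conjVec x) - M *ᵥ x) :=
    toC_im_mulVec M
  have hδ_ker : ∀ x, toC N *ᵥ x = 0 → toC δ *ᵥ x = 0 := by
    intro x hx
    rw [hδ_apply, hMker hx, hMker (ker_conj hx)]; simp
  have hδ_skew : ∀ x y, form Q (toC δ *ᵥ x) y = -form Q x (toC δ *ᵥ y) := by
    intro x y
    have key : form Q (conjVec (M *ᵥ conjVec x) - M *ᵥ x) y =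
        -form Q x (conjVec (M *ᵥ conjVec y) - M *ᵥ y) := by
      have e1 : form Q (conjVec (M *ᵥ conjVec x) - M *ᵥ x) y =
          form Q (conjVec (M *ᵥ conjVec x)) (M *ᵥ y) := by
        obtain ⟨w, hw⟩ := hrange x
        have h1 : form Q (toC N *ᵥ w) (y - M *ᵥ y) = 0 :=
          h.form_N_ker _ (by rw [mulVec_sub, hMN, sub_self])
        rw [form_sub_right, sub_eq_zero, hw] at h1
        rw [h1, form_sub_left, h.deligneZero_isotropic (hMA x) (hMA y), sub_zero]
      have e2 : form Q x (conjVec (M *ᵥ conjVec y) - M *ᵥ y) =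
          -form Q (conjVec (M *ᵥ conjVec x)) (M *ᵥ y) := by
        obtain ⟨w, hw⟩ := hrange y
        have h1 : form Q (x - conjVec (M *ᵥ conjVec x)) (toC N *ᵥ w) = 0 :=
          h.form_ker_N _ (by rw [mulVec_sub, hMbar, sub_self])
        rw [form_sub_left, sub_eq_zero, hw] at h1
        rw [h1, form_sub_right, form_conjVec_eq_zero.2
          (h.deligneZero_isotropic (hMA _) (hMA _)), zero_sub]
      rw [e1, e2, neg_neg]
    rw [hδ_apply, hδ_apply, form_smul_left, form_smul_right, key, mul_neg]
  have hδ_deligne : ∀ {p : ℤ} {a : ι → ℂ}, a ∈ deligne N F p (-p) →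
      toC δ *ᵥ a ∈ deligne N F (p - 1) (-p - 1) := by
    intro p a ha
    rw [hδ_apply, hMeq (hA ha) rfl]
    exact Submodule.smul_mem _ _ (hdiff ha)
  have hlow : IsLowering Q N (-(I • toC δ)) := by
    have : IsLowering Q N ((-I) • toC δ) := IsLowering.smul ⟨hδ_skew, hδ_ker⟩ _
    rwa [neg_smul] at this
  refine ⟨δ, ⟨mem_LieG_iff.2 hδ_skew, ?_⟩, hlow, ?_⟩
  · intro p q
    rw [mapSub_le]
    intro v hv
    rcases lt_or_ge (p + q) 0 with hpq | hpq
    · have h1 : toC N *ᵥ v = 0 := by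
        have h2 := deligne_le_wt N F p q hv
        have h3 : ∀ k : ℤ, k < 0 → wt N k ≤ wt N (-1) := by
          intro k hk
          obtain rfl | rfl | hk : k = -1 ∨ k = -2 ∨ k ≤ -3 := by omega
          · exact le_rfl
          · exact wt_sub_one_le h.sq (-1)
          · rw [wt_le_neg_three N hk]; exact bot_le
        exact mem_wt_neg_one.1 (h3 _ hpq h2)
      rw [hδ_ker v h1]; exact Submodule.zero_mem _
    rcases hpq.eq_or_lt with hpq | hpq
    · obtain rfl : q = -p := by omega
      have h1 : deligne N F (p - 1) (-p - 1) ≤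
          ⨆ (r : ℤ) (_ : r < p) (s : ℤ) (_ : s < -p), deligne N F r s :=
        le_trans (le_iSup₂_of_le (f := fun s (_ : s < -p) => deligne N F (p - 1) s) (-p - 1)
          (by omega) le_rfl) (le_iSup₂_of_le (f := fun r (_ : r < p) =>
            ⨆ (s : ℤ) (_ : s < -p), deligne N F r s) (p - 1) (by omega) le_rfl)
      exact h1 (hδ_deligne hv)
    · rw [h.deligne_eq_bot_of_pos (by omega), Submodule.mem_bot] at hv
      rw [hv, mulVec_zero]; exact Submodule.zero_mem _
  · -- `1 + T` acts on `I^{p,-p}` as a real operator composed with `Π`, and maps it onto the Deligne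
    -- component of the translate
    set T := -(I • toC δ) with hT
    have h' : MixedHodge Q N (act (1 + T) F) := hlow.mixedHodge_act h
    have hg : ∀ {a : ι → ℂ}, a ∈ deligneZero N F →
        (1 + T) *ᵥ a = (1 / 2 : ℂ) • (a + conjVec (M *ᵥ conjVec a)) := by
      intro a ha
      rw [IsLowering.one_add_mulVec, hT, neg_mulVec, smul_mulVec, hδ_apply, hMeq ha rfl, smul_smul,
        show I * (I / 2) = -(1 / 2) by linear_combination (1 / 2 : ℂ) * I_sq]
      module
    have hgc : ∀ {p : ℤ} {a : ι → ℂ}, a ∈ deligne N F p (-p) →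
        ∃ a' ∈ deligne N F (-p) p, conjVec ((1 + T) *ᵥ a) = (1 + T) *ᵥ a' := by
      intro p a ha
      have h1 := hconj ha
      refine ⟨_, h1, ?_⟩
      have h2 : M *ᵥ conjVec (M *ᵥ conjVec a) = a := hMeq (hA ha) (hMbar a)
      rw [hg (hA ha), hg (Submodule.mem_iSup_of_mem (-p) (by rwa [neg_neg])), h2]
      rw [conjVec_smul, conjVec_add, conjVec_conjVec, add_comm]
      congr 1
      exact Complex.conj_eq_iff_re.2 (by norm_num)
    have hmem : ∀ {p : ℤ} {a : ι → ℂ}, a ∈ deligne N F p (-p) →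
        (1 + T) *ᵥ a ∈ deligne N (act (1 + T) F) p (-p) := by
      intro p a ha
      refine (mem_deligne_zero (by omega)).2 ⟨mulVec_mem_mapSub _ (deligne_le _ _ _ _ ha), ?_⟩
      obtain ⟨a', ha', haa'⟩ := hgc ha
      refine ⟨(1 + T) *ᵥ a', mulVec_mem_mapSub _ (deligne_le _ _ _ _ ha'), 0, by simp, ?_⟩
      rw [mulVec_zero, add_zero, ← haa', conjVec_conjVec]
    have hex : ∀ {p : ℤ} {x : ι → ℂ}, x ∈ deligne N (act (1 + T) F) p (-p) →
        ∃ a ∈ deligne N F p (-p), x = (1 + T) *ᵥ a := by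
      intro p x hx
      have h1 := h'.deligne_zero_le_grFilt p hx
      rw [hlow.grFilt_act h.toMonodromyFilt] at h1
      obtain ⟨a, ha, hxa⟩ := h.exists_mem_deligne_zero_of_grFilt h1
      refine ⟨a, ha, ?_⟩
      rw [← sub_eq_zero]
      apply h'.deligne_zero_ker (by omega) (Submodule.sub_mem _ hx (hmem ha))
      rw [IsLowering.one_add_mulVec, mulVec_sub, mulVec_add, hlow.N_mul h.toMonodromyFilt, add_zero,
        hxa, sub_self]
    have hle : ∀ p q, deligne N (act (1 + T) F) p q ≤ conjSub (deligne N (act (1 + T) F) q p) := by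
      intro p q x hx
      rw [mem_conjSub]
      obtain hpq | hpq | hpq | hpq | hpq :
        1 ≤ p + q ∨ p + q = 0 ∨ p + q = -1 ∨ p + q = -2 ∨ p + q ≤ -3 := by omega
      · rw [h'.deligne_eq_bot_of_pos hpq, Submodule.mem_bot] at hx
        rw [hx, conjVec_zero]; exact Submodule.zero_mem _
      · obtain rfl : q = -p := by omega
        obtain ⟨a, ha, rfl⟩ := hex hx
        obtain ⟨a', ha', haa'⟩ := hgc ha
        rw [haa']
        have := hmem (p := -p) (a := a') (by rwa [neg_neg])
        rwa [neg_neg] at this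
      · rw [mem_deligne_neg_one hpq] at hx
        rw [mem_deligne_neg_one (by omega), conjVec_conjVec]
        exact ⟨hx.2.1, hx.1, ker_conj hx.2.2⟩
      · rw [mem_deligne_neg_two hpq] at hx
        rw [mem_deligne_neg_two (by omega), conjVec_conjVec]
        obtain ⟨hx1, hx2, w, hw⟩ := hx
        exact ⟨hx2, hx1, conjVec w, by rw [← conjVec_toC_mulVec, hw]⟩
      · rw [deligne_eq_bot_of_le hpq, Submodule.mem_bot] at hx
        rw [hx, conjVec_zero]; exact Submodule.zero_mem _
    intro p q
    apply le_antisymm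
    · have := conjSub_mono (hle p q)
      rwa [conjSub_conjSub] at this
    · exact hle q p

/-- An element of `L^{-1,-1}` kills the components of weights `-1` and `-2`, which span `Ker N`,
since there is nothing below weight `-2`. -/
theorem isLowering_of_mem_LMinus (h : MixedHodge Q N F) {δ : Matrix ι ι ℝ}
    (hδ : δ ∈ LMinus Q N F) : IsLowering Q N (-(I • toC δ)) := by
  have hker : ∀ p q, p + q < 0 → ∀ v ∈ deligne N F p q, toC δ *ᵥ v = 0 := by
    intro p q hpq v hv
    have h1 := mapSub_le.1 (hδ.2 p q) v hv
    rw [← Submodule.mem_bot ℂ]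
    refine (iSup₂_le fun r hr => iSup₂_le fun s hs => ?_ :
      (⨆ (r : ℤ) (_ : r < p) (s : ℤ) (_ : s < q), deligne N F r s) ≤ ⊥) h1
    rw [deligne_eq_bot_of_le (by omega)]
  have : IsLowering Q N (toC δ) := by
    refine ⟨mem_LieG_iff.1 hδ.1, fun x hx => ?_⟩
    obtain ⟨a, ha, b, hb, a', ha', rfl⟩ := h.exists_decomp x
    have ha0 : a = 0 := by
      apply h.deligneZero_ker ha
      rwa [mulVec_add, mulVec_add, deligneOne_ker N F hb, toC_mulVec_mulVec_eq_zero h.sq, add_zero,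
        add_zero] at hx
    have hb0 : toC δ *ᵥ b = 0 :=
      Submodule.iSup_induction (fun p => deligne N F p (-p - 1))
        (motive := fun b => toC δ *ᵥ b = 0) hb (fun p => hker p (-p - 1) (by omega))
        (mulVec_zero _) (fun x y hx hy => by rw [mulVec_add, hx, hy, add_zero])
    have hc0 : toC δ *ᵥ (toC N *ᵥ a') = 0 :=
      Submodule.iSup_induction (fun p => deligne N F p (-p))
        (motive := fun a' => toC δ *ᵥ (toC N *ᵥ a') = 0) ha'
        (fun p x hx => hker (p - 1) (-p - 1) (by omega) _ (h.N_mulVec_mem_deligne hx))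
        (by simp) (fun x y hx hy => by rw [mulVec_add, mulVec_add, hx, hy, add_zero])
    rw [ha0, zero_add, mulVec_add, hb0, hc0, add_zero]
  have := this.smul (-I)
  rwa [neg_smul] at this

end MixedHodge

/-! ### Positive and negative parts of a filtration -/

theorem zpow_I_congr {p e : ℤ} (h : Even (p + e)) : I ^ (2 * p) = I ^ (2 * e) := by
  rcases Int.even_or_odd p with hp | hp
  · rw [zpow_I_even hp, zpow_I_even ((Int.even_add.1 h).1 hp)]
  · rw [zpow_I_odd hp, zpow_I_odd]
    rw [← Int.not_even_iff_odd] at hp ⊢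
    exact fun he => hp ((Int.even_add.1 h).2 he)

theorem zpow_I_succ (e : ℤ) : I ^ (2 * (e + 1)) = -I ^ (2 * e) := by
  rw [mul_add, zpow_add₀ I_ne_zero, mul_one, zpow_ofNat, I_sq, mul_neg_one]

/-- The subspaces on which `(-1)^e i⟨x, conj x⟩` is positive definite. -/
def IsPos (Q : Matrix ι ι ℤ) (e : ℤ) (V : Submodule ℂ (ι → ℂ)) : Prop :=
  ∀ v ∈ V, v ≠ 0 → 0 < (I ^ (2 * e + 1) * form Q v (conjVec v)).re

theorem isPos_congr {Q : Matrix ι ι ℤ} {e e' : ℤ} (h : Even (e + e')) {V : Submodule ℂ (ι → ℂ)} :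
    IsPos Q e V ↔ IsPos Q e' V := by
  rw [IsPos, IsPos, zpow_I_two_mul_add_one, zpow_I_two_mul_add_one, zpow_I_congr h]

theorem isPos_succ_iff {Q : Matrix ι ι ℤ} {e : ℤ} {V : Submodule ℂ (ι → ℂ)} :
    IsPos Q (e + 1) V ↔
      ∀ v ∈ V, v ≠ 0 → (I ^ (2 * e + 1) * form Q v (conjVec v)).re < 0 := by
  rw [IsPos]
  refine forall₃_congr fun v _ _ => ?_
  rw [zpow_I_two_mul_add_one, zpow_I_two_mul_add_one, zpow_I_succ, neg_mul, neg_mul, neg_re,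
    Left.neg_pos_iff]

/-- The filtration `F` is the sum of its intersections with `V` and `W`, and it jumps in `V` only
for `p ≡ e` modulo `2` and in `W` only for `p ≢ e`. -/
structure SplitBy (e : ℤ) (F : Filt ι) (V W : Submodule ℂ (ι → ℂ)) : Prop where
  le : ∀ p, F p ≤ (F p ⊓ V) ⊔ (F p ⊓ W)
  left : ∀ p, Odd (p + e) → F p ⊓ V ≤ F (p + 1)
  right : ∀ p, Even (p + e) → F p ⊓ W ≤ F (p + 1)

theorem SplitBy.symm {e : ℤ} {F : Filt ι} {V W : Submodule ℂ (ι → ℂ)} (h : SplitBy e F V W) :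
    SplitBy (e + 1) F W V := by
  refine ⟨fun p => by rw [sup_comm]; exact h.le p, fun p hp => h.right p ?_,
    fun p hp => h.left p ?_⟩
  · rw [← add_assoc] at hp
    by_contra h1
    exact Int.not_odd_iff_even.2 (Int.not_even_iff_odd.1 h1).add_one hp
  · rw [← add_assoc] at hp
    exact Int.not_even_iff_odd.1 (Int.even_add_one.1 hp)

theorem SplitBy.act {e : ℤ} {F : Filt ι} {V W : Submodule ℂ (ι → ℂ)} (h : SplitBy e F V W)
    {g : Matrix ι ι ℂ} (hg : IsUnit g) : SplitBy e (act g F) (mapSub g V) (mapSub g W) := by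
  have hinj : Function.Injective (toLin' g) := Matrix.mulVec_injective_iff_isUnit.2 hg
  have hinf : ∀ A B : Submodule ℂ (ι → ℂ), mapSub g (A ⊓ B) = mapSub g A ⊓ mapSub g B :=
    fun A B => Submodule.map_inf _ hinj
  refine ⟨fun p => ?_, fun p hp => ?_, fun p hp => ?_⟩
  · change mapSub g (F p) ≤ mapSub g (F p) ⊓ mapSub g V ⊔ mapSub g (F p) ⊓ mapSub g W
    rw [← hinf, ← hinf, mapSub, mapSub, mapSub, ← Submodule.map_sup]
    exact Submodule.map_mono (h.le p)
  · change mapSub g (F p) ⊓ mapSub g V ≤ mapSub g (F (p + 1))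
    rw [← hinf]; exact mapSub_mono g (h.left p hp)
  · change mapSub g (F p) ⊓ mapSub g W ≤ mapSub g (F (p + 1))
    rw [← hinf]; exact mapSub_mono g (h.right p hp)

/-- If `v + w` is orthogonal to `conj w`, then `w` enters the value of the Hermitian form on `v + w`
with the opposite sign. -/
theorem form_conj_eq_of_orth {Q : Matrix ι ι ℤ} (hQ : Qᵀ = -Q) {v w : ι → ℂ}
    (h : form Q (v + w) (conjVec w) = 0) :
    form Q (v + w) (conjVec (v + w)) =
      form Q v (conjVec v) - form Q w (conjVec w) := by
  have h1 := form_conj_swap hQ v w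
  have h2 := form_conj_swap hQ w w
  rw [form_add_left] at h
  rw [eq_neg_of_add_eq_zero_left h, map_neg, neg_neg] at h1
  rw [conjVec_add, form_add_right, form_add_left, form_add_left, h, h1]
  linear_combination h2

/-- The criterion for points of the period domain on which the inclusion of cycles in `D` rests:
`F` is the sum of its parts in a positive subspace `V` and in a negative subspace `W`, with jumps
of the right parity. -/
theorem mem_PeriodDomain_of_splitBy {Q : Matrix ι ι ℤ} (hQ : Qᵀ = -Q) (hQ' : Q.det ≠ 0)
    {h : ℤ →₀ ℕ} {F : Filt ι} (hF : F ∈ CompactDual Q h) {e : ℤ} {V W : Submodule ℂ (ι → ℂ)}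
    (hs : SplitBy e F V W) (hV : IsPos Q e V) (hW : IsPos Q (e + 1) W) :
    F ∈ PeriodDomain Q h := by
  have hd := CompactDual.dualFilt hQ hQ' hF
  -- on a vector `v + w` of the radical the values at `v` and at `w` agree, though they have
  -- opposite signs
  have hdis : ∀ p, ∀ x ∈ F p, (∀ y ∈ F p, form Q x (conjVec y) = 0) → x = 0 := by
    intro p x hx ho
    obtain ⟨v, ⟨hv, hvV⟩, w, ⟨hw, hwW⟩, rfl⟩ := Submodule.mem_sup.1 (hs.le p hx)
    have h1 := form_conj_eq_of_orth hQ (ho w hw)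
    rw [ho _ hx] at h1
    have hW' := isPos_succ_iff.1 hW
    have hv0 : v = 0 := by
      by_contra hv0
      have h2 := hV v hvV hv0
      rw [sub_eq_zero.1 h1.symm] at h2
      rcases eq_or_ne w 0 with rfl | hw0
      · rw [form_zero_left, mul_zero, zero_re] at h2
        exact lt_irrefl _ h2
      · exact lt_asymm h2 (hW' w hwW hw0)
    have hw0 : w = 0 := by
      by_contra hw0
      have h2 := hW' w hwW hw0
      rw [← sub_eq_zero.1 h1.symm, hv0, form_zero_left, mul_zero, zero_re] at h2
      exact lt_irrefl _ h2
    rw [hv0, hw0, add_zero]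
  -- if `p` is a jump in `V`, the `W`-part of a vector of type `(p,-p-1)` lies in `F^{p+1}`, so that
  -- both parts contribute with the same sign
  have hpos : ∀ {e : ℤ} {V W : Submodule ℂ (ι → ℂ)}, SplitBy e F V W → IsPos Q e V →
      IsPos Q (e + 1) W → ∀ p, Even (p + e) → IsPos Q p (hodge F p) := by
    rintro e V W hs hV hW p hp x ⟨hx, hx'⟩ hx0
    rw [zpow_I_two_mul_add_one, zpow_I_congr hp, ← zpow_I_two_mul_add_one]
    obtain ⟨v, ⟨hv, hvV⟩, w, ⟨hw, hwW⟩, rfl⟩ := Submodule.mem_sup.1 (hs.le p hx)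
    have hw1 : w ∈ F (p + 1) := hs.right p hp ⟨hw, hwW⟩
    have ho : form Q (v + w) (conjVec w) = 0 :=
      hd.form_conj_eq_zero (p := -p - 1) (q := p + 1) (by omega) hx' (by simpa using hw1)
    rw [form_conj_eq_of_orth hQ ho, mul_sub, sub_re]
    have hV' : 0 ≤ (I ^ (2 * e + 1) * form Q v (conjVec v)).re := by
      rcases eq_or_ne v 0 with rfl | h0
      · simp [form_zero_left]
      · exact (hV v hvV h0).le
    have hW' : (I ^ (2 * e + 1) * form Q w (conjVec w)).re ≤ 0 := by
      rcases eq_or_ne w 0 with rfl | h0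
      · simp [form_zero_left]
      · exact (isPos_succ_iff.1 hW w hwW h0).le
    rcases eq_or_ne v 0 with rfl | h0
    · have hw0 : w ≠ 0 := by rintro rfl; simp at hx0
      linarith [isPos_succ_iff.1 hW w hwW hw0]
    · linarith [hV v hvV h0]
  refine ⟨hF, fun p => ⟨?_, ?_⟩, fun p => ?_⟩
  · rw [Submodule.disjoint_def]
    intro x hx hx'
    apply hdis p x hx
    intro y hy
    exact hd.form_conj_eq_zero (p := -p) (q := p) (by omega) hx' (by simpa using hy)
  · rw [codisjoint_iff, eq_top_iff]
    intro z _
    obtain ⟨a, ha, ha'⟩ := exists_mem_forall_eq (F p) (conjSub (F p)) (formL Q) (formL Q z) (by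
      intro b hb hb'
      have : conjVec b = 0 := hdis p _ hb (by
        intro y hy
        rw [form_conjVec_eq_zero, form_swap hQ, neg_eq_zero]
        exact hb' y hy)
      rw [conjVec_eq_zero.1 this, map_zero])
    refine Submodule.mem_sup.2 ⟨a, ha, z - a, hd.mem_of_conj fun y hy => ?_, by abel⟩
    have := ha' (conjVec y) (by simpa using hy)
    rw [form_sub_left, ← formL_apply, ← formL_apply, this, sub_self]
  · rcases Int.even_or_odd (p + e) with hp | hp
    · exact hpos hs hV hW p hp
    · refine hpos hs.symm hW ((isPos_congr ⟨e + 1, by ring⟩).1 hV) p ?_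
      rw [← add_assoc]; exact hp.add_one

/-- `V` and `W` split a filtration that is a sum of subspaces `G p` of Hodge type `(p, -p-1)`. -/
theorem SplitBy.of_graded {Q : Matrix ι ι ℤ} {F : Filt ι} (hF : DualFilt Q F) {e : ℤ}
    {G : ℤ → Submodule ℂ (ι → ℂ)} {V W : Submodule ℂ (ι → ℂ)} (hG : ∀ p, G p ≤ hodge F p)
    (hstep : ∀ p, F p ≤ G p ⊔ F (p + 1)) (hGV : ∀ p, Even (p + e) → G p ≤ V)
    (hGW : ∀ p, Odd (p + e) → G p ≤ W) (ho : ∀ v ∈ V, ∀ w ∈ W, form Q v (conjVec w) = 0)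
    (hV : IsPos Q e V) (hW : IsPos Q (e + 1) W) : SplitBy e F V W := by
  have hnull : ∀ {e : ℤ} {V : Submodule ℂ (ι → ℂ)}, IsPos Q e V → ∀ v ∈ V,
      form Q v (conjVec v) = 0 → v = 0 := by
    intro e V hV v hv h0
    by_contra hne
    have := hV v hv hne
    rw [h0, mul_zero, zero_re] at this
    exact lt_irrefl _ this
  have key : ∀ p, ∀ g ∈ G p, ∀ z ∈ F (p + 1), form Q g (conjVec z) = 0 := by
    intro p g hg z hz
    exact hF.form_conj_eq_zero (p := -p - 1) (q := p + 1) (by omega) (hG p hg).2 (by simpa using hz)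
  refine ⟨fun p => ?_, fun p hp => ?_, fun p hp => ?_⟩
  · apply hF.le_of_step
    intro r hr
    refine (hstep r).trans (sup_le_sup_right ?_ _)
    have h1 : G r ≤ F p := (hG r).trans (inf_le_left.trans (hF.anti hr))
    rcases Int.even_or_odd (r + e) with h2 | h2
    · exact (le_inf h1 (hGV r h2)).trans le_sup_left
    · exact (le_inf h1 (hGW r h2)).trans le_sup_right
  · rintro x ⟨hx, hxV⟩
    obtain ⟨g, hg, z, hz, rfl⟩ := Submodule.mem_sup.1 (hstep p hx)
    have h1 := ho _ hxV g (hGW p hp hg)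
    rw [form_add_left, form_conj_swap hF.alt g z, key p g hg z hz, map_zero, neg_zero,
      add_zero] at h1
    rw [hnull hW g (hGW p hp hg) h1, zero_add]
    exact hz
  · rintro x ⟨hx, hxW⟩
    obtain ⟨g, hg, z, hz, rfl⟩ := Submodule.mem_sup.1 (hstep p hx)
    have h1 := ho g (hGV p hp hg) _ hxW
    rw [conjVec_add, form_add_right, key p g hg z hz, add_zero] at h1
    rw [hnull hV g (hGV p hp hg) h1, zero_add]
    exact hz

/-! ### Hodge decompositions -/

/-- The sum of the `H^{p,-p-1}` with `p ≡ e` modulo `2`. -/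
def hodgePar (e : ℤ) (F : Filt ι) : Submodule ℂ (ι → ℂ) := ⨆ (p : ℤ) (_ : Even (p + e)), hodge F p

theorem hodgeEv_eq (F : Filt ι) : hodgeEv F = hodgePar 0 F := by
  simp [hodgeEv, hodgePar]

theorem hodgeOd_eq (F : Filt ι) : hodgeOd F = hodgePar 1 F := by
  simp only [hodgeOd, hodgePar, Int.even_add_one, Int.not_even_iff_odd]

theorem hodgePar_congr {e e' : ℤ} (h : Even (e + e')) (F : Filt ι) :
    hodgePar e F = hodgePar e' F := by
  have : ∀ p : ℤ, Even (p + e) ↔ Even (p + e') := by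
    intro p
    have h1 := Int.even_add.1 h
    rw [Int.even_add, Int.even_add, h1]
  simp only [hodgePar, this]

theorem conjSub_hodge (F : Filt ι) (p : ℤ) : conjSub (hodge F p) = hodge F (-p - 1) := by
  rw [hodge, hodge, conjSub_inf, conjSub_conjSub, inf_comm, show -(-p - 1) - 1 = p by ring]

theorem conjSub_hodgePar (e : ℤ) (F : Filt ι) :
    conjSub (hodgePar e F) = hodgePar (e + 1) F := by
  have key : ∀ e, conjSub (hodgePar e F) ≤ hodgePar (e + 1) F := by
    intro e
    rw [hodgePar, conjSub_iSup]
    refine iSup_le fun p => ?_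
    rw [conjSub_iSup]
    refine iSup_le fun hp => ?_
    rw [conjSub_hodge]
    refine le_iSup₂_of_le (f := fun q (_ : Even (q + (e + 1))) => hodge F q) (-p - 1) ?_ le_rfl
    rw [show -p - 1 + (e + 1) = (p + e) - (p + p) by ring]
    exact hp.sub ⟨p, rfl⟩
  apply le_antisymm (key e)
  have := conjSub_mono (key (e + 1))
  rwa [conjSub_conjSub, hodgePar_congr (e := e + 1 + 1) (e' := e) ⟨e + 1, by ring⟩] at this

theorem hodge_le_hodgePar {e p : ℤ} (hp : Even (p + e)) (F : Filt ι) :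
    hodge F p ≤ hodgePar e F :=
  le_iSup₂_of_le (f := fun q (_ : Even (q + e)) => hodge F q) p hp le_rfl

theorem le_hodge_sup {Q : Matrix ι ι ℤ} {h : ℤ →₀ ℕ} {F : Filt ι} (hF : F ∈ PeriodDomain Q h)
    (p : ℤ) : F p ≤ hodge F p ⊔ F (p + 1) := by
  intro x hx
  have h1 : x ∈ F (p + 1) ⊔ conjSub (F (-(p + 1))) := by
    rw [codisjoint_iff.1 (hF.2.1 (p + 1)).codisjoint]; trivial
  obtain ⟨a, ha, c, hc, rfl⟩ := Submodule.mem_sup.1 h1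
  refine Submodule.mem_sup.2 ⟨c, ⟨?_, by rwa [show -p - 1 = -(p + 1) by ring]⟩, a, ha, add_comm _ _⟩
  have := Submodule.sub_mem _ hx (hF.1.1 (by omega : p ≤ p + 1) ha)
  rwa [add_sub_cancel_left] at this

theorem hodge_conj_orth {Q : Matrix ι ι ℤ} {F : Filt ι} (hF : DualFilt Q F) {p q : ℤ}
    (hpq : p ≠ q) {x y : ι → ℂ} (hx : x ∈ hodge F p) (hy : y ∈ hodge F q) :
    form Q x (conjVec y) = 0 := by
  rcases lt_or_gt_of_ne hpq with h1 | h1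
  · exact hF.form_conj_eq_zero (p := -p - 1) (q := q) (by omega) hx.2 (by simpa using hy.1)
  · exact hF.form_eq_zero (p := p) (q := -q - 1) (by omega) hx.1 hy.2

theorem hodgePar_conj_orth {Q : Matrix ι ι ℤ} {F : Filt ι} (hF : DualFilt Q F) {e : ℤ}
    {x y : ι → ℂ} (hx : x ∈ hodgePar e F) (hy : y ∈ hodgePar (e + 1) F) :
    form Q x (conjVec y) = 0 := by
  have hy : conjVec y ∈ conjSub (hodgePar (e + 1) F) := by simpa using hy
  rw [hodgePar, conjSub_iSup] at hy
  refine form_eq_zero_of_mem_iSup (fun p q x hx y hy => ?_) hx hy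
  rw [conjSub_iSup] at hy
  refine form_eq_zero_of_mem_iSup (fun hp hq x hx y hy => ?_) hx hy
  rw [← conjVec_conjVec y]
  refine hodge_conj_orth hF (p := p) (q := q) ?_ hx hy
  rintro rfl
  rw [← add_assoc] at hq
  exact Int.even_add_one.1 hq hp

/-- The form pairs `H^{p,-p-1}` with its conjugate `H^{-p-1,p}`, which has the other parity. -/
theorem hodgePar_isotropic {Q : Matrix ι ι ℤ} {F : Filt ι} (hF : DualFilt Q F) {e : ℤ}
    {x y : ι → ℂ} (hx : x ∈ hodgePar e F) (hy : y ∈ hodgePar e F) : form Q x y = 0 := by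
  rw [← conjVec_conjVec y]
  apply hodgePar_conj_orth hF hx
  rw [← conjSub_hodgePar]
  simpa using hy

theorem hodgePar_sup {Q : Matrix ι ι ℤ} (hQ : Qᵀ = -Q) (hQ' : Q.det ≠ 0) {h : ℤ →₀ ℕ}
    {F : Filt ι} (hF : F ∈ PeriodDomain Q h) (e : ℤ) :
    hodgePar e F ⊔ hodgePar (e + 1) F = ⊤ := by
  have hd := CompactDual.dualFilt hQ hQ' hF.1
  obtain ⟨m, hm⟩ := hd.exists_eq_top
  rw [eq_top_iff, ← hm]
  apply hd.le_of_step
  intro r _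
  refine (le_hodge_sup hF r).trans (sup_le_sup_right ?_ _)
  rcases Int.even_or_odd (r + e) with h2 | h2
  · exact (hodge_le_hodgePar h2 F).trans le_sup_left
  · refine (hodge_le_hodgePar ?_ F).trans le_sup_right
    rw [← add_assoc]; exact h2.add_one

theorem isPos_hodgePar {Q : Matrix ι ι ℤ} (hQ : Qᵀ = -Q) (hQ' : Q.det ≠ 0) {h : ℤ →₀ ℕ}
    {F : Filt ι} (hF : F ∈ PeriodDomain Q h) (e : ℤ) : IsPos Q e (hodgePar e F) := by
  have hd := CompactDual.dualFilt hQ hQ' hF.1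
  intro v hv hv0
  have h1 := pos_of_mem_iSup (Q := Q) (G := fun p => ⨆ (_ : Even (p + e)), hodge F p)
    (1 : Matrix ι ι ℝ) (I ^ (2 * e + 1)) ?_ ?_ hv hv0
  · simpa using h1
  · intro p q hpq x hx y hy
    rw [toC_one, one_mulVec]
    exact hodge_conj_orth hd hpq ((iSup_le fun _ => le_rfl : _ ≤ hodge F p) hx)
      ((iSup_le fun _ => le_rfl : _ ≤ hodge F q) hy)
  · intro p x hx hx0
    by_cases hp : Even (p + e)
    · simp only [hp, iSup_pos] at hx
      rw [toC_one, one_mulVec, zpow_I_two_mul_add_one, ← zpow_I_congr hp, ← zpow_I_two_mul_add_one]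
      exact hF.2.2 p x hx hx0
    · simp only [hp, iSup_false, Submodule.mem_bot] at hx
      exact absurd hx hx0

theorem splitBy_hodgePar {Q : Matrix ι ι ℤ} (hQ : Qᵀ = -Q) (hQ' : Q.det ≠ 0) {h : ℤ →₀ ℕ}
    {F : Filt ι} (hF : F ∈ PeriodDomain Q h) (e : ℤ) :
    SplitBy e F (hodgePar e F) (hodgePar (e + 1) F) := by
  have hd := CompactDual.dualFilt hQ hQ' hF.1
  refine SplitBy.of_graded hd (fun p => le_rfl) (le_hodge_sup hF)
    (fun p hp => hodge_le_hodgePar hp F) (fun p hp => hodge_le_hodgePar ?_ F)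
    (fun v hv w hw => hodgePar_conj_orth hd hv hw) (isPos_hodgePar hQ hQ' hF e)
    (isPos_hodgePar hQ hQ' hF (e + 1))
  rw [← add_assoc]; exact hp.add_one

/-- The maximal compact subgroup is defined by its action on `H^ev`; being real, it preserves `H^od`
as well. -/
theorem mapSub_hodgePar_of_maxCompact {Q : Matrix ι ι ℤ} {F : Filt ι} {k : Matrix ι ι ℝ}
    (hk : k ∈ maxCompact Q F) (e : ℤ) : mapSub (toC k) (hodgePar e F) = hodgePar e F := by
  have h0 : mapSub (toC k) (hodgePar 0 F) = hodgePar 0 F := by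
    rw [← hodgeEv_eq]; exact hk.2
  rcases Int.even_or_odd e with he | he
  · rw [hodgePar_congr (e := e) (e' := 0) (by simpa using he), h0]
  · rw [hodgePar_congr (e := e) (e' := 0 + 1) (by simpa using he.add_one), ← conjSub_hodgePar,
      ← conjSub_mapSub_toC, h0]

/-- A translate of a base cycle lies in `D` if it has positive `V` and negative `W`. -/
theorem translate_baseCycle_subset {Q : Matrix ι ι ℤ} (hQ : Qᵀ = -Q) (hQ' : Q.det ≠ 0)
    {h : ℤ →₀ ℕ} {F : Filt ι} (hF : F ∈ PeriodDomain Q h) {g : Matrix ι ι ℂ} (hg : g ∈ GC Q)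
    {e : ℤ} (hV : IsPos Q e (mapSub g (hodgePar e F)))
    (hW : IsPos Q (e + 1) (mapSub g (hodgePar (e + 1) F))) :
    translate g (baseCycle Q F) ⊆ PeriodDomain Q h := by
  rintro _ ⟨_, ⟨k, hk, rfl⟩, rfl⟩
  have hkG : toC k ∈ GC Q := toC_mem_GC_iff.2 hk.1
  refine mem_PeriodDomain_of_splitBy hQ hQ'
    (act_mem_CompactDual hQ hQ' (act_mem_CompactDual hQ hQ' hF.1 hkG) hg) (e := e) ?_ hV hW
  have h1 := ((splitBy_hodgePar hQ hQ' hF e).act (isUnit_of_mem_GC hQ' hkG)).act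
    (isUnit_of_mem_GC hQ' hg)
  rwa [mapSub_hodgePar_of_maxCompact hk, mapSub_hodgePar_of_maxCompact hk] at h1

/-! ### The `sl(2)`-triple of an `ℝ`-split mixed Hodge structure -/

/-- An `ℝ`-split limiting mixed Hodge structure with `N² = 0`. -/
structure SplitHodge (Q : Matrix ι ι ℤ) (N : Matrix ι ι ℝ) (F : Filt ι) : Prop
    extends MixedHodge Q N F where
  split : IsRSplit N F

/-- `N⁺` is the element of `𝔤` that inverts `N` on the weight `-2` part and kills the parts of
weights `0` and `-1`. -/
structure IsNplus (Q : Matrix ι ι ℤ) (N : Matrix ι ι ℝ) (F : Filt ι) (P : Matrix ι ι ℝ) :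
    Prop where
  lie : P ∈ LieG Q
  zero : ∀ a ∈ deligneZero N F, toC P *ᵥ a = 0
  one : ∀ b ∈ deligneOne N F, toC P *ᵥ b = 0
  inv : ∀ a ∈ deligneZero N F, toC P *ᵥ (toC N *ᵥ a) = a

namespace SplitHodge

variable {Q : Matrix ι ι ℤ} {N : Matrix ι ι ℝ} {F : Filt ι}

theorem conj_mem_deligne (h : SplitHodge Q N F) {p q : ℤ} {x : ι → ℂ}
    (hx : x ∈ deligne N F p q) : conjVec x ∈ deligne N F q p := by
  rw [← h.split p q]; simpa using hx

theorem conj_mem_deligneZero (h : SplitHodge Q N F) {x : ι → ℂ} (hx : x ∈ deligneZero N F) :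
    conjVec x ∈ deligneZero N F := by
  rw [← mem_conjSub, deligneZero, conjSub_iSup]
  refine (iSup_le fun p => ?_ : deligneZero N F ≤ _) hx
  refine le_iSup_of_le (-p) fun y hy => ?_
  rw [mem_conjSub, neg_neg]
  exact h.conj_mem_deligne hy

theorem conj_mem_deligneOne (h : SplitHodge Q N F) {x : ι → ℂ} (hx : x ∈ deligneOne N F) :
    conjVec x ∈ deligneOne N F := by
  rw [← mem_conjSub, deligneOne, conjSub_iSup]
  refine (iSup_le fun p => ?_ : deligneOne N F ≤ _) hx
  refine le_iSup_of_le (-p - 1) fun y hy => ?_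
  rw [mem_conjSub, show -(-p - 1) - 1 = p by ring]
  exact h.conj_mem_deligne hy

end SplitHodge

namespace MixedHodge

variable {Q : Matrix ι ι ℤ} {N : Matrix ι ι ℝ} {F : Filt ι}

/-- Matrices that agree on the three parts of the weight grading are equal. -/
theorem matrix_ext (h : MixedHodge Q N F) {A B : Matrix ι ι ℂ}
    (h0 : ∀ a ∈ deligneZero N F, A *ᵥ a = B *ᵥ a) (h1 : ∀ b ∈ deligneOne N F, A *ᵥ b = B *ᵥ b)
    (h2 : ∀ a ∈ deligneZero N F, A *ᵥ (toC N *ᵥ a) = B *ᵥ (toC N *ᵥ a)) : A = B := by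
  apply Matrix.ext_of_mulVec_single
  intro i
  obtain ⟨a, ha, b, hb, a', ha', hx⟩ := h.exists_decomp (Pi.single i 1)
  rw [hx, mulVec_add, mulVec_add, mulVec_add, mulVec_add, h0 a ha, h1 b hb, h2 a' ha']

/-- The complex version of `N⁺`. -/
theorem exists_inverse (h : MixedHodge Q N F) : ∃ M : Matrix ι ι ℂ,
    (∀ a ∈ deligneZero N F, M *ᵥ a = 0) ∧ (∀ b ∈ deligneOne N F, M *ᵥ b = 0) ∧
      ∀ a ∈ deligneZero N F, M *ᵥ (toC N *ᵥ a) = a := by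
  obtain ⟨P, hPA, hPN⟩ := h.exists_proj
  have hc : IsCompl (deligneZero N F ⊔ deligneOne N F) (wt N (-2)) := by
    refine ⟨?_, codisjoint_iff.2 h.deligne_sup_eq_top⟩
    rw [Submodule.disjoint_def]
    intro x hx hx'
    obtain ⟨a, ha, b, hb, rfl⟩ := Submodule.mem_sup.1 hx
    obtain ⟨w, hw⟩ := mem_wt_neg_two.1 hx'
    obtain ⟨rfl, rfl, -⟩ := h.decomp_eq_zero ha hb (w := -w) (by rw [mulVec_neg, hw]; abel)
    simp
  obtain ⟨g, hg⟩ := LinearMap.exists_rightInverse_of_surjective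
    (toLin' (toC N)).rangeRestrict (LinearMap.range_rangeRestrict _)
  have hwt : wt N (-2) = LinearMap.range (toLin' (toC N)) := by simp [wt]
  rw [hwt] at hc
  let p := (LinearMap.range (toLin' (toC N))).projectionOnto _ hc.symm
  refine ⟨P * LinearMap.toMatrix' (g.comp p), fun a ha => ?_, fun b hb => ?_, fun a ha => ?_⟩
  · rw [← mulVec_mulVec, ← toLin'_apply (LinearMap.toMatrix' _), toLin'_toMatrix',
      LinearMap.comp_apply, Submodule.projectionOnto_apply_of_mem_right hc.symm
      (Submodule.mem_sup_left ha), map_zero, mulVec_zero]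
  · rw [← mulVec_mulVec, ← toLin'_apply (LinearMap.toMatrix' _), toLin'_toMatrix',
      LinearMap.comp_apply, Submodule.projectionOnto_apply_of_mem_right hc.symm
      (Submodule.mem_sup_right hb), map_zero, mulVec_zero]
  · have hr : toC N *ᵥ a ∈ LinearMap.range (toLin' (toC N)) := ⟨a, by simp [toLin'_apply]⟩
    have h1 := congrArg Subtype.val (LinearMap.congr_fun hg ⟨_, hr⟩)
    rw [← mulVec_mulVec, ← toLin'_apply (LinearMap.toMatrix' _), toLin'_toMatrix',
      LinearMap.comp_apply, Submodule.projectionOnto_apply_of_mem_left hc.symm hr, ← sub_eq_zero]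
    apply h.deligneZero_ker (Submodule.sub_mem _ (hPA _) ha)
    rw [mulVec_sub, hPN, sub_eq_zero]
    simpa [toLin'_apply] using h1

/-- `N : (H, F) → (H, F[-1])` is strict. Here this follows from the Hodge decompositions. -/
theorem strict (h : MixedHodge Q N F) {p : ℤ} {w : ι → ℂ} (hw : toC N *ᵥ w ∈ F (p - 1)) :
    ∃ a ∈ F p, toC N *ᵥ a = toC N *ᵥ w := by
  obtain ⟨a, ha, c, hc, hac⟩ := h.gr_zero_sup p w
  refine ⟨a, ha, ?_⟩
  have h1 : toC N *ᵥ (w - a) = conjVec (toC N *ᵥ c) := by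
    rw [mulVec_sub, hac, conjVec_toC_mulVec]; abel
  have h2 : toC N *ᵥ (w - a) = 0 := by
    apply h.gr_two_inf (p := p - 1) (q := 1 - p - 1) (by omega) _ _ rfl
    · rw [mulVec_sub]; exact Submodule.sub_mem _ hw (h.hor ha)
    · rw [h1, conjVec_conjVec]; exact h.hor hc
  rw [mulVec_sub, sub_eq_zero] at h2
  exact h2.symm

/-- `N` maps `I^{p+1,-p-1}` onto `I^{p,-p-2}`. -/
theorem exists_mulVec_eq_of_mem_deligne (h : MixedHodge Q N F) {p : ℤ} {x : ι → ℂ}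
    (hx : x ∈ deligne N F p (-p - 2)) : ∃ a ∈ deligne N F (p + 1) (-(p + 1)), toC N *ᵥ a = x := by
  obtain ⟨hx1, hx2, w, rfl⟩ := (mem_deligne_neg_two (by omega)).1 hx
  obtain ⟨a, ha, hax⟩ := h.strict (p := p + 1) (w := w) (by simpa using hx1)
  obtain ⟨c, hc, hcx⟩ := h.strict (p := -(p + 1)) (w := conjVec w) (by
    rw [conjVec_toC_mulVec] at hx2
    rwa [show -(p + 1) - 1 = -p - 2 by ring])
  obtain ⟨y, hy, u, -, hu, hyu⟩ := h.exists_mem_deligne_zero ha hc (k := a - conjVec c) (by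
    rw [mulVec_sub, hax, ← conjVec_toC_mulVec, hcx, conjVec_toC_mulVec, conjVec_conjVec, sub_self])
    (by abel)
  refine ⟨y, hy, ?_⟩
  rw [← hax, hyu, mulVec_add, hu, add_zero]

end MixedHodge

/-- The operator `N⁺` of the `SL(2)`-orbit is real, because the components are exchanged by
conjugation. -/
theorem SplitHodge.exists_isNplus {Q : Matrix ι ι ℤ} {N : Matrix ι ι ℝ} {F : Filt ι}
    (h : SplitHodge Q N F) : ∃ P, IsNplus Q N F P := by
  obtain ⟨M, hM0, hM1, hM2⟩ := h.exists_inverse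
  have hMreal : M.map (starRingEnd ℂ) = M := by
    have key : ∀ x, M.map (starRingEnd ℂ) *ᵥ x = conjVec (M *ᵥ conjVec x) := fun x => by
      rw [conjVec_mulVec, conjVec_conjVec]
    apply h.matrix_ext
    · intro a ha
      rw [key, hM0 a ha, hM0 _ (h.conj_mem_deligneZero ha), conjVec_zero]
    · intro a ha
      rw [key, hM1 a ha, hM1 _ (h.conj_mem_deligneOne ha), conjVec_zero]
    · intro a ha
      rw [key, hM2 a ha, conjVec_toC_mulVec, hM2 _ (h.conj_mem_deligneZero ha), conjVec_conjVec]
  obtain ⟨P, rfl⟩ := exists_toC_eq (A := M) fun x => by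
    rw [conjVec_mulVec, hMreal, conjVec_conjVec]
  refine ⟨P, mem_LieG_iff.2 fun x y => ?_, hM0, hM1, hM2⟩
  obtain ⟨a, ha, b, hb, a', ha', rfl⟩ := h.exists_decomp x
  obtain ⟨c, hc, d, hd, c', hc', rfl⟩ := h.exists_decomp y
  simp only [mulVec_add, hM0 a ha, hM1 b hb, hM2 a' ha', hM0 c hc, hM1 d hd, hM2 c' hc',
    form_add_left, form_add_right, zero_add, h.deligneZero_isotropic ha' hc,
    h.deligneZero_isotropic ha hc', h.deligneZero_orth_deligneOne ha' hd]
  rw [form_swap h.alt b c', h.deligneZero_orth_deligneOne hc' hb, mem_LieG_iff.1 h.lie a' c']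
  ring

namespace IsNplus

variable {Q : Matrix ι ι ℤ} {N P : Matrix ι ι ℝ} {F : Filt ι}

theorem range (hP : IsNplus Q N F P) (h : MixedHodge Q N F) (x : ι → ℂ) :
    toC P *ᵥ x ∈ deligneZero N F := by
  obtain ⟨a, ha, b, hb, a', ha', rfl⟩ := h.exists_decomp x
  rw [mulVec_add, mulVec_add, hP.zero a ha, hP.one b hb, hP.inv a' ha', zero_add, zero_add]
  exact ha'

theorem sq (hP : IsNplus Q N F P) (h : MixedHodge Q N F) : toC P * toC P = 0 := by
  apply Matrix.ext_of_mulVec_single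
  intro i
  rw [← mulVec_mulVec, hP.zero _ (hP.range h _), zero_mulVec]

theorem mul_mul (hP : IsNplus Q N F P) (h : MixedHodge Q N F) :
    toC P * toC N * toC P = toC P := by
  apply Matrix.ext_of_mulVec_single
  intro i
  rw [← mulVec_mulVec, ← mulVec_mulVec, hP.inv _ (hP.range h _)]

theorem N_mul_mul (hP : IsNplus Q N F P) (h : MixedHodge Q N F) :
    toC N * toC P * toC N = toC N := by
  apply h.matrix_ext
  · intro a ha
    rw [← mulVec_mulVec, ← mulVec_mulVec, hP.inv a ha]
  · intro b hb
    rw [← mulVec_mulVec, MixedHodge.deligneOne_ker N F hb, mulVec_zero]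
  · intro a ha
    rw [← mulVec_mulVec, toC_mulVec_mulVec_eq_zero h.sq, mulVec_zero]

/-- `N⁺` raises the Hodge filtration. -/
theorem mulVec_mem (hP : IsNplus Q N F P) (h : MixedHodge Q N F) {p : ℤ} {x : ι → ℂ}
    (hx : x ∈ F p) : toC P *ᵥ x ∈ F (p + 1) := by
  have hle : F p ≤ (F (p + 1)).comap (toLin' (toC P)) := by
    apply h.le_of_step
    intro r hr
    refine (h.le_deligne_sup r).trans (sup_le_sup_right (sup_le (sup_le ?_ ?_) ?_) _)
    · intro a ha
      rw [Submodule.mem_comap, toLin'_apply, hP.zero a (Submodule.mem_iSup_of_mem r ha)]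
      exact Submodule.zero_mem _
    · intro a ha
      rw [Submodule.mem_comap, toLin'_apply, hP.one a (Submodule.mem_iSup_of_mem r ha)]
      exact Submodule.zero_mem _
    · intro y hy
      obtain ⟨a, ha, rfl⟩ := h.exists_mulVec_eq_of_mem_deligne hy
      rw [Submodule.mem_comap, toLin'_apply, hP.inv a (Submodule.mem_iSup_of_mem (r + 1) ha)]
      exact h.anti (by omega) (deligne_le _ _ _ _ ha)
  have := hle hx
  rwa [Submodule.mem_comap, toLin'_apply] at this

end IsNplus

/-! ### The representation of `SL(2)` -/

/-- The representation of the multiplicative monoid of `2 × 2`-matrices for which `n` and `m` are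
the images of the off-diagonal matrix units. -/
def rep (n m : Matrix ι ι ℂ) (g : Matrix (Fin 2) (Fin 2) ℂ) : Matrix ι ι ℂ :=
  (1 - n * m - m * n) + g 0 0 • (n * m) + g 0 1 • n + g 1 0 • m + g 1 1 • (m * n)

/-- The relations between off-diagonal matrix units. -/
structure IsUnitPair (n m : Matrix ι ι ℂ) : Prop where
  nn : n * n = 0
  mm : m * m = 0
  nmn : n * m * n = n
  mnm : m * n * m = m

theorem IsNplus.isUnitPair {Q : Matrix ι ι ℤ} {N P : Matrix ι ι ℝ} {F : Filt ι}
    (hP : IsNplus Q N F P) (h : MixedHodge Q N F) : IsUnitPair (toC N) (toC P) :=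
  ⟨by rw [← toC_mul, h.sq, toC_zero], hP.sq h, hP.N_mul_mul h, hP.mul_mul h⟩

theorem rep_one (n m : Matrix ι ι ℂ) : rep n m 1 = 1 := by
  simp [rep]
  abel

theorem rep_mul {n m : Matrix ι ι ℂ} (h : IsUnitPair n m) (g g' : Matrix (Fin 2) (Fin 2) ℂ) :
    rep n m (g * g') = rep n m g * rep n m g' := by
  have nmn : n * (m * n) = n := by rw [← mul_assoc, h.nmn]
  have mnm : m * (n * m) = m := by rw [← mul_assoc, h.mnm]
  have nn' : ∀ x, n * (n * x) = 0 := fun x => by rw [← mul_assoc, h.nn, zero_mul]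
  have mm' : ∀ x, m * (m * x) = 0 := fun x => by rw [← mul_assoc, h.mm, zero_mul]
  simp only [rep, Matrix.mul_apply, Fin.sum_univ_two, mul_add, add_mul, mul_sub, sub_mul, mul_one,
    one_mul, smul_mul_assoc, mul_smul_comm, mul_assoc, h.nn, h.mm, nmn, mnm, nn', mm',
    smul_zero, mul_zero]
  module

/-- The exponential of a multiple of an idempotent, needed for `Y`, which is a difference of two
orthogonal idempotents. -/
theorem exp_smul_idempotent {p : Matrix ι ι ℂ} (hp : p * p = p) (c : ℂ) :
    NormedSpace.exp (c • p) = 1 + (Complex.exp c - 1) • p := by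
  have hpow : ∀ n : ℕ, (c • p) ^ (n + 1) = c ^ (n + 1) • p := by
    intro n
    induction n with
    | zero => simp
    | succ n ih =>
      rw [pow_succ, ih, smul_mul_smul_comm, hp, ← pow_succ]
  have h1 : HasSum (fun n : ℕ => ((n.factorial : ℂ)⁻¹ * c ^ n)) (Complex.exp c) := by
    have := NormedSpace.exp_series_hasSum_exp' (𝕂 := ℂ) c
    rw [← Complex.exp_eq_exp_ℂ] at this
    simpa using this
  have h2 := (h1.smul_const p).add (hasSum_ite_eq (0 : ℕ) (1 - p))
  rw [NormedSpace.exp_eq_tsum (𝕂 := ℂ)]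
  beta_reduce
  have h3 : (fun n : ℕ => ((n.factorial : ℂ)⁻¹) • (c • p) ^ n) =
      fun n => ((n.factorial : ℂ)⁻¹ * c ^ n) • p + if n = 0 then 1 - p else 0 := by
    funext n
    cases n with
    | zero => simp
    | succ n => rw [hpow, if_neg (by omega), add_zero, smul_smul]
  rw [h3, h2.tsum_eq]
  module

theorem hasDifferential_rep {n m : Matrix ι ι ℂ} (h : IsUnitPair n m)
    {ρ : Matrix.SpecialLinearGroup (Fin 2) ℂ →* Matrix ι ι ℂ} (hρ : ∀ g, ρ g = rep n m g) :
    HasDifferential ρ !![0, 1; 0, 0] n ∧ HasDifferential ρ !![0, 0; 1, 0] m ∧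
      HasDifferential ρ !![-1, 0; 0, 1] (m * n - n * m) := by
  refine ⟨?_, ?_, ?_⟩
  · intro t g hg
    rw [hρ, hg, exp_eq_one_add, exp_eq_one_add]
    · simp [rep]
      abel
    · rw [smul_mul_smul_comm, h.nn, smul_zero]
    · ext i j; fin_cases i <;> fin_cases j <;> simp
  · intro t g hg
    rw [hρ, hg, exp_eq_one_add, exp_eq_one_add]
    · simp [rep]
      abel
    · rw [smul_mul_smul_comm, h.mm, smul_zero]
    · ext i j; fin_cases i <;> fin_cases j <;> simp
  · intro t g hg
    have e1 : t • !![(-1 : ℂ), 0; 0, 1] = diagonal ![-t, t] := by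
      ext i j; fin_cases i <;> fin_cases j <;> simp
    have i1 : m * n * (m * n) = m * n := by rw [← mul_assoc, h.mnm]
    have i2 : n * m * (n * m) = n * m := by rw [← mul_assoc, h.nmn]
    have z1 : m * n * (n * m) = 0 := by rw [mul_assoc, ← mul_assoc n, h.nn, zero_mul, mul_zero]
    have z2 : n * m * (m * n) = 0 := by rw [mul_assoc, ← mul_assoc m, h.mm, zero_mul, mul_zero]
    have e2 : t • (m * n - n * m) = t • (m * n) + (-t) • (n * m) := by module
    have hc : Commute (t • (m * n)) ((-t) • (n * m)) := by
      rw [Commute, SemiconjBy, smul_mul_smul_comm, smul_mul_smul_comm, z1, z2, smul_zero, smul_zero]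
    rw [hρ, hg, e1, Matrix.exp_diagonal, e2, Matrix.exp_add_of_commute _ _ hc,
      exp_smul_idempotent i1, exp_smul_idempotent i2]
    simp only [rep, diagonal_apply, Pi.coe_exp, mul_add, add_mul, mul_one, one_mul,
      smul_mul_smul_comm, z1, smul_zero, add_zero]
    simp [← Complex.exp_eq_exp_ℂ]
    module

theorem rep_mem_GC {Q : Matrix ι ι ℤ} {n m : Matrix ι ι ℂ} (h : IsUnitPair n m)
    (hn : ∀ x y, form Q (n *ᵥ x) y = -form Q x (n *ᵥ y))
    (hm : ∀ x y, form Q (m *ᵥ x) y = -form Q x (m *ᵥ y))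
    (g : Matrix.SpecialLinearGroup (Fin 2) ℂ) : rep n m g ∈ GC Q := by
  -- the adjoint of the image of `g` is the image of the inverse
  have hadj : ∀ x y, form Q (rep n m g *ᵥ x) y =
      form Q x (rep n m (g⁻¹ : Matrix.SpecialLinearGroup (Fin 2) ℂ) *ᵥ y) := by
    intro x y
    rw [Matrix.SpecialLinearGroup.SL2_inv_expl]
    simp only [rep, add_mulVec, sub_mulVec, smul_mulVec, one_mulVec, ← mulVec_mulVec, form_add_left,
      form_add_right, form_sub_left, form_sub_right, form_smul_left, form_smul_right, hn, hm]
    simp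
    ring
  rw [mem_GC_iff]
  intro x y
  rw [hadj, mulVec_mulVec, ← rep_mul h, ← Matrix.SpecialLinearGroup.coe_mul, inv_mul_cancel,
    Matrix.SpecialLinearGroup.coe_one, rep_one, one_mulVec]

/-! ### The Hodge structure at the base point of the `SL(2)`-orbit -/

/-- The part of weight `-1` and of parity `e`: the sum of the `I^{p,-p-1}` with `p ≡ e`. -/
def deligneOnePar (e : ℤ) (N : Matrix ι ι ℝ) (F : Filt ι) : Submodule ℂ (ι → ℂ) :=
  ⨆ (p : ℤ) (_ : Even (p + e)), deligne N F p (-p - 1)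

theorem deligne_le_deligneOnePar {e p : ℤ} (hp : Even (p + e)) (N : Matrix ι ι ℝ) (F : Filt ι) :
    deligne N F p (-p - 1) ≤ deligneOnePar e N F :=
  le_iSup₂_of_le (f := fun q (_ : Even (q + e)) => deligne N F q (-q - 1)) p hp le_rfl

theorem deligneOnePar_le (e : ℤ) (N : Matrix ι ι ℝ) (F : Filt ι) :
    deligneOnePar e N F ≤ deligneOne N F :=
  iSup₂_le fun p _ => le_iSup (fun q => deligne N F q (-q - 1)) p

/-- The components `I^{p,-p}` vanish unless `p ≡ e` modulo `2`. -/
def IsType (e : ℤ) (N : Matrix ι ι ℝ) (F : Filt ι) : Prop :=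
  ∀ p : ℤ, Odd (p + e) → deligne N F p (-p) = ⊥

/-- The candidate for the component of type `(p,-p-1)` at the base point. -/
def basePiece (N : Matrix ι ι ℝ) (F : Filt ι) (p : ℤ) : Submodule ℂ (ι → ℂ) :=
  deligne N F p (-p - 1) ⊔ mapSub (1 + I • toC N) (deligne N F p (-p)) ⊔
    mapSub (1 + (-I) • toC N) (deligne N F (p + 1) (-(p + 1)))

namespace MixedHodge

variable {Q : Matrix ι ι ℤ} {N : Matrix ι ι ℝ} {F : Filt ι}

theorem deligneOnePar_conj_orth (h : MixedHodge Q N F) {e : ℤ} {x y : ι → ℂ}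
    (hx : x ∈ deligneOnePar e N F) (hy : y ∈ deligneOnePar (e + 1) N F) :
    form Q x (conjVec y) = 0 := by
  have hy : conjVec y ∈ conjSub (deligneOnePar (e + 1) N F) := by simpa using hy
  rw [deligneOnePar, conjSub_iSup] at hy
  refine form_eq_zero_of_mem_iSup (fun p q x hx y hy => ?_) hx hy
  rw [conjSub_iSup] at hy
  refine form_eq_zero_of_mem_iSup (fun hp hq x hx y hy => ?_) hx hy
  rw [← conjVec_conjVec y]
  refine h.deligne_one_conj_orth (fun hpq => ?_) hx (mem_conjSub.1 hy)
  subst hpq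
  rw [← add_assoc] at hq
  exact Int.not_even_iff_odd.2 hp.add_one hq

theorem isPos_deligneOnePar (h : MixedHodge Q N F) (e : ℤ) : IsPos Q e (deligneOnePar e N F) := by
  intro v hv hv0
  have h1 := pos_of_mem_iSup (Q := Q) (G := fun p => ⨆ (_ : Even (p + e)), deligne N F p (-p - 1))
    (1 : Matrix ι ι ℝ) (I ^ (2 * e + 1)) ?_ ?_ hv hv0
  · simpa using h1
  · intro p q hpq x hx y hy
    rw [toC_one, one_mulVec]
    exact h.deligne_one_conj_orth hpq ((iSup_const_le : _ ≤ deligne N F p (-p - 1)) hx)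
      ((iSup_const_le : _ ≤ deligne N F q (-q - 1)) hy)
  · intro p x hx hx0
    rw [toC_one, one_mulVec]
    by_cases hp : Even (p + e)
    · rw [zpow_I_two_mul_add_one, ← zpow_I_congr hp, ← zpow_I_two_mul_add_one]
      exact h.pos_deligne_one ((iSup_const_le : _ ≤ deligne N F p (-p - 1)) hx) hx0
    · simp only [hp, iSup_false, Submodule.mem_bot] at hx
      exact absurd hx hx0

theorem pos_deligneZero (h : MixedHodge Q N F) {e : ℤ} (he : IsType e N F) {x : ι → ℂ}
    (hx : x ∈ deligneZero N F) (hx0 : x ≠ 0) :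
    0 < (I ^ (2 * e) * form Q x (toC N *ᵥ conjVec x)).re := by
  refine pos_of_mem_iSup N (I ^ (2 * e)) (fun p q hpq x hx y hy => h.deligne_zero_N_orth hpq hx hy)
    (fun p x hx hx0 => ?_) hx hx0
  rcases Int.even_or_odd (p + e) with hp | hp
  · rw [← zpow_I_congr hp]
    exact h.pos_deligne_zero hx hx0
  · rw [he p hp, Submodule.mem_bot] at hx
    exact absurd hx hx0

end MixedHodge

namespace SplitHodge

variable {Q : Matrix ι ι ℤ} {N P : Matrix ι ι ℝ} {F : Filt ι}

/-- The Hermitian form on `b + αa + βNa`, for `a` of weight `0` and `b` of weight `-1`. -/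
theorem form_conj_comb (h : SplitHodge Q N F) {a b a' b' : ι → ℂ} (ha : a ∈ deligneZero N F)
    (hb : b ∈ deligneOne N F) (ha' : a' ∈ deligneZero N F) (hb' : b' ∈ deligneOne N F)
    (α β α' β' : ℂ) :
    form Q (b + (α • a + β • (toC N *ᵥ a))) (conjVec (b' + (α' • a' + β' • (toC N *ᵥ a')))) =
      form Q b (conjVec b') + (α * (starRingEnd ℂ) β' - β * (starRingEnd ℂ) α') *
        form Q a (toC N *ᵥ conjVec a') := by
  have ha2 := h.conj_mem_deligneZero ha'
  have hb2 := h.conj_mem_deligneOne hb'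
  have hNN : form Q (toC N *ᵥ a) (toC N *ᵥ conjVec a') = 0 := by
    rw [mem_LieG_iff.1 h.lie, toC_mulVec_mulVec_eq_zero h.sq, form_zero_right, neg_zero]
  simp only [conjVec_add, conjVec_smul, conjVec_toC_mulVec, form_add_left, form_add_right,
    form_smul_left, form_smul_right, hNN, h.deligneZero_isotropic ha ha2,
    h.deligneZero_orth_deligneOne ha hb2, h.form_ker_N _ (MixedHodge.deligneOne_ker N F hb),
    h.form_N_ker _ (MixedHodge.deligneOne_ker N F hb2)]
  rw [form_swap h.alt b (conjVec a'), h.deligneZero_orth_deligneOne ha2 hb, mem_LieG_iff.1 h.lie]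
  ring

/-- The subspace of the `b + αa + βNa`, for `b` of weight `-1` and parity `e'`, is definite as soon
as the sign of the polarization of the weight `0` part agrees with the sign of that of the `b`. -/
theorem isPos_sup (h : SplitHodge Q N F) {e e' : ℤ} (he : IsType e N F) {α β : ℂ} {r : ℝ}
    (hr : 0 < r)
    (hαβ : I ^ (2 * e' + 1) * (α * (starRingEnd ℂ) β - β * (starRingEnd ℂ) α) = r * I ^ (2 * e)) :
    IsPos Q e' (deligneOnePar e' N F ⊔ mapSub (α • 1 + β • toC N) (deligneZero N F)) := by
  intro v hv hv0
  obtain ⟨b, hb, x, hx, rfl⟩ := Submodule.mem_sup.1 hv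
  obtain ⟨a, ha, rfl⟩ := mem_mapSub.1 hx
  rw [add_mulVec, smul_mulVec, smul_mulVec, one_mulVec] at hv0 ⊢
  rw [h.form_conj_comb ha (deligneOnePar_le _ _ _ hb) ha (deligneOnePar_le _ _ _ hb), mul_add,
    ← mul_assoc, hαβ, add_re, mul_assoc, re_ofReal_mul]
  by_cases ha0 : a = 0
  · subst ha0
    simp only [smul_zero, mulVec_zero, add_zero] at hv0
    simpa [form_zero_left] using h.isPos_deligneOnePar e' b hb hv0
  · have h1 := mul_pos hr (h.pos_deligneZero he ha ha0)
    by_cases hb0 : b = 0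
    · simpa [hb0, form_zero_left] using h1
    · exact add_pos (h.isPos_deligneOnePar e' b hb hb0) h1

/-- Membership in `exp(iN)F` is tested by `exp(-iN) = 1 - iN`. -/
theorem mem_act_iff (h : SplitHodge Q N F) {p : ℤ} {x : ι → ℂ} :
    x ∈ act (1 + I • toC N) F p ↔ x + (-I) • (toC N *ᵥ x) ∈ F p := by
  constructor
  · intro hx
    obtain ⟨v, hv, rfl⟩ := mem_mapSub.1 hx
    rw [one_add_smul_mulVec, mulVec_add, mulVec_smul, toC_mulVec_mulVec_eq_zero h.sq, smul_zero,
      add_zero, add_assoc, ← add_smul, add_neg_cancel, zero_smul, add_zero]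
    exact hv
  · intro hx
    refine mem_mapSub.2 ⟨_, hx, ?_⟩
    rw [one_add_smul_mulVec, mulVec_add, mulVec_smul, toC_mulVec_mulVec_eq_zero h.sq, smul_zero,
      add_zero, add_assoc, ← add_smul, neg_add_cancel, zero_smul, add_zero]

/-- The candidates have the right Hodge type. -/
theorem basePiece_le (h : SplitHodge Q N F) (p : ℤ) :
    basePiece N F p ≤ hodge (act (1 + I • toC N) F) p := by
  have hNN := toC_mulVec_mulVec_eq_zero h.sq
  have key : ∀ {q r : ℤ} {x : ι → ℂ} {c : ℂ}, x ∈ F q → r ≤ q - 1 →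
      (1 + c • toC N) *ᵥ x ∈ act (1 + I • toC N) F r := by
    intro q r x c hx hr
    rw [h.mem_act_iff, one_add_smul_mulVec, mulVec_add, mulVec_smul, hNN, smul_zero, add_zero,
      add_assoc, ← add_smul]
    exact Submodule.add_mem _ (h.anti (by omega) hx) (Submodule.smul_mem _ _
      (h.anti hr (h.hor hx)))
  refine sup_le (sup_le ?_ ?_) ?_
  · intro b hb
    obtain ⟨hb1, hb2, hb3⟩ := (mem_deligne_neg_one (by omega)).1 hb
    refine Submodule.mem_inf.2 ⟨?_, ?_⟩
    · rw [h.mem_act_iff, hb3, smul_zero, add_zero]; exact hb1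
    · rw [mem_conjSub, h.mem_act_iff, ker_conj hb3, smul_zero, add_zero]; exact hb2
  · rw [mapSub_le]
    intro a ha
    refine Submodule.mem_inf.2 ⟨mulVec_mem_mapSub _ (deligne_le _ _ _ _ ha), ?_⟩
    rw [mem_conjSub, one_add_smul_mulVec, conjVec_add, conjVec_smul, conjVec_toC_mulVec,
      ← one_add_smul_mulVec]
    exact key (deligne_le _ _ _ _ (h.conj_mem_deligne ha)) (by omega)
  · rw [mapSub_le]
    intro a ha
    refine Submodule.mem_inf.2 ⟨key (deligne_le _ _ _ _ ha) (by omega), ?_⟩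
    rw [mem_conjSub, one_add_smul_mulVec, conjVec_add, conjVec_smul, conjVec_toC_mulVec,
      ← one_add_smul_mulVec, map_neg, conj_I, neg_neg, show -p - 1 = -(p + 1) by ring]
    exact mulVec_mem_mapSub _ (deligne_le _ _ _ _ (h.conj_mem_deligne ha))

/-- The candidates exhaust the filtration `exp(iN)F`. -/
theorem le_basePiece_sup (h : SplitHodge Q N F) (p : ℤ) :
    act (1 + I • toC N) F p ≤ basePiece N F p ⊔ act (1 + I • toC N) F (p + 1) := by
  have h1 : ∀ x ∈ F p, (1 + I • toC N) *ᵥ x ∈ basePiece N F p ⊔ act (1 + I • toC N) F (p + 1) := by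
    have hle : F p ≤ (basePiece N F p ⊔ act (1 + I • toC N) F (p + 1)).comap
        (toLin' (1 + I • toC N)) := by
      refine (h.le_deligne_sup p).trans (sup_le (sup_le (sup_le ?_ ?_) ?_) ?_)
      all_goals
        intro x hx
        rw [Submodule.mem_comap, toLin'_apply]
      · exact Submodule.mem_sup_left (Submodule.mem_sup_left (Submodule.mem_sup_right
          (mulVec_mem_mapSub _ hx)))
      · rw [one_add_smul_mulVec, ((mem_deligne_neg_one (by omega)).1 hx).2.2, smul_zero, add_zero]
        exact Submodule.mem_sup_left (Submodule.mem_sup_left (Submodule.mem_sup_left hx))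
      · obtain ⟨a, ha, rfl⟩ := h.exists_mulVec_eq_of_mem_deligne hx
        -- `2i N a = (1 + iN) a - (1 - iN) a`
        have h2 : (1 + I • toC N) *ᵥ (toC N *ᵥ a) = (I / 2) • ((1 + (-I) • toC N) *ᵥ a) +
            (-I / 2) • ((1 + I • toC N) *ᵥ a) := by
          rw [one_add_smul_mulVec, one_add_smul_mulVec, one_add_smul_mulVec,
            toC_mulVec_mulVec_eq_zero h.sq]
          have hI : I / 2 * -I = 1 / 2 := by linear_combination (-1 / 2 : ℂ) * I_mul_I
          have hI' : -I / 2 * I = 1 / 2 := by linear_combination (-1 / 2 : ℂ) * I_mul_I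
          rw [smul_add, smul_add, smul_smul, smul_smul, hI, hI']
          module
        rw [h2]
        refine Submodule.add_mem _ (Submodule.mem_sup_left (Submodule.mem_sup_right
          (Submodule.smul_mem _ _ (mulVec_mem_mapSub _ ha)))) (Submodule.mem_sup_right
          (Submodule.smul_mem _ _ (mulVec_mem_mapSub _ (deligne_le _ _ _ _ ha))))
      · exact Submodule.mem_sup_right (mulVec_mem_mapSub _ hx)
    intro x hx
    have := hle hx
    rwa [Submodule.mem_comap, toLin'_apply] at this
  exact mapSub_le.2 h1

/-- The positive part of the Hodge structure at the base point. -/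
theorem isPos_base_left (h : SplitHodge Q N F) {e : ℤ} (he : IsType e N F) :
    IsPos Q e (deligneOnePar e N F ⊔ mapSub (1 + I • toC N) (deligneZero N F)) := by
  have := h.isPos_sup (e := e) (e' := e) he (α := 1) (β := I) (r := 2) (by norm_num) (by
    rw [zpow_I_two_mul_add_one, conj_I, map_one]
    push_cast
    linear_combination (-2 * I ^ (2 * e)) * I_mul_I)
  rwa [one_smul] at this

/-- The negative part of the Hodge structure at the base point. -/
theorem isPos_base_right (h : SplitHodge Q N F) {e : ℤ} (he : IsType e N F) :
    IsPos Q (e + 1) (deligneOnePar (e + 1) N F ⊔ mapSub (1 + (-I) • toC N) (deligneZero N F)) := by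
  have := h.isPos_sup (e := e) (e' := e + 1) he (α := 1) (β := -I) (r := 2) (by norm_num) (by
    rw [zpow_I_two_mul_add_one, zpow_I_succ, map_neg, conj_I, map_one]
    push_cast
    linear_combination (-2 * I ^ (2 * e)) * I_mul_I)
  rwa [one_smul] at this

theorem deligne_le_deligneZero (N : Matrix ι ι ℝ) (F : Filt ι) (p : ℤ) :
    deligne N F p (-p) ≤ deligneZero N F := le_iSup (fun q => deligne N F q (-q)) p

theorem basePiece_le_left {e : ℤ} (he : IsType e N F) {p : ℤ} (hp : Even (p + e)) :
    basePiece N F p ≤ deligneOnePar e N F ⊔ mapSub (1 + I • toC N) (deligneZero N F) := by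
  have hp1 : Odd (p + 1 + e) := by rw [add_right_comm]; exact hp.add_one
  refine sup_le (sup_le (le_sup_of_le_left (deligne_le_deligneOnePar hp N F))
    (le_sup_of_le_right (mapSub_mono _ (deligne_le_deligneZero N F p)))) ?_
  rw [he _ hp1, mapSub, Submodule.map_bot]
  exact bot_le

theorem basePiece_le_right {e : ℤ} (he : IsType e N F) {p : ℤ} (hp : Odd (p + e)) :
    basePiece N F p ≤
      deligneOnePar (e + 1) N F ⊔ mapSub (1 + (-I) • toC N) (deligneZero N F) := by
  refine sup_le (sup_le (le_sup_of_le_left (deligne_le_deligneOnePar ?_ N F)) ?_)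
    (le_sup_of_le_right (mapSub_mono _ (deligne_le_deligneZero N F (p + 1))))
  · rw [← add_assoc]; exact hp.add_one
  · rw [he _ hp, mapSub, Submodule.map_bot]
    exact bot_le

/-- The base point of the `SL(2)`-orbit lies in the period domain. -/
theorem base_mem_PeriodDomain (h : SplitHodge Q N F) {e : ℤ} (he : IsType e N F) {d : ℤ →₀ ℕ}
    (hF : act (1 + I • toC N) F ∈ CompactDual Q d) :
    act (1 + I • toC N) F ∈ PeriodDomain Q d := by
  have hd := CompactDual.dualFilt h.alt h.nondeg hF
  refine mem_PeriodDomain_of_splitBy h.alt h.nondeg hF (SplitBy.of_graded hd h.basePiece_le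
    h.le_basePiece_sup (fun p hp => basePiece_le_left he hp) (fun p hp => basePiece_le_right he hp)
    ?_ (h.isPos_base_left he) (h.isPos_base_right he)) (h.isPos_base_left he)
    (h.isPos_base_right he)
  intro v hv w hw
  obtain ⟨b, hb, x, hx, rfl⟩ := Submodule.mem_sup.1 hv
  obtain ⟨a, ha, rfl⟩ := mem_mapSub.1 hx
  obtain ⟨b', hb', x', hx', rfl⟩ := Submodule.mem_sup.1 hw
  obtain ⟨a', ha', rfl⟩ := mem_mapSub.1 hx'
  have := h.form_conj_comb ha (deligneOnePar_le _ _ _ hb) ha' (deligneOnePar_le _ _ _ hb')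
    1 I 1 (-I)
  rw [one_smul, one_smul] at this
  rw [one_add_smul_mulVec, one_add_smul_mulVec, this, h.deligneOnePar_conj_orth hb hb']
  simp

/-- The candidates are the Hodge components at the base point. -/
theorem hodge_base (h : SplitHodge Q N F) {d : ℤ →₀ ℕ}
    (hD : act (1 + I • toC N) F ∈ PeriodDomain Q d) (p : ℤ) :
    hodge (act (1 + I • toC N) F) p = basePiece N F p := by
  refine le_antisymm (fun x hx => ?_) (h.basePiece_le p)
  obtain ⟨y, hy, z, hz, rfl⟩ := Submodule.mem_sup.1 (h.le_basePiece_sup p hx.1)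
  have h1 : z ∈ hodge (act (1 + I • toC N) F) p := by
    simpa using Submodule.sub_mem _ hx (h.basePiece_le p hy)
  have h2 : z = 0 := by
    have := Submodule.disjoint_def.1 (hD.2.1 (p + 1)).disjoint z hz
    apply this
    rw [show -(p + 1) = -p - 1 by ring]
    exact h1.2
  rw [h2, add_zero]
  exact hy

/-- The positive and the negative part of the Hodge structure at the base point. -/
theorem hodgePar_base (h : SplitHodge Q N F) {e : ℤ} (he : IsType e N F) {d : ℤ →₀ ℕ}
    (hD : act (1 + I • toC N) F ∈ PeriodDomain Q d) :
    hodgePar e (act (1 + I • toC N) F) =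
        deligneOnePar e N F ⊔ mapSub (1 + I • toC N) (deligneZero N F) ∧
      hodgePar (e + 1) (act (1 + I • toC N) F) =
        deligneOnePar (e + 1) N F ⊔ mapSub (1 + (-I) • toC N) (deligneZero N F) := by
  have h1 : hodgePar e (act (1 + I • toC N) F) ≤
      deligneOnePar e N F ⊔ mapSub (1 + I • toC N) (deligneZero N F) :=
    iSup₂_le fun p hp => (h.hodge_base hD p).trans_le (basePiece_le_left he hp)
  have h2 : hodgePar (e + 1) (act (1 + I • toC N) F) ≤
      deligneOnePar (e + 1) N F ⊔ mapSub (1 + (-I) • toC N) (deligneZero N F) := by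
    refine iSup₂_le fun p hp => (h.hodge_base hD p).trans_le (basePiece_le_right he ?_)
    rw [← add_assoc] at hp
    by_contra h3
    exact Int.not_even_iff_odd.2 (Int.not_odd_iff_even.1 h3).add_one hp
  have hinf : (deligneOnePar e N F ⊔ mapSub (1 + I • toC N) (deligneZero N F)) ⊓
      (deligneOnePar (e + 1) N F ⊔ mapSub (1 + (-I) • toC N) (deligneZero N F)) = ⊥ := by
    rw [eq_bot_iff]
    rintro x ⟨hx1, hx2⟩
    by_contra hx0
    exact lt_asymm (h.isPos_base_left he x hx1 hx0)
      (isPos_succ_iff.1 (h.isPos_base_right he) x hx2 hx0)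
  have hsup := hodgePar_sup h.alt h.nondeg hD e
  exact ⟨eq_of_le_of_inf_le_of_sup_le h1 (hinf.trans_le bot_le)
      (le_top.trans (hsup.symm.trans_le (sup_le_sup_left h2 _))),
    eq_of_le_of_inf_le_of_sup_le (z := deligneOnePar e N F ⊔ mapSub (1 + I • toC N)
      (deligneZero N F)) h2 ((inf_comm _ _).trans_le (hinf.trans_le bot_le))
      (le_top.trans (hsup.symm.trans_le (by rw [sup_comm]; exact sup_le_sup_left h1 _)))⟩

end SplitHodge

/-! ### Existence and uniqueness of the `SL(2)`-orbit -/

/-- An element of `SL(2,ℂ)` that maps `0` to the given point of the projective line. -/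
def sectionSL : OnePoint ℂ → Matrix.SpecialLinearGroup (Fin 2) ℂ
  | OnePoint.infty => ⟨!![0, 1; -1, 0], by simp [det_fin_two]⟩
  | OnePoint.some z => ⟨!![1, z; 0, 1], by simp [det_fin_two]⟩

@[simp] theorem sectionSL_coe (z : ℂ) :
    (sectionSL (z : OnePoint ℂ) : Matrix (Fin 2) (Fin 2) ℂ) = !![1, z; 0, 1] := rfl

@[simp] theorem sectionSL_infty :
    (sectionSL OnePoint.infty : Matrix (Fin 2) (Fin 2) ℂ) = !![0, 1; -1, 0] := rfl

/-- If `s` is the section, then `s(gz)⁻¹ g s(z)` fixes `0`: it is lower triangular. -/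
theorem sectionSL_smul (g : Matrix.SpecialLinearGroup (Fin 2) ℂ) (z : OnePoint ℂ) :
    ((sectionSL (Matrix.SpecialLinearGroup.toGL g • z))⁻¹ * g * sectionSL z :
      Matrix.SpecialLinearGroup (Fin 2) ℂ) 0 1 = 0 := by
  have key : ∀ k s : Matrix.SpecialLinearGroup (Fin 2) ℂ,
      (k⁻¹ * g * s : Matrix.SpecialLinearGroup (Fin 2) ℂ) 0 1 =
        k 1 1 * (g 0 0 * s 0 1 + g 0 1 * s 1 1) - k 0 1 * (g 1 0 * s 0 1 + g 1 1 * s 1 1) := by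
    intro k s
    rw [Matrix.SpecialLinearGroup.coe_mul, Matrix.SpecialLinearGroup.coe_mul, Matrix.mul_apply,
      Fin.sum_univ_two, Matrix.mul_apply, Matrix.mul_apply, Fin.sum_univ_two, Fin.sum_univ_two,
      Matrix.SpecialLinearGroup.SL2_inv_expl]
    simp
    ring
  rw [key]
  induction z using OnePoint.rec with
  | infty =>
    rw [OnePoint.smul_infty_eq_ite]
    split_ifs with h0
    · have h1 : g 1 0 = 0 := by simpa using h0
      simp [h1]
    · have h1 : g 1 0 ≠ 0 := by simpa using h0
      simp [h1]
  | coe z =>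
    rw [OnePoint.smul_some_eq_ite]
    split_ifs with h0
    · have h1 : g 1 0 * z + g 1 1 = 0 := by simpa using h0
      simp [h1]
    · have h1 : g 1 0 * z + g 1 1 ≠ 0 := by simpa using h0
      simp [h1]

/-- The image of `i n_- - h + i n_+`, twice the element `X`. -/
def lowerOp (N P : Matrix ι ι ℝ) : Matrix ι ι ℂ :=
  I • toC N - toC (P * N - N * P) + I • toC P

namespace IsNplus

variable {Q : Matrix ι ι ℤ} {N P : Matrix ι ι ℝ} {F : Filt ι}

theorem Y_zero (hP : IsNplus Q N F P) {a : ι → ℂ} (ha : a ∈ deligneZero N F) :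
    toC (P * N - N * P) *ᵥ a = a := by
  rw [toC_sub, toC_mul, toC_mul, sub_mulVec, ← mulVec_mulVec, ← mulVec_mulVec, hP.inv a ha,
    hP.zero a ha, mulVec_zero, sub_zero]

theorem Y_one (hP : IsNplus Q N F P) {b : ι → ℂ} (hb : b ∈ deligneOne N F) :
    toC (P * N - N * P) *ᵥ b = 0 := by
  rw [toC_sub, toC_mul, toC_mul, sub_mulVec, ← mulVec_mulVec, ← mulVec_mulVec,
    MixedHodge.deligneOne_ker N F hb, hP.one b hb, mulVec_zero, mulVec_zero, sub_zero]

theorem Y_two (hP : IsNplus Q N F P) (h : MixedHodge Q N F) {a : ι → ℂ}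
    (ha : a ∈ deligneZero N F) : toC (P * N - N * P) *ᵥ (toC N *ᵥ a) = -(toC N *ᵥ a) := by
  rw [toC_sub, toC_mul, toC_mul, sub_mulVec, ← mulVec_mulVec, ← mulVec_mulVec,
    toC_mulVec_mulVec_eq_zero h.sq, hP.inv a ha, mulVec_zero, zero_sub]

theorem Y_eigen (hP : IsNplus Q N F P) (h : MixedHodge Q N F) (p q : ℤ) (v : ι → ℂ)
    (hv : v ∈ deligne N F p q) :
    toC (P * N - N * P) *ᵥ v = ((p + q + 1 : ℤ) : ℂ) • v := by
  obtain hk | hk | hk | hk | hk :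
    1 ≤ p + q ∨ p + q = 0 ∨ p + q = -1 ∨ p + q = -2 ∨ p + q ≤ -3 := by omega
  · rw [h.deligne_eq_bot_of_pos hk, Submodule.mem_bot] at hv
    rw [hv, mulVec_zero, smul_zero]
  · obtain rfl : q = -p := by omega
    rw [hP.Y_zero (Submodule.mem_iSup_of_mem p hv), hk]
    simp
  · obtain rfl : q = -p - 1 := by omega
    rw [hP.Y_one (Submodule.mem_iSup_of_mem p hv), hk]
    simp
  · obtain rfl : q = -p - 2 := by omega
    obtain ⟨a, ha, rfl⟩ := h.exists_mulVec_eq_of_mem_deligne hv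
    rw [hP.Y_two h (Submodule.mem_iSup_of_mem (p + 1) ha), hk]
    simp
  · rw [deligne_eq_bot_of_le hk, Submodule.mem_bot] at hv
    rw [hv, mulVec_zero, smul_zero]

theorem Y_mem (hP : IsNplus Q N F P) (h : MixedHodge Q N F) : P * N - N * P ∈ LieG Q := by
  rw [mem_LieG_iff]
  intro x y
  have h1 := mem_LieG_iff.1 hP.lie
  have h2 := mem_LieG_iff.1 h.lie
  rw [toC_sub, toC_mul, toC_mul, sub_mulVec, sub_mulVec, ← mulVec_mulVec, ← mulVec_mulVec,
    ← mulVec_mulVec, ← mulVec_mulVec, form_sub_left, form_sub_right, h1, h2, h2, h1]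
  ring

/-- The stabilizer of `0` in `SL(2,ℂ)` fixes `F`. Therefore `φ(z) = ρ(s(z))F`, with `s` the section
of the orbit map of `0`, is equivariant. -/
theorem act_rep (hP : IsNplus Q N F P) (h : MixedHodge Q N F)
    (g : Matrix.SpecialLinearGroup (Fin 2) ℂ) (hg : g 0 1 = 0) :
    act (rep (toC N) (toC P) g) F = F := by
  have key : ∀ g : Matrix.SpecialLinearGroup (Fin 2) ℂ, g 0 1 = 0 → ∀ p,
      mapSub (rep (toC N) (toC P) g) (F p) ≤ F p := by
    intro g hg p
    rw [mapSub_le]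
    intro x hx
    have h1 : toC N *ᵥ (toC P *ᵥ x) ∈ F p := by simpa using h.hor (hP.mulVec_mem h hx)
    have h2 : toC P *ᵥ (toC N *ᵥ x) ∈ F p := by simpa using hP.mulVec_mem h (h.hor hx)
    have h3 : toC P *ᵥ x ∈ F p := h.anti (by omega) (hP.mulVec_mem h hx)
    simp only [rep, add_mulVec, sub_mulVec, smul_mulVec, one_mulVec, ← mulVec_mulVec, hg, zero_smul,
      add_zero]
    exact Submodule.add_mem _ (Submodule.add_mem _ (Submodule.add_mem _ (Submodule.sub_mem _
      (Submodule.sub_mem _ hx h1) h2) (Submodule.smul_mem _ _ h1)) (Submodule.smul_mem _ _ h3))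
      (Submodule.smul_mem _ _ h2)
  funext p
  refine le_antisymm (key g hg p) ?_
  have h1 := mapSub_mono (rep (toC N) (toC P) g) (key g⁻¹ (by
    rw [Matrix.SpecialLinearGroup.SL2_inv_expl]; simpa using hg) p)
  rwa [← mapSub_mul, ← rep_mul (hP.isUnitPair h), ← Matrix.SpecialLinearGroup.coe_mul,
    mul_inv_cancel, Matrix.SpecialLinearGroup.coe_one, rep_one, mapSub_one] at h1

theorem lowerOp_zero (hP : IsNplus Q N F P) {a : ι → ℂ}
    (ha : a ∈ deligneZero N F) : lowerOp N P *ᵥ a = I • (toC N *ᵥ a) - a := by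
  rw [lowerOp, add_mulVec, sub_mulVec, smul_mulVec, smul_mulVec, hP.Y_zero ha, hP.zero a ha,
    smul_zero, add_zero]

theorem lowerOp_one (hP : IsNplus Q N F P) {b : ι → ℂ} (hb : b ∈ deligneOne N F) :
    lowerOp N P *ᵥ b = 0 := by
  rw [lowerOp, add_mulVec, sub_mulVec, smul_mulVec, smul_mulVec, hP.Y_one hb, hP.one b hb,
    MixedHodge.deligneOne_ker N F hb, smul_zero, add_zero, sub_zero]

theorem lowerOp_two (hP : IsNplus Q N F P) (h : MixedHodge Q N F) {a : ι → ℂ}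
    (ha : a ∈ deligneZero N F) : lowerOp N P *ᵥ (toC N *ᵥ a) = toC N *ᵥ a + I • a := by
  rw [lowerOp, add_mulVec, sub_mulVec, smul_mulVec, smul_mulVec, hP.Y_two h ha, hP.inv a ha,
    toC_mulVec_mulVec_eq_zero h.sq, smul_zero, zero_sub, neg_neg]

/-- Together with the next fact: `i N - Y + i N⁺` maps the Lagrangian subspace of parity `e` at the
base point into the other one, on which it vanishes. -/
theorem lowerOp_plus (hP : IsNplus Q N F P) (h : MixedHodge Q N F) {a : ι → ℂ}
    (ha : a ∈ deligneZero N F) : lowerOp N P *ᵥ ((1 + I • toC N) *ᵥ a) =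
      (-2 : ℂ) • ((1 + (-I) • toC N) *ᵥ a) := by
  rw [one_add_smul_mulVec, one_add_smul_mulVec, mulVec_add, mulVec_smul, hP.lowerOp_zero ha,
    hP.lowerOp_two h ha, smul_add, smul_smul, I_mul_I]
  module

theorem lowerOp_minus (hP : IsNplus Q N F P) (h : MixedHodge Q N F) {a : ι → ℂ}
    (ha : a ∈ deligneZero N F) : lowerOp N P *ᵥ ((1 + (-I) • toC N) *ᵥ a) = 0 := by
  rw [one_add_smul_mulVec, mulVec_add, mulVec_smul, hP.lowerOp_zero ha,
    hP.lowerOp_two h ha, smul_add, smul_smul, neg_mul, I_mul_I]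
  module

theorem lowerOp_sq (hP : IsNplus Q N F P) (h : MixedHodge Q N F) :
    lowerOp N P * lowerOp N P = 0 := by
  apply h.matrix_ext
  · intro a ha
    rw [zero_mulVec, ← mulVec_mulVec, hP.lowerOp_zero ha, mulVec_sub, mulVec_smul,
      hP.lowerOp_zero ha, hP.lowerOp_two h ha, smul_add, smul_smul, I_mul_I]
    module
  · intro b hb
    rw [zero_mulVec, ← mulVec_mulVec, hP.lowerOp_one hb, mulVec_zero]
  · intro a ha
    rw [zero_mulVec, ← mulVec_mulVec, hP.lowerOp_two h ha, mulVec_add, mulVec_smul,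
      hP.lowerOp_zero ha, hP.lowerOp_two h ha, smul_sub, smul_smul, I_mul_I]
    module

theorem lowerOp_skew (hP : IsNplus Q N F P) (h : MixedHodge Q N F) (x y : ι → ℂ) :
    form Q (lowerOp N P *ᵥ x) y = -form Q x (lowerOp N P *ᵥ y) := by
  have h1 := mem_LieG_iff.1 hP.lie
  have h2 := mem_LieG_iff.1 h.lie
  have h3 := mem_LieG_iff.1 (hP.Y_mem h)
  simp only [lowerOp, add_mulVec, sub_mulVec, smul_mulVec, form_add_left, form_add_right,
    form_sub_left, form_sub_right, form_smul_left, form_smul_right, h1, h2, h3]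
  ring

/-- The operator of type `(-1,1)`. -/
theorem mapSub_lowerOp_basePiece (hP : IsNplus Q N F P) (h : MixedHodge Q N F) (p : ℤ) :
    mapSub (lowerOp N P) (basePiece N F p) ≤ basePiece N F (p - 1) := by
  rw [mapSub, Submodule.map_le_iff_le_comap]
  refine sup_le (sup_le ?_ ?_) (mapSub_le.2 ?_)
  · intro b hb
    rw [Submodule.mem_comap, toLin'_apply, hP.lowerOp_one (Submodule.mem_iSup_of_mem p hb)]
    exact Submodule.zero_mem _
  · refine mapSub_le.2 fun a ha => ?_
    rw [Submodule.mem_comap, toLin'_apply, hP.lowerOp_plus h (Submodule.mem_iSup_of_mem p ha)]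
    refine Submodule.smul_mem _ _ (Submodule.mem_sup_right (mulVec_mem_mapSub _ ?_))
    rwa [sub_add_cancel]
  · intro a ha
    rw [Submodule.mem_comap, toLin'_apply,
      hP.lowerOp_minus h (Submodule.mem_iSup_of_mem (p + 1) ha)]
    exact Submodule.zero_mem _

/-- The operator of type `(0,0)`. -/
theorem mapSub_sub_basePiece (hP : IsNplus Q N F P) (h : MixedHodge Q N F) (p : ℤ) :
    mapSub (toC N - toC P) (basePiece N F p) ≤ basePiece N F p := by
  have key : ∀ c : ℂ, c * c = -1 → ∀ a ∈ deligneZero N F,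
      (toC N - toC P) *ᵥ ((1 + c • toC N) *ᵥ a) = (-c) • ((1 + c • toC N) *ᵥ a) := by
    intro c hc a ha
    rw [one_add_smul_mulVec, mulVec_add, mulVec_smul, sub_mulVec, sub_mulVec, hP.zero a ha,
      hP.inv a ha, toC_mulVec_mulVec_eq_zero h.sq, smul_add, smul_smul, neg_mul, hc]
    module
  rw [mapSub, Submodule.map_le_iff_le_comap]
  refine sup_le (sup_le ?_ ?_) (mapSub_le.2 ?_)
  · intro b hb
    have hb' : b ∈ deligneOne N F := Submodule.mem_iSup_of_mem p hb
    rw [Submodule.mem_comap, toLin'_apply, sub_mulVec, hP.one b hb',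
      MixedHodge.deligneOne_ker N F hb', sub_zero]
    exact Submodule.zero_mem _
  · refine mapSub_le.2 fun a ha => ?_
    rw [Submodule.mem_comap, toLin'_apply, key I I_mul_I a (Submodule.mem_iSup_of_mem p ha)]
    exact Submodule.smul_mem _ _ (Submodule.mem_sup_left (Submodule.mem_sup_right
      (mulVec_mem_mapSub _ ha)))
  · intro a ha
    rw [Submodule.mem_comap, toLin'_apply, key (-I) (by rw [neg_mul_neg, I_mul_I]) a
      (Submodule.mem_iSup_of_mem (p + 1) ha)]
    exact Submodule.smul_mem _ _ (Submodule.mem_sup_right (mulVec_mem_mapSub _ ha))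

/-- The operator of type `(1,-1)`. -/
theorem mapSub_raise_basePiece (hP : IsNplus Q N F P) (h : MixedHodge Q N F) (p : ℤ) :
    mapSub (-(I • toC N) - toC (P * N - N * P) - I • toC P) (basePiece N F p) ≤
      basePiece N F (p + 1) := by
  have h0 : ∀ a ∈ deligneZero N F, (-(I • toC N) - toC (P * N - N * P) - I • toC P) *ᵥ a =
      -(I • (toC N *ᵥ a)) - a := by
    intro a ha
    rw [sub_mulVec, sub_mulVec, neg_mulVec, smul_mulVec, smul_mulVec, hP.Y_zero ha, hP.zero a ha,
      smul_zero, sub_zero]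
  have h2 : ∀ a ∈ deligneZero N F, (-(I • toC N) - toC (P * N - N * P) - I • toC P) *ᵥ
      (toC N *ᵥ a) = toC N *ᵥ a - I • a := by
    intro a ha
    rw [sub_mulVec, sub_mulVec, neg_mulVec, smul_mulVec, smul_mulVec, hP.Y_two h ha, hP.inv a ha,
      toC_mulVec_mulVec_eq_zero h.sq, smul_zero, neg_zero, zero_sub, neg_neg]
  rw [mapSub, Submodule.map_le_iff_le_comap]
  refine sup_le (sup_le ?_ ?_) (mapSub_le.2 ?_)
  · intro b hb
    have hb' : b ∈ deligneOne N F := Submodule.mem_iSup_of_mem p hb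
    rw [Submodule.mem_comap, toLin'_apply, sub_mulVec, sub_mulVec, neg_mulVec, smul_mulVec,
      smul_mulVec, hP.one b hb', hP.Y_one hb', MixedHodge.deligneOne_ker N F hb']
    simp
  · refine mapSub_le.2 fun a ha => ?_
    have ha' : a ∈ deligneZero N F := Submodule.mem_iSup_of_mem p ha
    rw [Submodule.mem_comap, toLin'_apply, one_add_smul_mulVec, mulVec_add, mulVec_smul, h0 a ha',
      h2 a ha', smul_sub, smul_smul, I_mul_I]
    have : -(I • (toC N *ᵥ a)) - a + (I • (toC N *ᵥ a) - (-1 : ℂ) • a) = 0 := by module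
    rw [this]
    exact Submodule.zero_mem _
  · intro a ha
    have ha' : a ∈ deligneZero N F := Submodule.mem_iSup_of_mem (p + 1) ha
    rw [Submodule.mem_comap, toLin'_apply, one_add_smul_mulVec, mulVec_add, mulVec_smul, h0 a ha',
      h2 a ha', smul_sub, smul_smul, neg_mul, I_mul_I]
    have : -(I • (toC N *ᵥ a)) - a + (-I • (toC N *ᵥ a) - (- -1 : ℂ) • a) =
        (-2 : ℂ) • ((1 + I • toC N) *ᵥ a) := by
      rw [one_add_smul_mulVec]; module
    rw [this]
    exact Submodule.smul_mem _ _ (Submodule.mem_sup_left (Submodule.mem_sup_right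
      (mulVec_mem_mapSub _ ha)))

/-- The homomorphism `ρ`. -/
def rho (hP : IsNplus Q N F P) (h : MixedHodge Q N F) :
    Matrix.SpecialLinearGroup (Fin 2) ℂ →* Matrix ι ι ℂ where
  toFun g := rep (toC N) (toC P) g
  map_one' := by rw [Matrix.SpecialLinearGroup.coe_one, rep_one]
  map_mul' g g' := by rw [Matrix.SpecialLinearGroup.coe_mul, rep_mul (hP.isUnitPair h)]

theorem continuous_rho (hP : IsNplus Q N F P) (h : MixedHodge Q N F) :
    Continuous (hP.rho h) := by
  have hc : ∀ i j, Continuous fun g : Matrix.SpecialLinearGroup (Fin 2) ℂ => g i j := fun i j =>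
    (continuous_apply j).comp ((continuous_apply i).comp continuous_subtype_val)
  have h00 := hc 0 0
  have h01 := hc 0 1
  have h10 := hc 1 0
  have h11 := hc 1 1
  change Continuous fun g : Matrix.SpecialLinearGroup (Fin 2) ℂ => rep (toC N) (toC P) g
  unfold rep
  fun_prop

theorem rho_real (hP : IsNplus Q N F P) (h : MixedHodge Q N F)
    (g : Matrix.SpecialLinearGroup (Fin 2) ℂ) :
    hP.rho h (Matrix.SpecialLinearGroup.map (starRingEnd ℂ) g) =
      (hP.rho h g).map (starRingEnd ℂ) := by
  change rep _ _ _ = (rep _ _ _).map _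
  have hmul : ∀ A B : Matrix ι ι ℝ, (toC A * toC B).map (starRingEnd ℂ) = toC A * toC B := by
    intro A B
    rw [← toC_mul, toC_map_conj]
  have hs : ∀ (c : ℂ) (A : Matrix ι ι ℂ), (c • A).map (starRingEnd ℂ) =
      (starRingEnd ℂ) c • A.map (starRingEnd ℂ) := by
    intro c A; ext i j; simp
  have ha : ∀ (A B : Matrix ι ι ℂ), (A + B).map (starRingEnd ℂ) =
      A.map (starRingEnd ℂ) + B.map (starRingEnd ℂ) := by
    intro A B; ext i j; simp
  have hb : ∀ (A B : Matrix ι ι ℂ), (A - B).map (starRingEnd ℂ) =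
      A.map (starRingEnd ℂ) - B.map (starRingEnd ℂ) := by
    intro A B; ext i j; simp
  have h1 : (1 : Matrix ι ι ℂ).map (starRingEnd ℂ) = 1 := by
    rw [← toC_one, toC_map_conj]
  simp only [rep, ha, hb, hs, hmul, toC_map_conj, h1]
  simp

end IsNplus

namespace SplitHodge

variable {Q : Matrix ι ι ℤ} {N P : Matrix ι ι ℝ} {F : Filt ι}

theorem rep_sectionSL (z : ℂ) : rep (toC N) (toC P) (sectionSL (z : OnePoint ℂ)) =
    1 + z • toC N := by
  rw [sectionSL_coe]
  simp [rep]
  abel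

end SplitHodge

theorem exp_smul_lower (z : ℂ) :
    (sectionSL (z : OnePoint ℂ) : Matrix (Fin 2) (Fin 2) ℂ) =
      NormedSpace.exp (z • !![0, 1; 0, 0]) := by
  rw [sectionSL_coe, exp_eq_one_add (by ext i j; fin_cases i <;> fin_cases j <;> simp)]
  ext i j
  fin_cases i <;> fin_cases j <;> simp

theorem toGL_sectionSL_smul_zero (z : ℂ) :
    Matrix.SpecialLinearGroup.toGL (sectionSL (z : OnePoint ℂ)) • ((0 : ℂ) : OnePoint ℂ) =
      (z : OnePoint ℂ) := by
  rw [OnePoint.smul_some_eq_ite]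
  simp

/-- The `SL(2)`-orbit through an `ℝ`-split limiting mixed Hodge structure. -/
theorem MixedHodge.nonempty_SL2Data {Q : Matrix ι ι ℤ} {N : Matrix ι ι ℝ} {F : Filt ι}
    (h : MixedHodge Q N F) {e : ℤ} (he : IsType e N F) {d : ℤ →₀ ℕ} (hF : F ∈ CompactDual Q d) :
    Nonempty (SL2Data Q d N F) := by
  obtain ⟨δ, hδ, hL, hs⟩ := h.exists_splitting
  have hexp : NormedSpace.exp (-(I • toC δ)) = 1 + -(I • toC δ) :=
    exp_eq_one_add (hL.sq h.toMonodromyFilt)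
  have hS : SplitHodge Q N (act (1 + -(I • toC δ)) F) := ⟨hL.mixedHodge_act h, hs⟩
  have heS : IsType e N (act (1 + -(I • toC δ)) F) := fun p hp =>
    hL.deligne_zero_act_eq_bot h (he p hp)
  have hFS : act (1 + -(I • toC δ)) F ∈ CompactDual Q d :=
    act_mem_CompactDual h.alt h.nondeg hF (hL.one_add_mem_GC h.toMonodromyFilt)
  obtain ⟨P, hP⟩ := hS.exists_isNplus
  have hM := hS.toMixedHodge
  have hrG : ∀ g : Matrix.SpecialLinearGroup (Fin 2) ℂ, rep (toC N) (toC P) g ∈ GC Q :=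
    fun g => rep_mem_GC (hP.isUnitPair hM) (mem_LieG_iff.1 h.lie) (mem_LieG_iff.1 hP.lie) g
  have hdiff := hasDifferential_rep (hP.isUnitPair hM) (ρ := hP.rho hM) (fun _ => rfl)
  have hbase : act (rep (toC N) (toC P) (sectionSL ((I : ℂ) : OnePoint ℂ)))
      (act (1 + -(I • toC δ)) F) = act (1 + I • toC N) (act (1 + -(I • toC δ)) F) := by
    rw [SplitHodge.rep_sectionSL]
  have hD : act (1 + I • toC N) (act (1 + -(I • toC δ)) F) ∈ PeriodDomain Q d := by
    apply hS.base_mem_PeriodDomain heS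
    rw [← hbase]
    exact act_mem_CompactDual h.alt h.nondeg hFS (hrG _)
  refine ⟨{
    δ := δ
    δ_mem := hδ
    lmhs := by rw [hexp]; exact hS.lmhs
    split := by rw [hexp]; exact hs
    ρ := hP.rho hM
    ρ_mem := hrG
    ρ_cont := hP.continuous_rho hM
    ρ_real := hP.rho_real hM
    φ := fun z => act (rep (toC N) (toC P) (sectionSL z)) (act (1 + -(I • toC δ)) F)
    φ_mem := fun z => act_mem_CompactDual h.alt h.nondeg hFS (hrG _)
    equivariant := ?_
    φ_zero := ?_
    Nplus := P
    Y := P * N - N * P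
    Nplus_mem := hP.lie
    Y_mem := hP.Y_mem hM
    diff_minus := hdiff.1
    diff_h := ?_
    diff_plus := hdiff.2.1
    Y_eigen := ?_
    morph_minus := ?_
    morph_zero := ?_
    morph_plus := ?_ }⟩
  · intro g z
    have h1 := hP.act_rep hM _ (sectionSL_smul g z)
    have h2 : rep (toC N) (toC P) g * rep (toC N) (toC P) (sectionSL z) =
        rep (toC N) (toC P) (sectionSL (Matrix.SpecialLinearGroup.toGL g • z)) *
        rep (toC N) (toC P) ((sectionSL (Matrix.SpecialLinearGroup.toGL g • z))⁻¹ * g *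
          sectionSL z : Matrix.SpecialLinearGroup (Fin 2) ℂ) := by
      rw [← rep_mul (hP.isUnitPair hM), ← rep_mul (hP.isUnitPair hM),
        ← Matrix.SpecialLinearGroup.coe_mul, ← Matrix.SpecialLinearGroup.coe_mul, mul_assoc,
        mul_inv_cancel_left]
    change act (rep (toC N) (toC P) g) _ = _
    rw [← act_mul, h2, act_mul, h1]
  · rw [hexp, SplitHodge.rep_sectionSL, zero_smul, add_zero, act_one]
  · have := hdiff.2.2
    rwa [← toC_mul, ← toC_mul, ← toC_sub] at this
  · rw [hexp]
    exact hP.Y_eigen hM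
  · intro p
    rw [hbase, hS.hodge_base hD, hS.hodge_base hD]
    exact hP.mapSub_lowerOp_basePiece hM p
  · intro p
    rw [hbase, hS.hodge_base hD]
    exact hP.mapSub_sub_basePiece hM p
  · intro p
    rw [hbase, hS.hodge_base hD, hS.hodge_base hD]
    exact hP.mapSub_raise_basePiece hM p

/-- Matrices that agree on all Hodge components are equal. -/
theorem matrix_ext_hodge {Q : Matrix ι ι ℤ} (hQ : Qᵀ = -Q) (hQ' : Q.det ≠ 0) {d : ℤ →₀ ℕ}
    {F : Filt ι} (hF : F ∈ PeriodDomain Q d) {A B : Matrix ι ι ℂ}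
    (hAB : ∀ p, ∀ x ∈ hodge F p, A *ᵥ x = B *ᵥ x) : A = B := by
  have h1 : ∀ e, hodgePar e F ≤ LinearMap.ker (toLin' (A - B)) := by
    intro e
    refine iSup₂_le fun p _ x hx => ?_
    rw [LinearMap.mem_ker, toLin'_apply, sub_mulVec, hAB p x hx, sub_self]
  have h2 : (⊤ : Submodule ℂ (ι → ℂ)) ≤ LinearMap.ker (toLin' (A - B)) := by
    rw [← hodgePar_sup hQ hQ' hF 0]
    exact sup_le (h1 _) (h1 _)
  apply Matrix.ext_of_mulVec_single
  intro i
  have h3 : Pi.single i 1 ∈ LinearMap.ker (toLin' (A - B)) := h2 trivial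
  rwa [LinearMap.mem_ker, toLin'_apply, sub_mulVec, sub_eq_zero] at h3

/-- Any data of the `SL(2)`-orbit arise from the operator `N⁺` of the splitting `F'` given by their
element `δ`. The eigenvalues determine `Y`, and `N⁺` is determined by the Hodge types of `ρ_*`. -/
theorem SL2Data.exists_isNplus {Q : Matrix ι ι ℤ} {N : Matrix ι ι ℝ} {F : Filt ι} {d : ℤ →₀ ℕ}
    (D : SL2Data Q d N F) (h : MixedHodge Q N F) {e : ℤ} (he : IsType e N F) :
    ∃ F' P, F' ∈ CompactDual Q d ∧ SplitHodge Q N F' ∧ IsType e N F' ∧ IsNplus Q N F' P ∧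
      (∀ p, deligne N F' p (-p - 1) = deligne N F p (-p - 1)) ∧
      D.basePoint = act (1 + I • toC N) F' ∧ D.basePoint ∈ PeriodDomain Q d ∧
      D.X = (1 / 2 : ℂ) • lowerOp N P := by
  have hL := h.isLowering_of_mem_LMinus D.δ_mem
  have hexp : NormedSpace.exp (-(I • toC D.δ)) = 1 + -(I • toC D.δ) :=
    exp_eq_one_add (hL.sq h.toMonodromyFilt)
  have hS : SplitHodge Q N (act (1 + -(I • toC D.δ)) F) :=
    ⟨hL.mixedHodge_act h, by rw [← hexp]; exact D.split⟩
  have heS : IsType e N (act (1 + -(I • toC D.δ)) F) := fun p hp =>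
    hL.deligne_zero_act_eq_bot h (he p hp)
  obtain ⟨P, hP⟩ := hS.exists_isNplus
  have hM := hS.toMixedHodge
  have hbase : D.basePoint = act (1 + I • toC N) (act (1 + -(I • toC D.δ)) F) := by
    have h1 := D.equivariant (sectionSL (I : OnePoint ℂ)) ((0 : ℂ) : OnePoint ℂ)
    rw [toGL_sectionSL_smul_zero, D.φ_zero, hexp, D.diff_minus I _ (exp_smul_lower I),
      exp_smul_toC h.sq] at h1
    exact h1.symm
  have hD : D.basePoint ∈ PeriodDomain Q d := by
    rw [hbase]
    apply hS.base_mem_PeriodDomain heS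
    rw [← hbase]
    exact D.φ_mem _
  have hD' : act (1 + I • toC N) (act (1 + -(I • toC D.δ)) F) ∈ PeriodDomain Q d := by
    rwa [← hbase]
  have hY : toC D.Y = toC (P * N - N * P) := by
    have hYe := D.Y_eigen
    rw [hexp] at hYe
    have h0 : ∀ a ∈ deligneZero N (act (1 + -(I • toC D.δ)) F), toC D.Y *ᵥ a = a := by
      have hle : deligneZero N (act (1 + -(I • toC D.δ)) F) ≤
          LinearMap.ker (toLin' (toC D.Y - 1)) := by
        refine iSup_le fun p a ha => ?_
        rw [LinearMap.mem_ker, toLin'_apply, sub_mulVec, one_mulVec, hYe p (-p) a ha]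
        simp
      intro a ha
      have := hle ha
      rwa [LinearMap.mem_ker, toLin'_apply, sub_mulVec, one_mulVec, sub_eq_zero] at this
    have h1 : deligneOne N (act (1 + -(I • toC D.δ)) F) ≤ LinearMap.ker (toLin' (toC D.Y)) := by
      refine iSup_le fun p b hb => ?_
      rw [LinearMap.mem_ker, toLin'_apply, hYe p (-p - 1) b hb, show p + (-p - 1) + 1 = 0 by ring]
      simp
    have h2 : deligneZero N (act (1 + -(I • toC D.δ)) F) ≤
        LinearMap.ker (toLin' (toC D.Y * toC N + toC N)) := by
      refine iSup_le fun p a ha => ?_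
      rw [LinearMap.mem_ker, toLin'_apply, add_mulVec, ← mulVec_mulVec,
        hYe (p - 1) (-p - 1) _ (hM.N_mulVec_mem_deligne ha), show p - 1 + (-p - 1) + 1 = -1 by ring]
      simp
    apply hM.matrix_ext
    · intro a ha
      rw [h0 a ha, hP.Y_zero ha]
    · intro b hb
      have := h1 hb
      rw [LinearMap.mem_ker, toLin'_apply] at this
      rw [this, hP.Y_one hb]
    · intro a ha
      have := h2 ha
      rw [LinearMap.mem_ker, toLin'_apply, add_mulVec, ← mulVec_mulVec] at this
      rw [hP.Y_two hM ha]
      exact eq_neg_of_add_eq_zero_left this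
  have hN : toC D.Nplus = toC P := by
    apply matrix_ext_hodge h.alt h.nondeg hD
    intro p x hx
    -- the difference of both operators is of type `(-1,1)` as well as `(0,0)`
    have h1 := mapSub_le.1 (D.morph_minus p) x hx
    have h2 := mapSub_le.1 (D.morph_zero p) x hx
    have hx' : x ∈ basePiece N (act (1 + -(I • toC D.δ)) F) p := by
      rwa [← hS.hodge_base hD', ← hbase]
    have h3 := mapSub_le.1 (hP.mapSub_lowerOp_basePiece hM p) x hx'
    have h4 := mapSub_le.1 (hP.mapSub_sub_basePiece hM p) x hx'
    rw [← hS.hodge_base hD', ← hbase] at h3 h4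
    have h5 := Submodule.smul_mem _ (-I) (Submodule.sub_mem _ h1 h3)
    have h6 := Submodule.sub_mem _ h4 h2
    have e5 : (-I) • ((I • toC N - toC D.Y + I • toC D.Nplus) *ᵥ x - lowerOp N P *ᵥ x) =
        toC D.Nplus *ᵥ x - toC P *ᵥ x := by
      rw [hY, lowerOp]
      simp only [add_mulVec, sub_mulVec, smul_mulVec]
      rw [add_sub_add_left_eq_sub, ← smul_sub, smul_smul, neg_mul, I_mul_I, neg_neg, one_smul]
    have e6 : (toC N - toC P) *ᵥ x - (toC N - toC D.Nplus) *ᵥ x =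
        toC D.Nplus *ᵥ x - toC P *ᵥ x := by
      simp only [sub_mulVec]
      abel
    rw [e5] at h5
    rw [e6] at h6
    rw [← sub_eq_zero]
    apply Submodule.disjoint_def.1 (hD.2.1 p).disjoint _ h6.1
    rw [show -p = -(p - 1) - 1 by ring]
    exact h5.2
  have hF' : act (1 + -(I • toC D.δ)) F ∈ CompactDual Q d := by
    rw [← hexp, ← D.φ_zero]
    exact D.φ_mem _
  refine ⟨_, P, hF', hS, heS, hP, fun p => hL.deligne_act_neg_one h.toMonodromyFilt (by omega),
    hbase,
    hD, ?_⟩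
  rw [SL2Data.X, hY, hN, lowerOp]

/-! ### The closures of the cycle space and of the Siegel spaces -/

theorem continuous_orbitMap (Q : Matrix ι ι ℤ) (d : ℤ →₀ ℕ) (F : PeriodDomain Q d) :
    Continuous (orbitMap Q d F) :=
  continuous_iff_coinduced_le.2 (le_iSup
    (fun F : PeriodDomain Q d => TopologicalSpace.coinduced (orbitMap Q d F) inferInstance) F)

theorem mem_closure_of_path {X : Type*} [TopologicalSpace X] {S : Set X} {f : ℝ → X}
    (hf : Continuous f) (hS : ∀ t, 0 ≤ t → t < 1 → f t ∈ S) : f 1 ∈ closure S := by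
  have h1 : (1 : ℝ) ∈ closure (Set.Ico (0 : ℝ) 1) := by
    rw [closure_Ico (by norm_num)]; simp
  exact map_mem_closure hf h1 fun t ht => hS t ht.1 ht.2

/-- The limit of a path of cycles in `D`, for a path in `G_ℂ`. -/
theorem translate_mem_CycClosure {Q : Matrix ι ι ℤ} {d : ℤ →₀ ℕ} {F : Filt ι}
    (hF : F ∈ PeriodDomain Q d) {g : ℝ → Matrix ι ι ℂ} (hg : Continuous g) (hG : ∀ t, g t ∈ GC Q)
    (hD : ∀ t, 0 ≤ t → t < 1 → translate (g t) (baseCycle Q F) ⊆ PeriodDomain Q d) :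
    translate (g 1) (baseCycle Q F) ∈ CycClosure Q d :=
  ⟨_, mem_closure_of_path (f := fun t => orbitMap Q d ⟨F, hF⟩ ⟨g t, hG t⟩)
    ((continuous_orbitMap Q d _).comp (hg.subtype_mk hG)) hD, rfl⟩

theorem mapSub_mem_Lagr {Q : Matrix ι ι ℤ} (hQ' : Q.det ≠ 0) {V : Submodule ℂ (ι → ℂ)}
    (hV : V ∈ Lagr Q) {g : Matrix ι ι ℂ} (hg : g ∈ GC Q) : mapSub g V ∈ Lagr Q := by
  have hinj : Function.Injective (toLin' g) :=
    Matrix.mulVec_injective_iff_isUnit.2 (isUnit_of_mem_GC hQ' hg)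
  refine ⟨?_, fun x hx y hy => ?_⟩
  · rw [← hV.1]
    exact congrArg _ (Submodule.equivMapOfInjective _ hinj _).finrank_eq.symm
  · obtain ⟨v, hv, rfl⟩ := mem_mapSub.1 hx
    obtain ⟨w, hw, rfl⟩ := mem_mapSub.1 hy
    rw [mem_GC_iff.1 hg]
    exact hV.2 v hv w hw

/-- The limit of a path of Lagrangian subspaces. The path is lifted to a path of frames, the image
of a fixed basis. -/
theorem mapSub_mem_closure {Q : Matrix ι ι ℤ} (hQ' : Q.det ≠ 0) {V : Submodule ℂ (ι → ℂ)}
    (hV : V ∈ Lagr Q) {g : ℝ → Matrix ι ι ℂ} (hg : Continuous g) (hG : ∀ t, g t ∈ GC Q)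
    {S : Set (Lagr Q)}
    (hS : ∀ t, 0 ≤ t → t < 1 → (⟨mapSub (g t) V, mapSub_mem_Lagr hQ' hV (hG t)⟩ : Lagr Q) ∈ S) :
    mapSub (g 1) V ∈ Subtype.val '' closure S := by
  have hfr : Module.finrank ℂ V = Fintype.card ι / 2 := by have := hV.1; omega
  let b := Module.finBasisOfFinrankEq ℂ V hfr
  have hspan : ∀ t, Submodule.span ℂ (Set.range fun i => g t *ᵥ (b i : ι → ℂ)) =
      mapSub (g t) V := by
    intro t
    have h1 : (Set.range fun i => g t *ᵥ (b i : ι → ℂ)) =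
        toLin' (g t) '' (Subtype.val '' Set.range b) := by
      rw [← Set.range_comp, ← Set.range_comp]; rfl
    have h2 : Submodule.span ℂ (Subtype.val '' Set.range b) = V := by
      have := Submodule.map_span V.subtype (Set.range b)
      rw [b.span_eq, Submodule.map_subtype_top] at this
      exact this.symm
    rw [h1, ← Submodule.map_span, h2]; rfl
  have hfrm : ∀ t, (fun i => g t *ᵥ (b i : ι → ℂ)) ∈ LagrFrame Q := by
    intro t
    refine ⟨?_, by rw [hspan]; exact mapSub_mem_Lagr hQ' hV (hG t)⟩
    have hinj : Function.Injective (toLin' (g t)) :=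
      Matrix.mulVec_injective_iff_isUnit.2 (isUnit_of_mem_GC hQ' (hG t))
    have h1 : LinearIndependent ℂ fun i => (b i : ι → ℂ) :=
      b.linearIndependent.map' V.subtype (Submodule.ker_subtype V)
    exact h1.map' (toLin' (g t)) (LinearMap.ker_eq_bot.2 hinj)
  have hc : Continuous fun t => frameSpan Q ⟨_, hfrm t⟩ := by
    have h1 : Continuous (frameSpan Q) := continuous_coinduced_rng
    refine h1.comp (Continuous.subtype_mk ?_ hfrm)
    exact continuous_pi fun i => hg.matrix_mulVec continuous_const
  have heq : ∀ t, frameSpan Q ⟨_, hfrm t⟩ =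
      (⟨mapSub (g t) V, mapSub_mem_Lagr hQ' hV (hG t)⟩ : Lagr Q) :=
    fun t => Subtype.ext (hspan t)
  refine ⟨_, mem_closure_of_path hc fun t h0 h1 => ?_, hspan 1⟩
  rw [heq]
  exact hS t h0 h1

theorem hodgePar_mem_Lagr {Q : Matrix ι ι ℤ} (hQ : Qᵀ = -Q) (hQ' : Q.det ≠ 0) {d : ℤ →₀ ℕ}
    {F : Filt ι} (hF : F ∈ PeriodDomain Q d) (e : ℤ) : hodgePar e F ∈ Lagr Q := by
  have hd := CompactDual.dualFilt hQ hQ' hF.1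
  refine ⟨?_, fun x hx y hy => hodgePar_isotropic hd hx hy⟩
  -- the form identifies either of the two Lagrangian subspaces with the dual of the other one
  have key : ∀ V W : Submodule ℂ (ι → ℂ), V ⊔ W = ⊤ → (∀ x ∈ W, ∀ y ∈ W, form Q x y = 0) →
      Module.finrank ℂ W ≤ Module.finrank ℂ V := by
    intro V W hVW hW
    rw [← Subspace.dual_finrank_eq (K := ℂ) (V := V)]
    refine LinearMap.finrank_le_finrank_of_injective
      (f := (LinearMap.lcomp ℂ ℂ V.subtype).comp ((formL Q).domRestrict W)) ?_
    rw [injective_iff_map_eq_zero]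
    rintro ⟨x, hx⟩ h0
    apply Subtype.ext
    apply form_nondeg hQ'
    intro y
    have hy : y ∈ V ⊔ W := by rw [hVW]; trivial
    obtain ⟨v, hv, w, hw, rfl⟩ := Submodule.mem_sup.1 hy
    have := LinearMap.congr_fun h0 ⟨v, hv⟩
    simp only [LinearMap.comp_apply, LinearMap.lcomp_apply, LinearMap.domRestrict_apply,
      Submodule.subtype_apply, formL_apply, LinearMap.zero_apply] at this
    rw [form_add_right, hW x hx w hw, this, add_zero]
  have hsup := hodgePar_sup hQ hQ' hF e
  have h1 := key _ _ hsup fun x hx y hy => hodgePar_isotropic hd hx hy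
  have h2 := key _ _ ((sup_comm _ _).trans hsup) fun x hx y hy => hodgePar_isotropic hd hx hy
  have hinf : hodgePar e F ⊓ hodgePar (e + 1) F = ⊥ := by
    rw [eq_bot_iff]
    rintro x ⟨hx1, hx2⟩
    by_contra hx0
    exact lt_asymm (isPos_hodgePar hQ hQ' hF e x hx1 hx0)
      (isPos_succ_iff.1 (isPos_hodgePar hQ hQ' hF (e + 1)) x hx2 hx0)
  have h3 := Submodule.finrank_sup_add_finrank_inf_eq (hodgePar e F) (hodgePar (e + 1) F)
  rw [hsup, hinf, finrank_top, finrank_bot, Module.finrank_fintype_fun_eq_card] at h3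
  omega

namespace IsNplus

variable {Q : Matrix ι ι ℤ} {N P : Matrix ι ι ℝ} {F : Filt ι}

/-- The path `exp(tX)V`, which joins `V` to `B_e ⊕ Im N`. -/
theorem mapSub_lower_sup (hP : IsNplus Q N F P) (h : MixedHodge Q N F) (e : ℤ) (t : ℝ) :
    mapSub (1 + (t : ℂ) • (1 / 2 : ℂ) • lowerOp N P)
        (deligneOnePar e N F ⊔ mapSub (1 + I • toC N) (deligneZero N F)) =
      deligneOnePar e N F ⊔
        mapSub ((1 - t : ℂ) • 1 + (I * (1 + t) : ℂ) • toC N) (deligneZero N F) := by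
  have h1 : mapSub (1 + (t : ℂ) • (1 / 2 : ℂ) • lowerOp N P) (deligneOnePar e N F) =
      deligneOnePar e N F := by
    have key : ∀ b ∈ deligneOnePar e N F,
        (1 + (t : ℂ) • (1 / 2 : ℂ) • lowerOp N P) *ᵥ b = b := by
      intro b hb
      rw [one_add_smul_mulVec, smul_mulVec, hP.lowerOp_one (deligneOnePar_le _ _ _ hb), smul_zero,
        smul_zero, add_zero]
    refine le_antisymm (mapSub_le.2 fun b hb => by rwa [key b hb]) fun b hb => ?_
    exact mem_mapSub.2 ⟨b, hb, key b hb⟩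
  have h2 : mapSub (1 + (t : ℂ) • (1 / 2 : ℂ) • lowerOp N P)
      (mapSub (1 + I • toC N) (deligneZero N F)) =
      mapSub ((1 - t : ℂ) • 1 + (I * (1 + t) : ℂ) • toC N) (deligneZero N F) := by
    have key : ∀ a ∈ deligneZero N F,
        (1 + (t : ℂ) • (1 / 2 : ℂ) • lowerOp N P) *ᵥ ((1 + I • toC N) *ᵥ a) =
          ((1 - t : ℂ) • 1 + (I * (1 + t) : ℂ) • toC N) *ᵥ a := by
      intro a ha
      rw [one_add_smul_mulVec, smul_mulVec, hP.lowerOp_plus h ha, one_add_smul_mulVec,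
        one_add_smul_mulVec, add_mulVec, smul_mulVec, smul_mulVec, one_mulVec]
      module
    ext x
    rw [mem_mapSub, mem_mapSub]
    constructor
    · rintro ⟨y, hy, rfl⟩
      obtain ⟨a, ha, rfl⟩ := mem_mapSub.1 hy
      exact ⟨a, ha, (key a ha).symm⟩
    · rintro ⟨a, ha, rfl⟩
      exact ⟨_, mulVec_mem_mapSub _ ha, key a ha⟩
  rw [← h1, ← h2]
  conv_lhs => rw [h1]
  exact Submodule.map_sup _ _ _

/-- The path `exp(tX)W` is constant. -/
theorem mapSub_lower_sup_right (hP : IsNplus Q N F P) (h : MixedHodge Q N F) (e : ℤ) (t : ℝ) :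
    mapSub (1 + (t : ℂ) • (1 / 2 : ℂ) • lowerOp N P)
        (deligneOnePar e N F ⊔ mapSub (1 + (-I) • toC N) (deligneZero N F)) =
      deligneOnePar e N F ⊔ mapSub (1 + (-I) • toC N) (deligneZero N F) := by
  have key : ∀ x ∈ deligneOnePar e N F ⊔ mapSub (1 + (-I) • toC N) (deligneZero N F),
      (1 + (t : ℂ) • (1 / 2 : ℂ) • lowerOp N P) *ᵥ x = x := by
    intro x hx
    obtain ⟨b, hb, y, hy, rfl⟩ := Submodule.mem_sup.1 hx
    obtain ⟨a, ha, rfl⟩ := mem_mapSub.1 hy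
    rw [one_add_smul_mulVec, smul_mulVec, mulVec_add, hP.lowerOp_one (deligneOnePar_le _ _ _ hb),
      hP.lowerOp_minus h ha, add_zero, smul_zero, smul_zero, add_zero]
  exact le_antisymm (mapSub_le.2 fun b hb => by rwa [key b hb]) fun b hb =>
    mem_mapSub.2 ⟨b, hb, key b hb⟩

end IsNplus

theorem IsNplus.lowerOp_eq_zero {Q : Matrix ι ι ℤ} {N P : Matrix ι ι ℝ} {F : Filt ι}
    (hP : IsNplus Q N F P) (h : MixedHodge Q N F) (h0 : deligneZero N F = ⊥) :
    lowerOp N P = 0 := by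
  apply h.matrix_ext
  · intro a ha
    rw [h0, Submodule.mem_bot] at ha
    rw [ha, mulVec_zero, mulVec_zero]
  · intro b hb
    rw [hP.lowerOp_one hb, zero_mulVec]
  · intro a ha
    rw [h0, Submodule.mem_bot] at ha
    rw [ha, mulVec_zero, mulVec_zero, mulVec_zero]

/-- If `h^{p,-p-1} = 0`, then `F` does not jump at `p`. -/
theorem CompactDual.eq_of_eq_zero {Q : Matrix ι ι ℤ} {d : ℤ →₀ ℕ} {F : Filt ι}
    (hF : F ∈ CompactDual Q d) {p : ℤ} (hp : d p = 0) : F p = F (p + 1) := by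
  refine (Submodule.eq_of_le_of_finrank_eq (hF.1 (by omega)) ?_).symm
  rw [hF.2.1, hF.2.1]
  congr 1
  ext r
  simp only [Finset.mem_filter, Finsupp.mem_support_iff]
  refine and_congr_right fun hr => ⟨fun h => by omega, fun h => ?_⟩
  rcases h.lt_or_eq with h | rfl
  · omega
  · exact absurd hp hr

theorem MixedHodge.deligne_zero_eq_bot {Q : Matrix ι ι ℤ} {N : Matrix ι ι ℝ} {F : Filt ι}
    (h : MixedHodge Q N F) {d : ℤ →₀ ℕ} (hF : F ∈ CompactDual Q d) {p : ℤ} (hp : d p = 0) :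
    deligne N F p (-p) = ⊥ := by
  rw [eq_bot_iff]
  intro x hx
  apply h.deligne_zero_ker (add_neg_cancel p) hx
  have h1 := deligne_le N F p (-p) hx
  rw [CompactDual.eq_of_eq_zero hF hp] at h1
  obtain ⟨-, c, hc, w, -, hxc⟩ := (mem_deligne_zero (add_neg_cancel p)).1 hx
  refine h.gr_zero_inf h1 (c := c) (by rwa [show 1 - (p + 1) = -p by ring]) ?_
  rw [hxc, conjVec_add, conjVec_toC_mulVec, mulVec_add, toC_mulVec_mulVec_eq_zero h.sq, add_zero]

/-- If the parity `e` does not occur in `F^0`, then `I^{p,-p} = 0` for `p ≥ 0`, as the type of the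
orbit excludes the other parity, and then also for `p ≤ 0`, by conjugation. -/
theorem SplitHodge.deligneZero_eq_bot {Q : Matrix ι ι ℤ} {N : Matrix ι ι ℝ} {F : Filt ι}
    (h : SplitHodge Q N F) {d : ℤ →₀ ℕ} (hF : F ∈ CompactDual Q d) {e : ℤ} (he : IsType e N F)
    (hd : ∀ p, 0 ≤ p → Even (p + e) → d p = 0) : deligneZero N F = ⊥ := by
  have key : ∀ p, 0 ≤ p → deligne N F p (-p) = ⊥ := by
    intro p hp
    rcases Int.even_or_odd (p + e) with h1 | h1
    · exact h.deligne_zero_eq_bot hF (hd p hp h1)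
    · exact he p h1
  rw [deligneZero, eq_bot_iff]
  refine iSup_le fun p => ?_
  rcases le_total 0 p with hp | hp
  · exact (key p hp).le
  · intro x hx
    have h1 := h.conj_mem_deligne hx
    have h2 := key (-p) (by omega)
    rw [neg_neg] at h2
    rw [h2, Submodule.mem_bot, conjVec_eq_zero] at h1
    rw [h1]
    exact Submodule.zero_mem _

theorem MixedHodge.mapSub_deligneZero {Q : Matrix ι ι ℤ} {N : Matrix ι ι ℝ} {F : Filt ι}
    (h : MixedHodge Q N F) :
    mapSub (toC N) (deligneZero N F) = LinearMap.range (toLin' (toC N)) := by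
  apply le_antisymm
  · rw [mapSub_le]
    exact fun x _ => ⟨x, toLin'_apply _ _⟩
  · rintro _ ⟨x, rfl⟩
    obtain ⟨a, ha, b, hb, a', ha', rfl⟩ := h.exists_decomp x
    rw [toLin'_apply, mulVec_add, mulVec_add, toC_mulVec_mulVec_eq_zero h.sq,
      MixedHodge.deligneOne_ker N F hb, add_zero, add_zero]
    exact mulVec_mem_mapSub _ ha

/-- The boundary cycle lies in the closure of the cycle space, and the associated Lagrangian
subspace in the closure of a Siegel space. The vanishing condition under which `g = 1` is the case
in which the cycle does not determine `gV`. -/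
theorem SL2Data.boundary {Q : Matrix ι ι ℤ} {N : Matrix ι ι ℝ} {F : Filt ι} {d : ℤ →₀ ℕ}
    (D : SL2Data Q d N F) (h : MixedHodge Q N F) {e : ℤ} (he : IsType e N F) :
    ∃ g ∈ GC Q, D.boundaryCycle = translate g (baseCycle Q D.basePoint) ∧
      ((∀ p, 0 ≤ p → Even (p + e) → d p = 0) → g = 1) ∧
      D.basePoint ∈ PeriodDomain Q d ∧ D.boundaryCycle ∈ CycClosure Q d ∧
      mapSub g (hodgePar e D.basePoint) =
        deligneOnePar e N F ⊔ LinearMap.range (toLin' (toC N)) ∧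
      ∀ S : Set (Lagr Q), (∀ V : Lagr Q, IsPos Q e V.1 → V ∈ S) →
        mapSub g (hodgePar e D.basePoint) ∈ Subtype.val '' closure S := by
  obtain ⟨F', P, hF', hS, heS, hP, hone, hbase, hD, hX⟩ := D.exists_isNplus h he
  have hM := hS.toMixedHodge
  have hsq : ∀ c : ℂ, (c • D.X) * (c • D.X) = 0 := fun c => by
    rw [hX, smul_mul_smul_comm, smul_mul_smul_comm, hP.lowerOp_sq hM, smul_zero, smul_zero]
  have hskew : ∀ (c : ℂ) x y, form Q ((c • D.X) *ᵥ x) y = -form Q x ((c • D.X) *ᵥ y) := by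
    intro c x y
    rw [hX]
    simp only [smul_mulVec, form_smul_left, form_smul_right, hP.lowerOp_skew hM]
    ring
  have hG : ∀ t : ℝ, 1 + (t : ℂ) • D.X ∈ GC Q := fun t => one_add_mem_GC (hsq t) (hskew t)
  have hc : Continuous fun t : ℝ => 1 + (t : ℂ) • D.X := by fun_prop
  have hexp : NormedSpace.exp D.X = 1 + ((1 : ℝ) : ℂ) • D.X := by
    rw [exp_eq_one_add (by simpa using hsq 1), ofReal_one, one_smul]
  have hVt : ∀ t : ℝ, mapSub (1 + (t : ℂ) • D.X) (hodgePar e D.basePoint) =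
      deligneOnePar e N F' ⊔
        mapSub ((1 - t : ℂ) • 1 + (I * (1 + t) : ℂ) • toC N) (deligneZero N F') := by
    intro t
    rw [hX, hbase, (hS.hodgePar_base heS (by rwa [← hbase])).1, hP.mapSub_lower_sup hM]
  have hWt : ∀ t : ℝ, mapSub (1 + (t : ℂ) • D.X) (hodgePar (e + 1) D.basePoint) =
      deligneOnePar (e + 1) N F' ⊔ mapSub (1 + (-I) • toC N) (deligneZero N F') := by
    intro t
    rw [hX, hbase, (hS.hodgePar_base heS (by rwa [← hbase])).2, hP.mapSub_lower_sup_right hM]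
  have hpos : ∀ t : ℝ, 0 ≤ t → t < 1 →
      IsPos Q e (mapSub (1 + (t : ℂ) • D.X) (hodgePar e D.basePoint)) := by
    intro t h0 h1
    rw [hVt]
    refine hS.isPos_sup heS (r := 2 * ((1 - t) * (1 + t)))
      (mul_pos two_pos (mul_pos (by linarith) (by linarith))) ?_
    rw [zpow_I_two_mul_add_one]
    simp only [map_mul, map_sub, map_add, map_one, conj_I, conj_ofReal]
    push_cast
    linear_combination (-2 * I ^ (2 * e) * (1 - t) * (1 + t)) * I_mul_I
  refine ⟨1 + ((1 : ℝ) : ℂ) • D.X, hG 1, by rw [SL2Data.boundaryCycle, hexp], ?_, hD, ?_, ?_, ?_⟩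
  · intro hd
    rw [hX, hP.lowerOp_eq_zero hM (hS.deligneZero_eq_bot hF' heS hd), smul_zero, smul_zero,
      add_zero]
  · rw [SL2Data.boundaryCycle, hexp]
    refine translate_mem_CycClosure (g := fun t : ℝ => 1 + (t : ℂ) • D.X) hD hc hG
      fun t h0 h1 => ?_
    refine translate_baseCycle_subset h.alt h.nondeg hD (hG t) (hpos t h0 h1) ?_
    rw [hWt]
    exact hS.isPos_base_right heS
  · have h1 : deligneOnePar e N F' = deligneOnePar e N F := by simp only [deligneOnePar, hone]
    have h2 : mapSub ((1 - (1 : ℝ) : ℂ) • 1 + (I * (1 + (1 : ℝ)) : ℂ) • toC N) (deligneZero N F') =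
        mapSub (toC N) (deligneZero N F') := by
      have : (I * (1 + (1 : ℝ)) : ℂ) ≠ 0 := by norm_num
      rw [ofReal_one, sub_self, zero_smul, zero_add, mapSub, map_smul, mapSub]
      exact Submodule.map_smul _ _ _ this
    rw [hVt, h1, h2, hM.mapSub_deligneZero]
  · intro S hSpos
    exact mapSub_mem_closure (g := fun t : ℝ => 1 + (t : ℂ) • D.X) h.nondeg
      (hodgePar_mem_Lagr h.alt h.nondeg hD e) hc hG fun t h0 h1 => hSpos _ (hpos t h0 h1)

/-! ### A cycle determines its Lagrangian subspaces -/

/-- The unitary reflection in `v`, as an element of the maximal compact subgroup. On the conjugate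
Lagrangian subspace it is the reflection in `conj v`. -/
theorem exists_reflection {Q : Matrix ι ι ℤ} (hQ : Qᵀ = -Q) (hQ' : Q.det ≠ 0) {d : ℤ →₀ ℕ}
    {F : Filt ι} (hF : F ∈ PeriodDomain Q d) {e : ℤ} {v : ι → ℂ} (hv : v ∈ hodgePar e F)
    (hv0 : form Q v (conjVec v) ≠ 0) :
    ∃ k ∈ maxCompact Q F, ∀ x ∈ hodgePar e F,
      toC k *ᵥ x = x - (2 * (form Q x (conjVec v) / form Q v (conjVec v))) • v := by
  have hd := CompactDual.dualFilt hQ hQ' hF.1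
  let L : (ι → ℂ) →ₗ[ℂ] (ι → ℂ) := LinearMap.id -
    (2 / form Q v (conjVec v)) • (((formL Q).flip (conjVec v)).smulRight v) +
    (2 / form Q v (conjVec v)) • (((formL Q).flip v).smulRight (conjVec v))
  have hL : ∀ x, LinearMap.toMatrix' L *ᵥ x = x - (2 / form Q v (conjVec v) *
      form Q x (conjVec v)) • v + (2 / form Q v (conjVec v) * form Q x v) • conjVec v := by
    intro x
    rw [← toLin'_apply, toLin'_toMatrix']
    simp [L, smul_smul]
  have hc : (starRingEnd ℂ) (form Q v (conjVec v)) = -form Q v (conjVec v) := by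
    rw [eq_neg_iff_add_eq_zero, add_comm, ← eq_neg_iff_add_eq_zero]
    exact form_conj_swap hQ v v
  obtain ⟨k, hk⟩ := exists_toC_eq (A := LinearMap.toMatrix' L) (fun x => by
    rw [hL, hL]
    simp only [conjVec_add, conjVec_sub, conjVec_smul, conjVec_conjVec, map_mul, map_div₀, hc,
      form_conjVec_left, Complex.conj_conj, map_ofNat, div_neg, neg_mul, neg_smul]
    abel)
  have hkx : ∀ x, toC k *ᵥ x = x - (2 / form Q v (conjVec v) * form Q x (conjVec v)) • v +
      (2 / form Q v (conjVec v) * form Q x v) • conjVec v := fun x => by rw [hk, hL]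
  have hGR : k ∈ GR Q := by
    rw [← toC_mem_GC_iff, mem_GC_iff]
    intro x y
    have hvv := form_self hQ v
    have hvv' := form_self hQ (conjVec v)
    have h1 := form_swap hQ (conjVec v) v
    have h2 := form_swap hQ v y
    have h3 := form_swap hQ (conjVec v) y
    simp only [hkx, form_add_left, form_add_right, form_sub_left, form_sub_right, form_smul_left,
      form_smul_right, hvv, hvv', h1, h2, h3]
    field_simp
    ring
  have hsq : toC k * toC k = 1 := by
    apply Matrix.ext_of_mulVec_single
    intro i
    rw [← mulVec_mulVec, one_mulVec, hkx, hkx]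
    have h1 := form_swap hQ (conjVec v) v
    simp only [form_add_left, form_sub_left, form_smul_left, form_self hQ, h1]
    generalize form Q (Pi.single i 1) v = s
    generalize form Q (Pi.single i 1) (conjVec v) = t
    rw [sub_eq_add_neg, ← neg_smul, sub_eq_add_neg, ← neg_smul]
    generalize form Q v (conjVec v) = r at hv0
    have e1 : -(2 / r * (t - 2 / r * t * r + 2 / r * s * 0)) = 2 / r * t := by
      field_simp
      ring
    have e2 : 2 / r * (s - 2 / r * t * 0 + 2 / r * s * -r) = -(2 / r * s) := by
      field_simp
      ring
    rw [e1, e2]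
    module
  have hle : ∀ e', Even (e' + e) → ∀ x ∈ hodgePar e' F,
      toC k *ᵥ x = x - (2 * (form Q x (conjVec v) / form Q v (conjVec v))) • v := by
    intro e' he' x hx
    rw [hodgePar_congr he'] at hx
    rw [hkx, hodgePar_isotropic hd hx hv, mul_zero, zero_smul, add_zero, div_mul_eq_mul_div,
      mul_div_assoc]
  have hvc : conjVec v ∈ hodgePar (e + 1) F := by
    rw [← conjSub_hodgePar]; simpa using hv
  have hstab : ∀ x ∈ hodgePar 0 F, toC k *ᵥ x ∈ hodgePar 0 F := by
    intro x hx
    rcases Int.even_or_odd e with he | he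
    · rw [hle 0 (by simpa using he) x hx]
      rw [hodgePar_congr (e' := e) (by simpa using he)] at hx ⊢
      exact Submodule.sub_mem _ hx (Submodule.smul_mem _ _ hv)
    · have he' : Even (0 + (e + 1)) := by rw [zero_add]; exact he.add_one
      rw [hodgePar_congr he'] at hx ⊢
      rw [hkx, hodgePar_isotropic hd hx hvc, mul_zero, zero_smul, sub_zero]
      exact Submodule.add_mem _ hx (Submodule.smul_mem _ _ hvc)
  refine ⟨k, ⟨hGR, ?_⟩, fun x hx => hle e (Even.add_self e) x hx⟩
  rw [hodgeEv_eq]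
  refine le_antisymm (mapSub_le.2 hstab) fun x hx => mem_mapSub.2 ⟨_, hstab x hx, ?_⟩
  rw [mulVec_mulVec, hsq, one_mulVec]

theorem form_conj_ne_zero {Q : Matrix ι ι ℤ} (hQ : Qᵀ = -Q) (hQ' : Q.det ≠ 0) {d : ℤ →₀ ℕ}
    {F : Filt ι} (hF : F ∈ PeriodDomain Q d) {e : ℤ} {v : ι → ℂ} (hv : v ∈ hodgePar e F)
    (hv0 : v ≠ 0) : form Q v (conjVec v) ≠ 0 := by
  intro h0
  have := isPos_hodgePar hQ hQ' hF e v hv hv0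
  rw [h0, mul_zero, zero_re] at this
  exact lt_irrefl _ this

/-- The maximal compact subgroup acts irreducibly on either Lagrangian subspace. -/
theorem mem_of_maxCompact_orbit {Q : Matrix ι ι ℤ} (hQ : Qᵀ = -Q) (hQ' : Q.det ≠ 0) {d : ℤ →₀ ℕ}
    {F : Filt ι} (hF : F ∈ PeriodDomain Q d) {e : ℤ} {a : ι → ℂ} (ha : a ∈ hodgePar e F)
    (ha0 : a ≠ 0) {S : Submodule ℂ (ι → ℂ)} (hS : ∀ k ∈ maxCompact Q F, toC k *ᵥ a ∈ S) :
    hodgePar e F ≤ S := by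
  have haS : a ∈ S := by
    simpa using hS 1 ⟨by simp [GR], by rw [toC_one, mapSub_one]⟩
  -- `a` minus its reflection in `v` is a multiple of `v`
  have key : ∀ v ∈ hodgePar e F, form Q a (conjVec v) ≠ 0 → v ∈ S := by
    intro v hv hav
    have hv0 : v ≠ 0 := by
      rintro rfl
      rw [conjVec_zero, form_zero_right] at hav
      exact hav rfl
    have hvv := form_conj_ne_zero hQ hQ' hF hv hv0
    obtain ⟨k, hk, hkx⟩ := exists_reflection hQ hQ' hF hv hvv
    have h1 := Submodule.sub_mem _ haS (hS k hk)
    rw [hkx a ha, sub_sub_cancel] at h1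
    exact (Submodule.smul_mem_iff _ (mul_ne_zero two_ne_zero (div_ne_zero hav hvv))).1 h1
  intro b hb
  by_cases hab : form Q a (conjVec b) = 0
  · have h1 := key (a + b) (Submodule.add_mem _ ha hb) (by
      rw [conjVec_add, form_add_right, hab, add_zero]
      exact form_conj_ne_zero hQ hQ' hF ha ha0)
    simpa using Submodule.sub_mem _ h1 haS
  · exact key b hb hab

/-- A quadratic form on one of the Lagrangian subspaces that vanishes on an orbit of the maximal
compact subgroup vanishes. -/
theorem quadratic_eq_zero {Q : Matrix ι ι ℤ} (hQ : Qᵀ = -Q) (hQ' : Q.det ≠ 0) {d : ℤ →₀ ℕ}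
    {F : Filt ι} (hF : F ∈ PeriodDomain Q d) {e : ℤ} {a : ι → ℂ} (ha : a ∈ hodgePar e F)
    (ha0 : a ≠ 0) (β : (ι → ℂ) →ₗ[ℂ] (ι → ℂ) →ₗ[ℂ] ℂ)
    (hβ : ∀ x ∈ hodgePar e F, ∀ y ∈ hodgePar e F, β x y = β y x)
    (h0 : ∀ k ∈ maxCompact Q F, β (toC k *ᵥ a) (toC k *ᵥ a) = 0) {x y : ι → ℂ}
    (hx : x ∈ hodgePar e F) (hy : y ∈ hodgePar e F) : β x y = 0 := by
  have haa : β a a = 0 := by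
    simpa using h0 1 ⟨by simp [GR], by rw [toC_one, mapSub_one]⟩
  have hEa := form_conj_ne_zero hQ hQ' hF ha ha0
  -- the value of `β` at the reflection of `a` in `v`
  have key : ∀ v ∈ hodgePar e F, form Q a (conjVec v) ≠ 0 →
      form Q v (conjVec v) * β a v = form Q a (conjVec v) * β v v := by
    intro v hv hav
    have hv0 : v ≠ 0 := by
      rintro rfl
      rw [conjVec_zero, form_zero_right] at hav
      exact hav rfl
    have hvv := form_conj_ne_zero hQ hQ' hF hv hv0
    obtain ⟨k, hk, hkx⟩ := exists_reflection hQ hQ' hF hv hvv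
    have h1 := h0 k hk
    rw [hkx a ha] at h1
    simp only [map_sub, map_smul, LinearMap.sub_apply, LinearMap.smul_apply, smul_eq_mul, haa,
      hβ v hv a ha] at h1
    field_simp at h1
    have h2 : 4 * form Q a (conjVec v) *
        (form Q v (conjVec v) * β a v - form Q a (conjVec v) * β v v) = 0 := by
      linear_combination -h1
    rcases mul_eq_zero.1 h2 with h3 | h3
    · exact absurd h3 (mul_ne_zero (by norm_num) hav)
    · exact sub_eq_zero.1 h3
  -- for `b` orthogonal to `a`, the reflections in `b + ta` with `t = 1, -1, 2` give enough
  -- equations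
  have horth : ∀ b ∈ hodgePar e F, form Q a (conjVec b) = 0 → β a b = 0 ∧ β b b = 0 := by
    intro b hb hab
    have hba : form Q b (conjVec a) = 0 := by
      rw [form_conj_swap hQ, hab, map_zero, neg_zero]
    have h1 : ∀ t : ℝ, t ≠ 0 → (form Q b (conjVec b) + t ^ 2 * form Q a (conjVec a)) * β a b =
        t * form Q a (conjVec a) * (β b b + 2 * t * β a b) := by
      intro t ht
      have := key (b + (t : ℂ) • a) (Submodule.add_mem _ hb (Submodule.smul_mem _ _ ha)) (by
        rw [conjVec_add, conjVec_smul, form_add_right, form_smul_right, hab, zero_add, conj_ofReal]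
        exact mul_ne_zero (ofReal_ne_zero.2 ht) hEa)
      simp only [conjVec_add, conjVec_smul, form_add_right, form_add_left, form_smul_right,
        form_smul_left, map_add, map_smul, LinearMap.add_apply, LinearMap.smul_apply, smul_eq_mul,
        hab, hba, haa, conj_ofReal, hβ b hb a ha] at this
      linear_combination this
    have e1 := h1 1 one_ne_zero
    have e2 := h1 (-1) (by norm_num)
    have e3 := h1 2 two_ne_zero
    push_cast at e1 e2 e3
    have hbb : β b b = 0 := by
      have : form Q a (conjVec a) * β b b = 0 := by linear_combination (e2 - e1) / 2
      exact (mul_eq_zero.1 this).resolve_left hEa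
    have hab' : β a b = 0 := by
      have : form Q a (conjVec a) * β a b = 0 := by
        rw [hbb] at e1 e3
        linear_combination (e1 - e3) / 3
      exact (mul_eq_zero.1 this).resolve_left hEa
    exact ⟨hab', hbb⟩
  have hq : ∀ x ∈ hodgePar e F, β x x = 0 := by
    intro x hx
    have hb : x - (form Q x (conjVec a) / form Q a (conjVec a)) • a ∈ hodgePar e F :=
      Submodule.sub_mem _ hx (Submodule.smul_mem _ _ ha)
    obtain ⟨h1, h2⟩ := horth _ hb (by
      rw [form_conj_swap hQ, form_sub_left, form_smul_left, div_mul_cancel₀ _ hEa, sub_self,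
        map_zero, neg_zero])
    simp only [map_sub, map_smul, LinearMap.sub_apply, LinearMap.smul_apply, smul_eq_mul, haa,
      hβ x hx a ha] at h1 h2
    linear_combination h2 + 2 * (form Q x (conjVec a) / form Q a (conjVec a)) * h1
  have h1 := hq (x + y) (Submodule.add_mem _ hx hy)
  simp only [map_add, LinearMap.add_apply, hq x hx, hq y hy, hβ y hy x hx] at h1
  linear_combination h1 / 2

theorem mulVec_mem_hodgePar_of_maxCompact {Q : Matrix ι ι ℤ} {F : Filt ι} (e : ℤ) {k : Matrix ι ι ℝ}
    (hk : k ∈ maxCompact Q F) {p : ℤ} {x : ι → ℂ} (hx : x ∈ hodge F p) (hp : Even (p + e)) :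
    toC k *ᵥ x ∈ hodgePar e F := by
  rw [← mapSub_hodgePar_of_maxCompact hk e]
  exact mulVec_mem_mapSub _ (hodge_le_hodgePar hp F hx)

theorem hodge_ne_bot {Q : Matrix ι ι ℤ} {d : ℤ →₀ ℕ} {F : Filt ι} (hF : F ∈ PeriodDomain Q d)
    {p : ℤ} (hp : d p ≠ 0) : hodge F p ≠ ⊥ := by
  intro h0
  have h1 := le_hodge_sup hF p
  rw [h0, bot_sup_eq] at h1
  have h2 := Submodule.finrank_mono h1
  rw [hF.1.2.1, hF.1.2.1] at h2
  refine absurd h2 (not_le.2 ?_)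
  refine Finset.sum_lt_sum_of_subset (i := p) ?_ ?_ ?_ (Nat.pos_of_ne_zero hp) (by simp)
  · intro r hr
    simp only [Finset.mem_filter] at hr ⊢
    exact ⟨hr.1, by omega⟩
  · simp [hp]
  · simp

/-- For the top index `p` the images of `F^p` under the maximal compact subgroup span one of the
Lagrangian subspaces. -/
theorem mapSub_hodgePar_le_top {Q : Matrix ι ι ℤ} (hQ : Qᵀ = -Q) (hQ' : Q.det ≠ 0) {d : ℤ →₀ ℕ}
    {F F' : Filt ι} (hF : F ∈ PeriodDomain Q d) (hF' : F' ∈ PeriodDomain Q d) {g : Matrix ι ι ℂ}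
    (hC : translate g (baseCycle Q F) ⊆ baseCycle Q F') {p : ℤ} (hp : d p ≠ 0)
    (htop : ∀ r, p < r → d r = 0) :
    mapSub g (hodgePar p F) ≤ hodgePar p F' := by
  obtain ⟨a, ha, ha0⟩ := Submodule.exists_mem_ne_zero_of_ne_bot (hodge_ne_bot hF hp)
  have hF'p : F' (p + 1) = ⊥ := by
    rw [← Submodule.finrank_eq_zero (R := ℂ), hF'.1.2.1]
    exact Finset.sum_eq_zero fun r hr => htop r (by simp at hr; omega)
  have h1 : hodgePar p F ≤ (hodgePar p F').comap (toLin' g) := by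
    refine mem_of_maxCompact_orbit hQ hQ' hF (hodge_le_hodgePar (Even.add_self p) F ha) ha0
      fun k hk => ?_
    obtain ⟨k', hk', he⟩ := hC ⟨_, ⟨k, hk, rfl⟩, rfl⟩
    have h2 : g *ᵥ (toC k *ᵥ a) ∈ act (toC k') F' p := by
      rw [← he]
      exact mulVec_mem_mapSub _ (mulVec_mem_mapSub _ ha.1)
    obtain ⟨v, hv, hva⟩ := mem_mapSub.1 h2
    rw [Submodule.mem_comap, toLin'_apply, ← hva]
    have h3 := le_hodge_sup hF' p hv
    rw [hF'p, sup_bot_eq] at h3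
    exact mulVec_mem_hodgePar_of_maxCompact p hk' h3 (Even.add_self p)
  exact mapSub_le.2 fun v hv => by
    have := h1 hv
    rwa [Submodule.mem_comap, toLin'_apply] at this

theorem eq_of_mapSub_hodgePar_le {Q : Matrix ι ι ℤ} (hQ : Qᵀ = -Q) (hQ' : Q.det ≠ 0) {d : ℤ →₀ ℕ}
    {F F' : Filt ι} (hF : F ∈ PeriodDomain Q d) (hF' : F' ∈ PeriodDomain Q d) {g : Matrix ι ι ℂ}
    (hg : g ∈ GC Q) {e : ℤ} (h : mapSub g (hodgePar e F) ≤ hodgePar e F') :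
    mapSub g (hodgePar e F) = hodgePar e F' := by
  refine Submodule.eq_of_le_of_finrank_eq h ?_
  have h1 := (mapSub_mem_Lagr hQ' (hodgePar_mem_Lagr hQ hQ' hF e) hg).1
  have h2 := (hodgePar_mem_Lagr hQ hQ' hF' e).1
  omega

/-- If the cycles have one Lagrangian subspace in common, and the other parity occurs in `F^0`, they
have both in common: the failure of `g` to map `V` to `V'` is measured by a quadratic form on `V`,
which vanishes on the `K`-orbit of `V ∩ F^0` because all members of the cycle are isotropic. -/
theorem mapSub_hodgePar_le_of_succ {Q : Matrix ι ι ℤ} (hQ : Qᵀ = -Q) (hQ' : Q.det ≠ 0) {d : ℤ →₀ ℕ}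
    {F F' : Filt ι} (hF : F ∈ PeriodDomain Q d) (hF' : F' ∈ PeriodDomain Q d) {g : Matrix ι ι ℂ}
    (hg : g ∈ GC Q) (hC : translate g (baseCycle Q F) ⊆ baseCycle Q F') {e : ℤ}
    (hW : mapSub g (hodgePar (e + 1) F) = hodgePar (e + 1) F') {p : ℤ} (hp0 : 0 ≤ p)
    (hp : d p ≠ 0) (hpe : Even (p + e)) :
    mapSub g (hodgePar e F) ≤ hodgePar e F' := by
  have hd := CompactDual.dualFilt hQ hQ' hF.1
  have hd' := CompactDual.dualFilt hQ hQ' hF'.1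
  have hgf := mem_GC_iff.1 hg
  obtain ⟨a, ha, ha0⟩ := Submodule.exists_mem_ne_zero_of_ne_bot (hodge_ne_bot hF hp)
  have hc : IsCompl (hodgePar (e + 1) F') (hodgePar e F') := by
    refine ⟨?_, codisjoint_iff.2 ((sup_comm _ _).trans (hodgePar_sup hQ hQ' hF' e))⟩
    rw [Submodule.disjoint_def]
    intro x hx1 hx2
    by_contra hx0
    exact lt_asymm (isPos_hodgePar hQ hQ' hF' e x hx2 hx0)
      (isPos_succ_iff.1 (isPos_hodgePar hQ hQ' hF' (e + 1)) x hx1 hx0)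
  -- the projection to `W'` along `V'`
  let π := (hodgePar (e + 1) F').subtype.comp
    ((hodgePar (e + 1) F').projectionOnto (hodgePar e F') hc)
  have hπ : ∀ x, π x ∈ hodgePar (e + 1) F' := fun x => Subtype.property _
  have hπ_add : ∀ v ∈ hodgePar e F', ∀ w ∈ hodgePar (e + 1) F', π (v + w) = w := by
    intro v hv w hw
    rw [map_add]
    simp only [π, LinearMap.comp_apply, Submodule.subtype_apply,
      Submodule.projectionOnto_apply_of_mem_right hc hv,
      Submodule.projectionOnto_apply_of_mem_left hc hw]
    simp
  have hdec : ∀ x, ∃ v ∈ hodgePar e F', ∃ w ∈ hodgePar (e + 1) F', v + w = x := by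
    intro x
    have hx : x ∈ hodgePar e F' ⊔ hodgePar (e + 1) F' := by
      rw [hodgePar_sup hQ hQ' hF' e]; trivial
    exact Submodule.mem_sup.1 hx
  -- `β` is symmetric since `g V` is isotropic, and it vanishes if and only if `g V ⊆ V'`
  let β := (formL Q).compl₁₂ (toLin' g) (π.comp (toLin' g))
  have hβ : ∀ x y, β x y = form Q (g *ᵥ x) (π (g *ᵥ y)) := fun x y => by
    simp [β, toLin'_apply]
  have hzero : ∀ x ∈ hodgePar e F, ∀ y ∈ hodgePar e F, β x y = 0 := by
    intro x hx y hy
    refine quadratic_eq_zero hQ hQ' hF (hodge_le_hodgePar hpe F ha) ha0 β ?_ ?_ hx hy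
    · intro x hx y hy
      have h1 : form Q (g *ᵥ x) (g *ᵥ y) = 0 := by rw [hgf, hodgePar_isotropic hd hx hy]
      rw [hβ, hβ]
      obtain ⟨v, hv, w, hw, hvw⟩ := hdec (g *ᵥ x)
      obtain ⟨v', hv', w', hw', hvw'⟩ := hdec (g *ᵥ y)
      rw [← hvw, ← hvw'] at h1 ⊢
      rw [hπ_add v hv w hw, hπ_add v' hv' w' hw']
      simp only [form_add_left, form_add_right, hodgePar_isotropic hd' hv hv',
        hodgePar_isotropic hd' hw hw', hodgePar_isotropic hd' hw' hw] at h1 ⊢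
      rw [form_swap hQ v' w]
      linear_combination h1
    · intro k hk
      rw [hβ]
      obtain ⟨k', hk', he⟩ := hC ⟨_, ⟨k, hk, rfl⟩, rfl⟩
      have h2 : g *ᵥ (toC k *ᵥ a) ∈ act (toC k') F' 0 := by
        rw [← he]
        exact mulVec_mem_mapSub _ (mulVec_mem_mapSub _ (hd.anti hp0 ha.1))
      -- `F'` is split by `V'` and `W'`, so that `v + w ∈ F'^0` implies `w ∈ F'^0`
      obtain ⟨u, hu, hua⟩ := mem_mapSub.1 h2
      obtain ⟨v, hv, w, hw, hvw⟩ := Submodule.mem_sup.1 ((splitBy_hodgePar hQ hQ' hF' e).le 0 hu)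
      have hk'G := mem_GC_iff.1 (toC_mem_GC_iff.2 hk'.1)
      have hkv : toC k' *ᵥ v ∈ hodgePar e F' := by
        rw [← mapSub_hodgePar_of_maxCompact hk' e]; exact mulVec_mem_mapSub _ hv.2
      have hkw : toC k' *ᵥ w ∈ hodgePar (e + 1) F' := by
        rw [← mapSub_hodgePar_of_maxCompact hk' (e + 1)]; exact mulVec_mem_mapSub _ hw.2
      rw [← hua, ← hvw, mulVec_add, hπ_add _ hkv _ hkw, ← mulVec_add, hk'G]
      exact hd'.form_eq_zero (by norm_num) (Submodule.add_mem _ hv.1 hw.1) hw.1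
  rw [mapSub_le]
  intro y hy
  have h1 : π (g *ᵥ y) = 0 := by
    apply form_nondeg_right hQ hQ'
    intro z
    -- `π (g y)` is orthogonal to `g V` as well as to `g W`
    have hu := (Matrix.isUnit_iff_isUnit_det g).1 (isUnit_of_mem_GC hQ' hg)
    have hz : g⁻¹ *ᵥ z ∈ hodgePar e F ⊔ hodgePar (e + 1) F := by
      rw [hodgePar_sup hQ hQ' hF e]; trivial
    obtain ⟨v, hv, w, hw, hvw⟩ := Submodule.mem_sup.1 hz
    have hz' : z = g *ᵥ v + g *ᵥ w := by
      rw [← mulVec_add, hvw, mulVec_mulVec, Matrix.mul_nonsing_inv _ hu, one_mulVec]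
    rw [hz', form_add_left, ← hβ, hzero v hv y hy, zero_add]
    refine hodgePar_isotropic hd' ?_ (hπ _)
    rw [← hW]
    exact mulVec_mem_mapSub _ hw
  obtain ⟨v, hv, w, hw, hvw⟩ := hdec (g *ᵥ y)
  rw [← hvw, hπ_add v hv w hw] at h1
  rw [← hvw, h1, add_zero]
  exact hv

/-- A translate `g C_F` determines `g V`, where `V` is the Lagrangian subspace of a parity that
occurs in `F^0`. -/
theorem mapSub_hodgePar_eq {Q : Matrix ι ι ℤ} (hQ : Qᵀ = -Q) (hQ' : Q.det ≠ 0) {d : ℤ →₀ ℕ}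
    {F F' : Filt ι} (hF : F ∈ PeriodDomain Q d) (hF' : F' ∈ PeriodDomain Q d) {g g' : Matrix ι ι ℂ}
    (hg : g ∈ GC Q) (hg' : g' ∈ GC Q)
    (hC : translate g (baseCycle Q F) = translate g' (baseCycle Q F')) {e : ℤ}
    (he : ∃ p : ℤ, 0 ≤ p ∧ Even (p + e) ∧ d p ≠ 0) :
    mapSub g (hodgePar e F) = mapSub g' (hodgePar e F') := by
  obtain ⟨p, hp0, hpe, hp⟩ := he
  have hu := (Matrix.isUnit_iff_isUnit_det g').1 (isUnit_of_mem_GC hQ' hg')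
  have hgg : g'⁻¹ * g ∈ GC Q := GC_mul (inv_mem_GC hQ' hg') hg
  have hC' : translate (g'⁻¹ * g) (baseCycle Q F) ⊆ baseCycle Q F' := by
    rintro _ ⟨G, hG, rfl⟩
    have h1 : act g G ∈ translate g' (baseCycle Q F') := by
      rw [← hC]; exact ⟨G, hG, rfl⟩
    obtain ⟨G', hG', h2⟩ := h1
    rw [act_mul, ← h2, ← act_mul, Matrix.nonsing_inv_mul _ hu, act_one]
    exact hG'
  have key : mapSub (g'⁻¹ * g) (hodgePar e F) ≤ hodgePar e F' := by
    obtain ⟨q, hq, hqm⟩ := d.support.exists_max_image id ⟨p, Finsupp.mem_support_iff.2 hp⟩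
    have htop : ∀ r, q < r → d r = 0 := by
      intro r hr
      by_contra h0
      have := hqm r (Finsupp.mem_support_iff.2 h0)
      simp only [id] at this
      omega
    have h1 := mapSub_hodgePar_le_top hQ hQ' hF hF' hC' (Finsupp.mem_support_iff.1 hq) htop
    rcases Int.even_or_odd (q + e) with hqe | hqe
    · rwa [hodgePar_congr hqe, hodgePar_congr hqe] at h1
    · have hqe' : Even (q + (e + 1)) := by rw [← add_assoc]; exact hqe.add_one
      rw [hodgePar_congr hqe', hodgePar_congr hqe'] at h1
      exact mapSub_hodgePar_le_of_succ hQ hQ' hF hF' hgg hC'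
        (eq_of_mapSub_hodgePar_le hQ hQ' hF hF' hgg h1) hp0 hp hpe
  rw [← eq_of_mapSub_hodgePar_le hQ hQ' hF hF' hgg key, ← mapSub_mul,
    Matrix.mul_nonsing_inv_cancel_left _ _ hu]

/-- The chosen representative of the cycle in the definition of `evTranslate` does not matter. -/
theorem evTranslate_eq {Q : Matrix ι ι ℤ} (hQ : Qᵀ = -Q) (hQ' : Q.det ≠ 0) {d : ℤ →₀ ℕ}
    {F : Filt ι} (hF : F ∈ PeriodDomain Q d) {g : Matrix ι ι ℂ} (hg : g ∈ GC Q)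
    (he : ∃ p : ℤ, 0 ≤ p ∧ Even p ∧ d p ≠ 0) :
    evTranslate Q d (translate g (baseCycle Q F)) = mapSub g (hodgePar 0 F) := by
  have hC : ∃ x : Filt ι × Matrix ι ι ℂ, x.1 ∈ PeriodDomain Q d ∧ x.2 ∈ GC Q ∧
      translate g (baseCycle Q F) = translate x.2 (baseCycle Q x.1) := ⟨(F, g), hF, hg, rfl⟩
  rw [evTranslate, dif_pos hC, hodgeEv_eq]
  obtain ⟨h1, h2, h3⟩ := hC.choose_spec
  exact mapSub_hodgePar_eq hQ hQ' h1 hF h2 hg h3.symm (by simpa using he)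

/-- The chosen representative of the cycle in the definition of `odTranslate` does not matter. -/
theorem odTranslate_eq {Q : Matrix ι ι ℤ} (hQ : Qᵀ = -Q) (hQ' : Q.det ≠ 0) {d : ℤ →₀ ℕ}
    {F : Filt ι} (hF : F ∈ PeriodDomain Q d) {g : Matrix ι ι ℂ} (hg : g ∈ GC Q)
    (he : ∃ p : ℤ, 0 ≤ p ∧ Odd p ∧ d p ≠ 0) :
    odTranslate Q d (translate g (baseCycle Q F)) = mapSub g (hodgePar 1 F) := by
  have hC : ∃ x : Filt ι × Matrix ι ι ℂ, x.1 ∈ PeriodDomain Q d ∧ x.2 ∈ GC Q ∧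
      translate g (baseCycle Q F) = translate x.2 (baseCycle Q x.1) := ⟨(F, g), hF, hg, rfl⟩
  rw [odTranslate, dif_pos hC, hodgeOd_eq]
  obtain ⟨h1, h2, h3⟩ := hC.choose_spec
  refine mapSub_hodgePar_eq hQ hQ' h1 hF h2 hg h3.symm ?_
  simpa only [Int.even_add_one, Int.not_even_iff_odd] using he

/-- If `F^0 = 0` then `H = 0`. -/
theorem subsingleton_of_forall_eq_zero {Q : Matrix ι ι ℤ}
    {d : ℤ →₀ ℕ} {F : Filt ι} (hF : F ∈ CompactDual Q d) (hd : ∀ p, 0 ≤ p → d p = 0) :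
    Subsingleton (Submodule ℂ (ι → ℂ)) := by
  have h0 : F 0 = ⊥ := by
    rw [← Submodule.finrank_eq_zero (R := ℂ), hF.2.1]
    exact Finset.sum_eq_zero fun r hr => hd r (by simp at hr; omega)
  have h1 : ∀ x : ι → ℂ, x = 0 := by
    intro x
    rw [← Submodule.mem_bot ℂ, ← h0, hF.2.2]
    intro y hy
    rw [neg_zero, h0, Submodule.mem_bot] at hy
    rw [hy, form_zero_right]
  have : Subsingleton (ι → ℂ) := ⟨fun x y => by rw [h1 x, h1 y]⟩
  infer_instance

/-- The projection `p^ev` in all cases. If no even `p ≥ 0` occurs, the definition falls back on the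
conjugate of `g H^od`, which agrees with `g H^ev` for real `g`; here `g = 1` is assumed. -/
theorem pEv_eq {Q : Matrix ι ι ℤ} (hQ : Qᵀ = -Q) (hQ' : Q.det ≠ 0) {d : ℤ →₀ ℕ}
    {F : Filt ι} (hF : F ∈ PeriodDomain Q d) {g : Matrix ι ι ℂ} (hg : g ∈ GC Q)
    (h1 : (∀ p, 0 ≤ p → Even p → d p = 0) → g = 1) :
    pEv Q d (translate g (baseCycle Q F)) = mapSub g (hodgePar 0 F) := by
  by_cases he : ∃ p : ℤ, 0 ≤ p ∧ Even p ∧ d p ≠ 0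
  · rw [pEv, if_pos he, evTranslate_eq hQ hQ' hF hg he]
  · have he' : ∀ p, 0 ≤ p → Even p → d p = 0 := by push Not at he; exact he
    rw [pEv, if_neg he]
    by_cases ho : ∃ p : ℤ, 0 ≤ p ∧ Odd p ∧ d p ≠ 0
    · rw [odTranslate_eq hQ hQ' hF hg ho, h1 he', mapSub_one, mapSub_one, conjSub_hodgePar,
        hodgePar_congr (e' := 0) (by norm_num)]
    · have ho' : ∀ p, 0 ≤ p → Odd p → d p = 0 := by push Not at ho; exact ho
      have := subsingleton_of_forall_eq_zero hF.1 fun p hp =>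
        (Int.even_or_odd p).elim (he' p hp) (ho' p hp)
      exact Subsingleton.elim _ _

/-- The projection `p^od` in all cases, with the same remark as for `p^ev`. -/
theorem pOd_eq {Q : Matrix ι ι ℤ} (hQ : Qᵀ = -Q) (hQ' : Q.det ≠ 0) {d : ℤ →₀ ℕ}
    {F : Filt ι} (hF : F ∈ PeriodDomain Q d) {g : Matrix ι ι ℂ} (hg : g ∈ GC Q)
    (h1 : (∀ p, 0 ≤ p → Odd p → d p = 0) → g = 1) :
    pOd Q d (translate g (baseCycle Q F)) = mapSub g (hodgePar 1 F) := by
  by_cases ho : ∃ p : ℤ, 0 ≤ p ∧ Odd p ∧ d p ≠ 0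
  · rw [pOd, if_pos ho, odTranslate_eq hQ hQ' hF hg ho]
  · have ho' : ∀ p, 0 ≤ p → Odd p → d p = 0 := by push Not at ho; exact ho
    rw [pOd, if_neg ho]
    by_cases he : ∃ p : ℤ, 0 ≤ p ∧ Even p ∧ d p ≠ 0
    · rw [evTranslate_eq hQ hQ' hF hg he, h1 ho', mapSub_one, mapSub_one, conjSub_hodgePar,
        zero_add]
    · have he' : ∀ p, 0 ≤ p → Even p → d p = 0 := by push Not at he; exact he
      have := subsingleton_of_forall_eq_zero hF.1 fun p hp =>
        (Int.even_or_odd p).elim (he' p hp) (ho' p hp)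
      exact Subsingleton.elim _ _

/-! ### Nilpotent orbits -/

theorem relInt_nonempty (σ : PointedCone ℝ (Matrix ι ι ℝ)) : (relInt σ).Nonempty := by
  let _ : NormedAddCommGroup (Matrix ι ι ℝ) := Matrix.normedAddCommGroup
  let _ : NormedSpace ℝ (Matrix ι ι ℝ) := Matrix.normedSpace
  exact Set.Nonempty.intrinsicInterior (PointedCone.convex σ) ⟨0, σ.zero_mem⟩

/-- Segments can be prolonged beyond a point of the relative interior. -/
theorem exists_prolongation {σ : PointedCone ℝ (Matrix ι ι ℝ)} {N M : Matrix ι ι ℝ}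
    (hN : N ∈ relInt σ) (hM : M ∈ σ) :
    ∃ ε : ℝ, 0 < ε ∧ N + ε • (M - N) ∈ relInt σ ∧ N - ε • (M - N) ∈ relInt σ := by
  obtain ⟨y, hy, rfl⟩ := mem_intrinsicInterior.1 hN
  have hMs : M ∈ affineSpan ℝ (σ : Set (Matrix ι ι ℝ)) := subset_affineSpan _ _ hM
  have hmem : ∀ t : ℝ, (y : Matrix ι ι ℝ) + t • (M - y) ∈
      affineSpan ℝ (σ : Set (Matrix ι ι ℝ)) := by
    intro t
    have := AffineMap.lineMap_mem t y.2 hMs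
    rwa [AffineMap.lineMap_apply, vsub_eq_sub, vadd_eq_add, add_comm] at this
  let f : ℝ → affineSpan ℝ (σ : Set (Matrix ι ι ℝ)) := fun t => ⟨_, hmem t⟩
  have hf : Continuous f := Continuous.subtype_mk (by fun_prop) hmem
  have hf0 : f 0 = y := Subtype.ext (by simp [f])
  have hnhds : f ⁻¹' interior ((↑) ⁻¹' (σ : Set (Matrix ι ι ℝ))) ∈ nhds (0 : ℝ) :=
    (isOpen_interior.preimage hf).mem_nhds (by rw [Set.mem_preimage, hf0]; exact hy)
  obtain ⟨ε, hε, hball⟩ := Metric.mem_nhds_iff.1 hnhds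
  have h1 : ∀ t : ℝ, |t| < ε → (y : Matrix ι ι ℝ) + t • (M - y) ∈ relInt σ := by
    intro t ht
    exact mem_intrinsicInterior.2 ⟨f t, hball (by simpa using ht), rfl⟩
  refine ⟨ε / 2, half_pos hε, h1 _ ?_, ?_⟩
  · rw [abs_of_pos (half_pos hε)]; exact half_lt_self hε
  · have := h1 (-(ε / 2)) (by rw [abs_neg, abs_of_pos (half_pos hε)]; exact half_lt_self hε)
    rwa [neg_smul, ← sub_eq_add_neg] at this

/-- The form `⟨x, N conj x⟩` is semidefinite with radical `Ker N`: all the types `(p, -p)` that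
occur on `Gr_0` have the same parity, and hence the same sign. -/
theorem MixedHodge.form_N_nonneg {Q : Matrix ι ι ℤ} {N : Matrix ι ι ℝ} {F : Filt ι}
    (h : MixedHodge Q N F) {e : ℤ} (he : IsType e N F) (x : ι → ℂ) :
    0 ≤ (I ^ (2 * e) * form Q x (toC N *ᵥ conjVec x)).re ∧
      ((I ^ (2 * e) * form Q x (toC N *ᵥ conjVec x)).re = 0 → toC N *ᵥ x = 0) := by
  obtain ⟨a, ha, b, hb, a', ha', hx⟩ := h.exists_decomp x
  have hNx : toC N *ᵥ x = toC N *ᵥ a := by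
    rw [hx, mulVec_add, mulVec_add, toC_mulVec_mulVec_eq_zero h.sq,
      MixedHodge.deligneOne_ker N F hb, add_zero, add_zero]
  have h1 : form Q x (toC N *ᵥ conjVec x) = form Q a (toC N *ᵥ conjVec a) := by
    rw [← conjVec_toC_mulVec, hNx, conjVec_toC_mulVec, ← neg_inj, ← mem_LieG_iff.1 h.lie, hNx,
      mem_LieG_iff.1 h.lie]
  rw [h1, hNx]
  by_cases ha0 : a = 0
  · simp [ha0, form_zero_left]
  · have := h.pos_deligneZero he ha ha0
    exact ⟨this.le, fun h0 => absurd h0 this.ne'⟩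

namespace IsNilpotentOrbit

variable {Q : Matrix ι ι ℤ} {d : ℤ →₀ ℕ} {σ : PointedCone ℝ (Matrix ι ι ℝ)} {F : Filt ι}

theorem mixedHodge (hσ : IsNilpotentOrbit Q d σ F) (hQ : Qᵀ = -Q) (hQ' : Q.det ≠ 0)
    {N : Matrix ι ι ℝ} (hN : N ∈ relInt σ) (hN2 : N * N = 0) : MixedHodge Q N F := by
  have hNσ : N ∈ σ := intrinsicInterior_subset hN
  have h := OrbitPositivity.of_orbit hQ hQ' hσ.mem_dual (hσ.subset_lie hNσ) hN2
    (hσ.horizontal N hNσ) (hσ.mem_domain N hN)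
  exact ⟨h.toMonodromyFilt, h.isLMHS⟩

/-- The kernels of the elements of the relative interior agree, and all elements of the cone vanish
on them: for `x ∈ Ker N` the form `⟨x, N' conj x⟩` is a nonnegative affine function of `N'` that
vanishes at an inner point. -/
theorem mulVec_eq_zero (hσ : IsNilpotentOrbit Q d σ F) (hQ : Qᵀ = -Q) (hQ' : Q.det ≠ 0) {e : ℤ}
    (htype : ∀ N ∈ relInt σ, N * N = 0 ∧ IsType e N F) {N M : Matrix ι ι ℝ} (hN : N ∈ relInt σ)
    (hM : M ∈ σ) {x : ι → ℂ} (hx : toC N *ᵥ x = 0) : toC M *ᵥ x = 0 := by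
  obtain ⟨ε, hε, h1, h2⟩ := exists_prolongation hN hM
  have hpos : ∀ N' ∈ relInt σ, 0 ≤ (I ^ (2 * e) * form Q x (toC N' *ᵥ conjVec x)).re ∧
      ((I ^ (2 * e) * form Q x (toC N' *ᵥ conjVec x)).re = 0 → toC N' *ᵥ x = 0) :=
    fun N' hN' => (hσ.mixedHodge hQ hQ' hN' (htype N' hN').1).form_N_nonneg (htype N' hN').2 x
  have hxc := ker_conj hx
  have e1 : ∀ y, toC N *ᵥ y = 0 → toC (N + ε • (M - N)) *ᵥ y = (ε : ℂ) • (toC M *ᵥ y) := by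
    intro y hy
    rw [toC_add, toC_smul, toC_sub, add_mulVec, smul_mulVec, sub_mulVec, hy, zero_add, sub_zero]
  have e2 : toC (N - ε • (M - N)) *ᵥ conjVec x = -((ε : ℂ) • (toC M *ᵥ conjVec x)) := by
    rw [toC_sub, toC_smul, toC_sub, sub_mulVec, smul_mulVec, sub_mulVec, hxc, zero_sub, sub_zero]
  have p1 := hpos _ h1
  have p2 := (hpos _ h2).1
  rw [e1 _ hxc, e1 _ hx] at p1
  rw [e2, form_neg_right, mul_neg, neg_re] at p2
  have h3 := p1.2 (le_antisymm (by linarith) p1.1)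
  exact (smul_eq_zero.1 h3).resolve_left (ofReal_ne_zero.2 hε.ne')

/-- All of `σ_ℂ` vanishes on the common kernel of the inner elements. -/
theorem isLowering (hσ : IsNilpotentOrbit Q d σ F) (hQ : Qᵀ = -Q) (hQ' : Q.det ≠ 0) {e : ℤ}
    (htype : ∀ N ∈ relInt σ, N * N = 0 ∧ IsType e N F) {N : Matrix ι ι ℝ} (hN : N ∈ relInt σ)
    {T : Matrix ι ι ℂ} (hT : T ∈ coneC σ) : IsLowering Q N T := by
  refine Submodule.span_induction (p := fun T _ => IsLowering Q N T) ?_ ?_ ?_ ?_ hT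
  · rintro _ ⟨M, hM, rfl⟩
    exact ⟨mem_LieG_iff.1 (hσ.subset_lie hM), fun x hx => hσ.mulVec_eq_zero hQ hQ' htype hN hM hx⟩
  · exact ⟨fun x y => by simp [form_zero_left, form_zero_right], fun x _ => zero_mulVec x⟩
  · intro S T _ _ hS hT
    refine ⟨fun x y => ?_, fun x hx => ?_⟩
    · rw [add_mulVec, add_mulVec, form_add_left, form_add_right, hS.skew, hT.skew]; ring
    · rw [add_mulVec, hS.ker x hx, hT.ker x hx, add_zero]
  · exact fun c T _ hT => hT.smul c

/-- The images of the inner elements agree, being the orthogonal complements of the kernels. -/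
theorem range_eq (hσ : IsNilpotentOrbit Q d σ F) (hQ : Qᵀ = -Q) (hQ' : Q.det ≠ 0) {e : ℤ}
    (htype : ∀ N ∈ relInt σ, N * N = 0 ∧ IsType e N F) {N N' : Matrix ι ι ℝ} (hN : N ∈ relInt σ)
    (hN' : N' ∈ relInt σ) :
    LinearMap.range (toLin' (toC N)) = LinearMap.range (toLin' (toC N')) := by
  have key : ∀ {N N' : Matrix ι ι ℝ}, N ∈ relInt σ → N' ∈ relInt σ →
      LinearMap.range (toLin' (toC N)) ≤ LinearMap.range (toLin' (toC N')) := by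
    rintro N N' hN hN' _ ⟨x, rfl⟩
    have h := hσ.mixedHodge hQ hQ' hN (htype N hN).1
    obtain ⟨w, hw⟩ := exists_mulVec_eq_of_orth_ker hQ hQ'
      (hσ.subset_lie (intrinsicInterior_subset hN' : N' ∈ σ)) (x := toC N *ᵥ x) fun k hk =>
        h.form_N_ker x (hσ.mulVec_eq_zero hQ hQ' htype hN' (intrinsicInterior_subset hN) hk)
    exact ⟨w, by rw [toLin'_apply, toLin'_apply, hw]⟩
  exact le_antisymm (key hN hN') (key hN' hN)

theorem deligneOnePar_eq (hσ : IsNilpotentOrbit Q d σ F) (hQ : Qᵀ = -Q) (hQ' : Q.det ≠ 0) {e : ℤ}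
    (htype : ∀ N ∈ relInt σ, N * N = 0 ∧ IsType e N F) {N N' : Matrix ι ι ℝ} (hN : N ∈ relInt σ)
    (hN' : N' ∈ relInt σ) : deligneOnePar e N F = deligneOnePar e N' F := by
  have key : ∀ p, deligne N F p (-p - 1) = deligne N' F p (-p - 1) := by
    intro p
    ext x
    rw [mem_deligne_neg_one (by omega), mem_deligne_neg_one (by omega)]
    refine and_congr_right fun _ => and_congr_right fun _ => ⟨fun h => ?_, fun h => ?_⟩
    · exact hσ.mulVec_eq_zero hQ hQ' htype hN (intrinsicInterior_subset hN') h
    · exact hσ.mulVec_eq_zero hQ hQ' htype hN' (intrinsicInterior_subset hN) h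
  simp only [deligneOnePar, key]

/-- The limiting mixed Hodge structures of the members of a nilpotent orbit, all of which yield the
same Lagrangian subspace. -/
theorem expOrbit_spec (hσ : IsNilpotentOrbit Q d σ F) (hQ : Qᵀ = -Q) (hQ' : Q.det ≠ 0) {e : ℤ}
    (htype : ∀ N ∈ relInt σ, N * N = 0 ∧ IsType e N F) {N₀ N : Matrix ι ι ℝ} (hN₀ : N₀ ∈ relInt σ)
    (hN : N ∈ relInt σ) {F' : Filt ι} (hF' : F' ∈ expOrbit σ F) :
    MixedHodge Q N F' ∧ IsType e N F' ∧ F' ∈ CompactDual Q d ∧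
      deligneOnePar e N F' ⊔ LinearMap.range (toLin' (toC N)) =
        deligneOnePar e N₀ F ⊔ LinearMap.range (toLin' (toC N₀)) := by
  obtain ⟨T, hT, rfl⟩ := hF'
  have hL := hσ.isLowering hQ hQ' htype hN hT
  have h := hσ.mixedHodge hQ hQ' hN (htype N hN).1
  rw [exp_eq_one_add (hL.sq h.toMonodromyFilt)]
  refine ⟨hL.mixedHodge_act h, fun p hp => hL.deligne_zero_act_eq_bot h ((htype N hN).2 p hp),
    act_mem_CompactDual hQ hQ' hσ.mem_dual (hL.one_add_mem_GC h.toMonodromyFilt), ?_⟩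
  have h1 : ∀ p, deligne N (act (1 + T) F) p (-p - 1) = deligne N F p (-p - 1) := fun p =>
    hL.deligne_act_neg_one h.toMonodromyFilt (by omega)
  rw [hσ.range_eq hQ hQ' htype hN hN₀, ← hσ.deligneOnePar_eq hQ hQ' htype hN hN₀]
  simp only [deligneOnePar, h1]

theorem self_mem_expOrbit (σ : PointedCone ℝ (Matrix ι ι ℝ)) (F : Filt ι) : F ∈ expOrbit σ F :=
  ⟨0, Submodule.zero_mem _, by rw [exp_eq_one_add (by simp), add_zero, act_one]⟩

/-- The theorem for the parity `e`, before the Lagrangian subspace `gV` is identified with the value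
of a projection. -/
theorem boundary (hσ : IsNilpotentOrbit Q d σ F) (hQ : Qᵀ = -Q) (hQ' : Q.det ≠ 0) {e : ℤ}
    (htype : ∀ N ∈ relInt σ, N * N = 0 ∧ IsType e N F) :
    ∃ V : Submodule ℂ (ι → ℂ),
      (∀ S : Set (Lagr Q), (∀ V : Lagr Q, IsPos Q e V.1 → V ∈ S) → V ∈ Subtype.val '' closure S) ∧
      ∀ N ∈ relInt σ, ∀ F' ∈ expOrbit σ F, Nonempty (SL2Data Q d N F') ∧
        (∀ D : SL2Data Q d N F', D.boundaryCycle ∈ CycClosure Q d ∧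
          ∃ g ∈ GC Q, D.boundaryCycle = translate g (baseCycle Q D.basePoint) ∧
            ((∀ p, 0 ≤ p → Even (p + e) → d p = 0) → g = 1) ∧
            D.basePoint ∈ PeriodDomain Q d ∧ mapSub g (hodgePar e D.basePoint) = V) ∧
        V = deligneOnePar e N F' ⊔ LinearMap.range (toLin' (toC N)) := by
  obtain ⟨N₀, hN₀⟩ := relInt_nonempty σ
  refine ⟨deligneOnePar e N₀ F ⊔ LinearMap.range (toLin' (toC N₀)), fun S hS => ?_,
    fun N hN F' hF' => ?_⟩
  · obtain ⟨h, he, hF, -⟩ := hσ.expOrbit_spec hQ hQ' htype hN₀ hN₀ (self_mem_expOrbit σ F)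
    obtain ⟨D⟩ := h.nonempty_SL2Data he hF
    obtain ⟨g, -, -, -, -, -, hV, hcl⟩ := D.boundary h he
    rw [← hV]
    exact hcl S hS
  · obtain ⟨h, he, hF, heq⟩ := hσ.expOrbit_spec hQ hQ' htype hN₀ hN hF'
    refine ⟨h.nonempty_SL2Data he hF, fun D => ?_, heq.symm⟩
    obtain ⟨g, hg, hgD, hg1, hD, hcl, hV, -⟩ := D.boundary h he
    exact ⟨hcl, g, hg, hgD, hg1, hD, hV.trans heq⟩

end IsNilpotentOrbit

theorem deligneOnePar_zero (N : Matrix ι ι ℝ) (F : Filt ι) :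
    deligneOnePar 0 N F = ⨆ (p : ℤ) (_ : Even p), deligne N F p (-p - 1) := by
  simp only [deligneOnePar, add_zero]

theorem deligneOnePar_one (N : Matrix ι ι ℝ) (F : Filt ι) :
    deligneOnePar 1 N F = ⨆ (p : ℤ) (_ : Odd p), deligne N F p (-p - 1) := by
  simp only [deligneOnePar, Int.even_add_one, Int.not_even_iff_odd]

end

end CycleBoundary

theorem theorem2p6 {ι : Type*} [Fintype ι] [DecidableEq ι]
    (Q : Matrix ι ι ℤ) (hQalt : Qᵀ = -Q) (hQ : Q.det ≠ 0) (h : ℤ →₀ ℕ)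
    (σ : PointedCone ℝ (Matrix ι ι ℝ)) (F : CycleBoundary.Filt ι)
    (hσ : CycleBoundary.IsNilpotentOrbit Q h σ F) :
    (CycleBoundary.IsEvenType σ F →
      ∃ V ∈ CycleBoundary.SiegelPosCl Q,
        ∀ N ∈ CycleBoundary.relInt σ, ∀ F' ∈ CycleBoundary.expOrbit σ F,
          Nonempty (CycleBoundary.SL2Data Q h N F') ∧
          (∀ d : CycleBoundary.SL2Data Q h N F',
            d.boundaryCycle ∈ CycleBoundary.CycClosure Q h ∧
            CycleBoundary.pEv Q h d.boundaryCycle = V) ∧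
          V = (⨆ (p : ℤ) (_ : Even p), CycleBoundary.deligne N F' p (-p - 1)) ⊔
            LinearMap.range (Matrix.toLin' (CycleBoundary.toC N))) ∧
    (CycleBoundary.IsOddType σ F →
      ∃ V ∈ CycleBoundary.SiegelNegCl Q,
        ∀ N ∈ CycleBoundary.relInt σ, ∀ F' ∈ CycleBoundary.expOrbit σ F,
          Nonempty (CycleBoundary.SL2Data Q h N F') ∧
          (∀ d : CycleBoundary.SL2Data Q h N F',
            d.boundaryCycle ∈ CycleBoundary.CycClosure Q h ∧
            CycleBoundary.pOd Q h d.boundaryCycle = V) ∧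
          V = (⨆ (p : ℤ) (_ : Odd p), CycleBoundary.deligne N F' p (-p - 1)) ⊔
            LinearMap.range (Matrix.toLin' (CycleBoundary.toC N))) := by
  constructor
  · intro ht
    obtain ⟨V, hV, hall⟩ := hσ.boundary hQalt hQ (e := 0) fun N hN =>
      ⟨(ht N hN).1, fun p hp => (ht N hN).2 p (by simpa using hp)⟩
    refine ⟨V, hV _ fun W hW v hv hv0 => by simpa using hW v hv hv0, fun N hN F' hF' => ?_⟩
    obtain ⟨hne, hd, hV'⟩ := hall N hN F' hF'
    refine ⟨hne, fun D => ?_, by rw [← CycleBoundary.deligneOnePar_zero]; exact hV'⟩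
    obtain ⟨hcl, g, hg, hgD, hg1, hD, hgV⟩ := hd D
    refine ⟨hcl, ?_⟩
    rw [hgD, CycleBoundary.pEv_eq hQalt hQ hD hg (by simpa using hg1), hgV]
  · intro ht
    obtain ⟨V, hV, hall⟩ := hσ.boundary hQalt hQ (e := 1) fun N hN =>
      ⟨(ht N hN).1, fun p hp => (ht N hN).2 p (by
        by_contra h1
        exact Int.not_even_iff_odd.2 hp (Int.not_even_iff_odd.1 h1).add_one)⟩
    refine ⟨V, hV _ fun W hW v hv hv0 => ?_, fun N hN F' hF' => ?_⟩
    · simpa using CycleBoundary.isPos_succ_iff.1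
        (show CycleBoundary.IsPos Q (0 + 1) W.1 from hW) v hv hv0
    obtain ⟨hne, hd, hV'⟩ := hall N hN F' hF'
    refine ⟨hne, fun D => ?_, by rw [← CycleBoundary.deligneOnePar_one]; exact hV'⟩
    obtain ⟨hcl, g, hg, hgD, hg1, hD, hgV⟩ := hd D
    refine ⟨hcl, ?_⟩
    rw [hgD, CycleBoundary.pOd_eq hQalt hQ hD hg (by
      simpa only [Int.even_add_one, Int.not_even_iff_odd] using hg1), hgV]
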